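/- Let $a\ge 0$. For $N\ge 1$ let $p_0,\dots,p_{N-1}$ be the orthonormal polynomials on $\mathbb R$ for the Cauchy weight $w(\lambda)=(1+\lambda^2)^{-N-a}$, let $K_N(x,y)=[w(x)w(y)]^{1/2}\sum_{l=0}^{N-1}p_l(x)p_l(y)$, let $R_{N,s}(x,y)$ be the kernel of the resolvent $K_N(1-K_N)^{-1}$ of the integral operator with kernel $K_N$ on $L^2(s,\infty)$ (it exists and is unique as a function on $\mathbb R^2$ satisfying the resolvent equations everywhere), and put $\sigma_N(s)=(1+s^2)R_{N,s}(s,s)$. Let $E_{N,L}(x)$ be the probability that no eigenvalue has coordinate in $(0,x)$ in the circular Jacobi ensemble on a circle of circumference $L$, that is, for $N$ points $x_1,\dots,x_N\in[0,L)$, $z_l=e^{2\pi i x_l/L}$, with joint density proportional to $\prod_l|1-z_l|^{2a}\prod_{j<k}|z_k-z_j|^2$. Then the following limits exist in the thermodynamic limit $N\to\infty$, $L=N/\rho$. There is a function $\sigma$ on $(0,\infty)$ such that for every density $\rho>0$ and every $x>0$ $$\lim_{N\to\infty}\frac1N\,\sigma_N\Big(\cot\frac{\pi x}{L}\Big)=\sigma(\pi\rho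 x).$$ The function $\tau_a(x)=x\,\sigma(x)$ is twice continuously differentiable on $(0,\infty)$ and satisfies there $$x^2\ddot\tau_a^2-4(x\dot\tau_a-\tau_a)\dot\tau_a^2-4a^2\dot\tau_a^2+4(x\dot\tau_a-\tau_a)^2=0,$$ subject to the boundary condition $$\tau_a(x)\sim\frac{(x/2)^{2a+1}}{\Gamma(a+\frac12)\Gamma(a+\frac32)}\qquad(x\to0^+).$$ Moreover $\tau_a(y)/y$ is integrable on $(0,t)$ for every $t>0$, and $\tau_a$ gives the limiting probability of the gap $(0,x)$ next to the spectrum singularity: for all $\rho>0$ and $x>0$, $$\lim_{N\to\infty}E_{N,N/\rho}(x)=\exp\Big(-\int_0^{\pi\rho x}\frac{\tau_a(y)}{y}\,dy\Big).$$ -/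

import Mathlib

open MeasureTheory Filter Topology Set

noncomputable section

/-! ### The circular Jacobi ensemble and its gap probability -/

/-- The point `e^{2πix/L}` of the unit circle with coordinate `x ∈ [0, L)`. -/
def circlePoint (L x : ℝ) : ℂ := Complex.exp (2 * Real.pi * Complex.I * (x / L))

/-- The unnormalised eigenvalue density
`∏ |1 - z_l|^{2a} ∏_{j<k} |z_k - z_j|²`, `z_l = e^{2πi x_l/L}`, of the circular Jacobi ensemble. -/
def circularJacobiDensity (a L : ℝ) (N : ℕ) (x : Fin N → ℝ) : ℝ :=
  (∏ l, ‖1 - circlePoint L (x l)‖ ^ (2 * a)) *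
    ∏ j, ∏ k ∈ Finset.Ioi j, ‖circlePoint L (x k) - circlePoint L (x j)‖ ^ 2

/-- `E₂(0;(0,x);|1-z|^{2a};N)`: the probability that none of the `N` eigenvalues of the circular
Jacobi ensemble on the circle of circumference `L` has its coordinate in `(0, x)`. -/
def circularJacobiGap (a L : ℝ) (N : ℕ) (x : ℝ) : ℝ :=
  (∫ y in {y : Fin N → ℝ | ∀ l, y l ∈ Ico 0 L ∧ y l ∉ Ioo 0 x}, circularJacobiDensity a L N y) /
    ∫ y in {y : Fin N → ℝ | ∀ l, y l ∈ Ico 0 L}, circularJacobiDensity a L N y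

/-! ### Orthonormal polynomials and the Christoffel–Darboux kernel -/

/-- Monic orthogonal polynomials of the weight `w` on the real line, by Gram–Schmidt
orthogonalisation of `1, X, X², …`. -/
def monicOrthPoly (w : ℝ → ℝ) : ℕ → Polynomial ℝ
  | n => Polynomial.X ^ n - ∑ k : Fin n,
      Polynomial.C ((∫ x, x ^ n * (monicOrthPoly w k).eval x * w x) /
        ∫ x, (monicOrthPoly w k).eval x ^ 2 * w x) * monicOrthPoly w k
  decreasing_by all_goals exact k.isLt

/-- The orthonormal polynomial `p_n` of the weight `w`, with positive leading coefficient. -/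
def orthonormalPoly (w : ℝ → ℝ) (n : ℕ) : Polynomial ℝ :=
  Polynomial.C (Real.sqrt (∫ x, (monicOrthPoly w n).eval x ^ 2 * w x))⁻¹ * monicOrthPoly w n

/-- The correlation kernel `K_N(x,y) = [w(x)w(y)]^{1/2} ∑_{l<N} p_l(x) p_l(y)`. -/
def correlationKernel (w : ℝ → ℝ) (N : ℕ) (x y : ℝ) : ℝ :=
  Real.sqrt (w x * w y) *
    ∑ l ∈ Finset.range N, (orthonormalPoly w l).eval x * (orthonormalPoly w l).eval y

/-! ### Resolvent kernels -/

/-- `R` is the kernel of the resolvent `K (1 - K)⁻¹` of the integral operator on `L²(I)` with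
kernel `K`: that is, `1 + R` is the two-sided inverse of `1 - K`.  The two equations are required
at all real `x, y`, so that for a continuous `K` the values of `R` at an end point of `I` are the
limits of its values inside `I`. -/
structure IsResolventKernel (K : ℝ → ℝ → ℝ) (I : Set ℝ) (R : ℝ → ℝ → ℝ) : Prop where
  memLp_left : ∀ y, MemLp (fun z => R z y) 2 (volume.restrict I)
  memLp_right : ∀ x, MemLp (fun z => R x z) 2 (volume.restrict I)
  eq_left : ∀ x y, R x y = K x y + ∫ z in I, K x z * R z y
  eq_right : ∀ x y, R x y = K x y + ∫ z in I, R x z * K z y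

open Classical in
/-- The resolvent kernel (the zero function if there is none). -/
def resolventKernel (K : ℝ → ℝ → ℝ) (I : Set ℝ) : ℝ → ℝ → ℝ :=
  if h : ∃ R, IsResolventKernel K I R then h.choose else 0

/-! ### The Cauchy ensemble -/

/-- The Cauchy weight `(1 + λ²)^{-N-a}`. -/
def cauchyWeight (a : ℝ) (N : ℕ) (x : ℝ) : ℝ := (1 + x ^ 2) ^ (-(N : ℝ) - a)

/-- The correlation kernel of the Cauchy unitary ensemble of `N` eigenvalues. -/
def cauchyKernel (a : ℝ) (N : ℕ) : ℝ → ℝ → ℝ := correlationKernel (cauchyWeight a N) N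

/-- `σ(s) = (1 + s²) R(s,s)`, where `R` is the resolvent kernel on the interval `(s, ∞)` of the
Cauchy unitary ensemble of `N` eigenvalues. -/
def cauchySigma (a : ℝ) (N : ℕ) (s : ℝ) : ℝ :=
  (1 + s ^ 2) * resolventKernel (cauchyKernel a N) (Ioi s) s s

end

/-!
Everything is expressed through the Hankel matrix `H(s)` of the moments of the Cauchy weight on
`(-∞, s)` and its complete version `H(∞)`. With `m(x) = (1, x, …, x^{N-1})` the correlation kernel
is `√(w(x) w(y)) m(x)ᵀ H(∞)⁻¹ m(y)` and the unique resolvent kernel on `(s, ∞)` is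
`√(w(x) w(y)) m(x)ᵀ H(s)⁻¹ m(y)` (`existsUnique_resolvent`). Hence
`σ_N(s) = (1 + s²) (log det H)'(s)` (`cauchySigma_eq`, `hasDerivAt_gapDet`). On the other hand the
substitution `l = cot (π x / L)` and Andréief's identity turn the gap probability of the circular
Jacobi ensemble into `det H(s) / det H(∞)` at `s = cot (π x / L)` (`circularJacobiGap_eq_gapDet`).
So a limit theorem for one determinant, with derivatives, and a differential equation for finite
`N` are what is needed.

*The equation for finite `N`.* The Pearson equation of the weight is a three term recurrence for
the moments, that is, a commutation relation of `H(s)` with two explicit matrices, `Hankel.shift`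
and `Hankel.rotGen`. It gives a linear system for the two last orthogonal polynomials at the end
point and a conserved quantity (`Hankel.first_integral`). Eliminating, one finds the
Jimbo–Miwa–Okamoto form of Painlevé VI for `σ_N` (`Hankel.sigma_ode`, `odeExpr_eq_zero`).

*The limit.* The inverse of `H(∞)` is given by the Christoffel–Darboux formula and the explicit
pseudo-Jacobi polynomials (`kerCoeff_mul_hankelTotal`). In the variable `T = N / s`, after a diagonal
conjugation and reversal of the indices, `det H(s) / det H(∞) = det (1 - X_N(T))` with a matrix
`X_N(T)` whose entries are holomorphic in `T` for `Re T > 0`, `|T| < N`, whose rows are summable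
uniformly in `N`, and which converges entry by entry (`gapDet_eq_scaledDet`). So the determinants
converge, uniformly near each point of the half plane (`tendsto_scaledDet`), and by holomorphy so do
all their derivatives (`tendsto_deriv_prod`). The limit is positive on the positive axis, being
decreasing, analytic and `1` at the origin (`gap_pos`). Therefore `σ_N(N/T) / N` converges with two
derivatives, to a function `σ(T)`, and the equation passes to the limit (`sigmaLim_ode`). Since
`N tan (t / N) → t`, the argument `cot (t / N)` has `T → t`.

*The boundary condition.* The entry `(0, 0)` dominates as `T → 0` and gives
`1 - κ T^{2a+1} / (2a+1) + O(T^{2a+2})` for the limiting gap probability (`norm_limitGap_sub_le`);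
Cauchy's estimate transfers this to the derivative (`abs_sigmaLim_mul_gap_sub_le`). The constant `κ`
is the limit of the inverse of the scaled norm of the last orthogonal polynomial, found from a
recurrence in `N`, Euler's limit for `Γ` and the duplication formula (`tendsto_kappa`). Finally
`σ` is nonnegative and minus the logarithmic derivative of the gap probability, so it is integrable
up to the origin and the gap probability is `exp (-∫ σ)` (`exp_neg_integral_sigmaLim`).
-/

noncomputable section

/-! ### The Cauchy weight and its moments -/

/-- The incomplete moment `∫_{-∞}^s x^k w(x) dx` of the Cauchy weight. -/
def cauchyMoment (a : ℝ) (N k : ℕ) (s : ℝ) : ℝ := ∫ x in Iic s, x ^ k * cauchyWeight a N x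

/-- The complete moment `∫ x^k w(x) dx` of the Cauchy weight. -/
def cauchyTotal (a : ℝ) (N k : ℕ) : ℝ := ∫ x, x ^ k * cauchyWeight a N x

lemma cauchyWeight_pos (a : ℝ) (N : ℕ) (x : ℝ) : 0 < cauchyWeight a N x :=
  Real.rpow_pos_of_pos (by positivity) _

lemma continuous_cauchyWeight (a : ℝ) (N : ℕ) : Continuous (cauchyWeight a N) := by
  unfold cauchyWeight
  exact Continuous.rpow_const (by fun_prop) fun x => Or.inl (by positivity)

lemma abs_pow_le_one_add_sq_rpow (k : ℕ) (x : ℝ) : |x ^ k| ≤ (1 + x ^ 2) ^ ((k : ℝ) / 2) := by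
  have h : |x| ≤ (1 + x ^ 2) ^ ((1 : ℝ) / 2) := by
    rw [← Real.sqrt_eq_rpow]
    exact Real.abs_le_sqrt (by linarith)
  calc |x ^ k| = |x| ^ k := abs_pow x k
    _ ≤ ((1 + x ^ 2) ^ ((1 : ℝ) / 2)) ^ k := by gcongr
    _ = _ := by rw [← Real.rpow_natCast, ← Real.rpow_mul (by positivity)]; ring_nf

lemma abs_pow_mul_cauchyWeight_le (a : ℝ) (N k : ℕ) (x : ℝ) :
    |x ^ k * cauchyWeight a N x| ≤ (1 + x ^ 2) ^ ((k : ℝ) / 2 - N - a) := by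
  rw [abs_mul, abs_of_pos (cauchyWeight_pos a N x)]
  refine (mul_le_mul_of_nonneg_right (abs_pow_le_one_add_sq_rpow k x)
    (cauchyWeight_pos a N x).le).trans_eq ?_
  rw [cauchyWeight, ← Real.rpow_add (by positivity)]
  ring_nf

lemma integrable_pow_mul_cauchyWeight {a : ℝ} {N k : ℕ} (h : (k : ℝ) + 1 < 2 * (N + a)) :
    Integrable fun x => x ^ k * cauchyWeight a N x := by
  have h1 : Integrable fun x : ℝ => (1 + ‖x‖ ^ 2) ^ (-(2 * (N + a) - k) / 2) :=
    integrable_rpow_neg_one_add_norm_sq (by simp; linarith)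
  refine h1.mono' (by have := continuous_cauchyWeight a N; fun_prop) (ae_of_all _ fun x => ?_)
  rw [Real.norm_eq_abs]
  refine (abs_pow_mul_cauchyWeight_le a N k x).trans_eq ?_
  rw [Real.norm_eq_abs, sq_abs]
  ring_nf

lemma hasDerivAt_cauchyWeight (a : ℝ) (N : ℕ) (x : ℝ) :
    HasDerivAt (cauchyWeight a N) (-(2 * (N + a) * x / (1 + x ^ 2)) * cauchyWeight a N x) x := by
  have h0 : (0 : ℝ) < 1 + x ^ 2 := by positivity
  have h1 : HasDerivAt (fun x : ℝ => 1 + x ^ 2) (2 * x) x := by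
    simpa using (hasDerivAt_pow 2 x).const_add 1
  have := h1.rpow_const (p := -(N : ℝ) - a) (Or.inl h0.ne')
  refine this.congr_deriv ?_
  rw [Real.rpow_sub_one h0.ne', cauchyWeight]
  field_simp
  ring

/-- The Pearson equation of the Cauchy weight, tested against monomials. -/
lemma hasDerivAt_pearson (a : ℝ) (N k : ℕ) (x : ℝ) :
    HasDerivAt (fun x => x ^ k * (1 + x ^ 2) * cauchyWeight a N x)
      (k * (x ^ (k - 1) * cauchyWeight a N x)
        + (k + 2 - 2 * (N + a)) * (x ^ (k + 1) * cauchyWeight a N x)) x := by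
  have h0 : (0 : ℝ) < 1 + x ^ 2 := by positivity
  have h1 : HasDerivAt (fun x : ℝ => 1 + x ^ 2) (2 * x) x := by
    simpa using (hasDerivAt_pow 2 x).const_add 1
  have := ((hasDerivAt_pow k x).mul h1).mul (hasDerivAt_cauchyWeight a N x)
  refine this.congr_deriv ?_
  rcases k with _ | k
  · simp; field_simp; ring
  · simp only [Pi.mul_apply, Nat.add_sub_cancel, Nat.cast_add, Nat.cast_one]
    field_simp
    ring

lemma tendsto_pearson_cocompact {a : ℝ} {N k : ℕ} (h : (k : ℝ) + 2 < 2 * (N + a)) :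
    Tendsto (fun x => x ^ k * (1 + x ^ 2) * cauchyWeight a N x) (cocompact ℝ) (𝓝 0) := by
  have hp : 0 < (N + a) - (k : ℝ) / 2 - 1 := by linarith
  have h1 : Tendsto (fun x : ℝ => 1 + x ^ 2) (cocompact ℝ) atTop := by
    refine tendsto_atTop_add_const_left _ _ ?_
    have : Tendsto (fun x : ℝ => ‖x‖ ^ 2) (cocompact ℝ) atTop :=
      (tendsto_pow_atTop two_ne_zero).comp (tendsto_norm_cocompact_atTop)
    simpa using this
  have h2 := (tendsto_rpow_neg_atTop hp).comp h1
  refine squeeze_zero_norm (fun x => ?_) h2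
  rw [Real.norm_eq_abs, show x ^ k * (1 + x ^ 2) * cauchyWeight a N x
    = (1 + x ^ 2) * (x ^ k * cauchyWeight a N x) by ring, abs_mul,
    abs_of_pos (by positivity : (0 : ℝ) < 1 + x ^ 2)]
  have h0 : (0 : ℝ) < 1 + x ^ 2 := by positivity
  calc (1 + x ^ 2) * |x ^ k * cauchyWeight a N x|
      ≤ (1 + x ^ 2) ^ (1 : ℝ) * (1 + x ^ 2) ^ ((k : ℝ) / 2 - N - a) := by
        rw [Real.rpow_one]
        gcongr
        exact abs_pow_mul_cauchyWeight_le a N k x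
    _ = _ := by
        rw [← Real.rpow_add h0]
        simp only [Function.comp]
        ring_nf

lemma integrable_pearson {a : ℝ} {N k : ℕ} (h : (k : ℝ) + 2 < 2 * (N + a)) :
    Integrable fun x => k * (x ^ (k - 1) * cauchyWeight a N x)
        + (k + 2 - 2 * (N + a)) * (x ^ (k + 1) * cauchyWeight a N x) := by
  refine Integrable.add (Integrable.const_mul (integrable_pow_mul_cauchyWeight ?_) _)
    (Integrable.const_mul (integrable_pow_mul_cauchyWeight (by push_cast; linarith)) _)
  have : ((k - 1 : ℕ) : ℝ) ≤ k := by exact_mod_cast Nat.sub_le k 1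
  linarith

lemma cauchyMoment_rec {a : ℝ} {N k : ℕ} (h : (k : ℝ) + 2 < 2 * (N + a)) (s : ℝ) :
    k * cauchyMoment a N (k - 1) s + (k + 2 - 2 * (N + a)) * cauchyMoment a N (k + 1) s
      = s ^ k * (1 + s ^ 2) * cauchyWeight a N s := by
  have hk : ((k - 1 : ℕ) : ℝ) ≤ k := by exact_mod_cast Nat.sub_le k 1
  have h1 : IntegrableOn (fun x => x ^ (k - 1) * cauchyWeight a N x) (Iic s) :=
    (integrable_pow_mul_cauchyWeight (by linarith)).integrableOn
  have h2 : IntegrableOn (fun x => x ^ (k + 1) * cauchyWeight a N x) (Iic s) :=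
    (integrable_pow_mul_cauchyWeight (by push_cast; linarith)).integrableOn
  have := integral_Iic_of_hasDerivAt_of_tendsto' (a := s)
    (fun x _ => hasDerivAt_pearson a N k x) (integrable_pearson h).integrableOn
    ((tendsto_pearson_cocompact h).mono_left atBot_le_cocompact)
  rw [integral_add (h1.const_mul _) (h2.const_mul _), integral_const_mul,
    integral_const_mul, sub_zero] at this
  exact this

lemma cauchyTotal_rec {a : ℝ} {N k : ℕ} (h : (k : ℝ) + 2 < 2 * (N + a)) :
    k * cauchyTotal a N (k - 1) + (k + 2 - 2 * (N + a)) * cauchyTotal a N (k + 1) = 0 := by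
  have hk : ((k - 1 : ℕ) : ℝ) ≤ k := by exact_mod_cast Nat.sub_le k 1
  have h1 : Integrable (fun x => x ^ (k - 1) * cauchyWeight a N x) :=
    integrable_pow_mul_cauchyWeight (by linarith)
  have h2 : Integrable (fun x => x ^ (k + 1) * cauchyWeight a N x) :=
    integrable_pow_mul_cauchyWeight (by push_cast; linarith)
  have := integral_of_hasDerivAt_of_tendsto
    (fun x => hasDerivAt_pearson a N k x) (integrable_pearson h)
    ((tendsto_pearson_cocompact h).mono_left atBot_le_cocompact)
    ((tendsto_pearson_cocompact h).mono_left atTop_le_cocompact)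
  rw [integral_add (h1.const_mul _) (h2.const_mul _), integral_const_mul,
    integral_const_mul, sub_zero] at this
  exact this

lemma hasDerivAt_cauchyMoment {a : ℝ} {N k : ℕ} (h : (k : ℝ) + 1 < 2 * (N + a)) (s : ℝ) :
    HasDerivAt (cauchyMoment a N k) (s ^ k * cauchyWeight a N s) s := by
  have hi := integrable_pow_mul_cauchyWeight h
  have hc : Continuous fun x => x ^ k * cauchyWeight a N x := by
    have := continuous_cauchyWeight a N
    fun_prop
  have h1 : cauchyMoment a N k
      = fun u => (∫ x in s..u, x ^ k * cauchyWeight a N x) + cauchyMoment a N k s := by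
    funext u
    have := intervalIntegral.integral_Iic_sub_Iic (hi.integrableOn (s := Iic s))
      (hi.integrableOn (s := Iic u))
    simp only [cauchyMoment]
    linarith
  rw [h1]
  exact (intervalIntegral.integral_hasDerivAt_right (hc.intervalIntegrable _ _)
    hc.aestronglyMeasurable.stronglyMeasurableAtFilter hc.continuousAt).add_const _

/-! ### Derivatives of determinants and inverses -/

open Matrix in
lemma hasDerivAt_det {n : Type*} [Fintype n] [DecidableEq n] {H : ℝ → Matrix n n ℝ}
    {H' : Matrix n n ℝ} {s : ℝ} (hH : ∀ i j, HasDerivAt (fun t => H t i j) (H' i j) s) :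
    HasDerivAt (fun t => (H t).det) (∑ i, ((H s).updateCol i fun k => H' k i).det) s := by
  simp only [det_apply']
  have h1 : ∀ σ : Equiv.Perm n, HasDerivAt (fun t => ((σ.sign : ℤ) : ℝ) * ∏ i, H t (σ i) i)
      (((σ.sign : ℤ) : ℝ) * ∑ i, (∏ j ∈ Finset.univ.erase i, H s (σ j) j) • H' (σ i) i) s :=
    fun σ => (HasDerivAt.fun_finsetProd fun i _ => hH (σ i) i).const_mul _
  refine (HasDerivAt.fun_sum fun σ (_ : σ ∈ Finset.univ) => h1 σ).congr_deriv ?_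
  rw [Finset.sum_comm]
  refine Finset.sum_congr rfl fun σ _ => ?_
  rw [Finset.mul_sum]
  refine Finset.sum_congr rfl fun i _ => ?_
  rw [← Finset.mul_prod_erase Finset.univ (fun j => ((H s).updateCol i fun k => H' k i) (σ j) j)
    (Finset.mem_univ i), updateCol_self, smul_eq_mul, mul_comm (H' (σ i) i)]
  congr 2
  refine Finset.prod_congr rfl fun j hj => ?_
  rw [updateCol_ne (Finset.ne_of_mem_erase hj)]

open Matrix in
/-- Jacobi's formula for a derivative of rank one. -/
lemma hasDerivAt_det_rankOne {n : Type*} [Fintype n] [DecidableEq n] {H : ℝ → Matrix n n ℝ}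
    {c : n → ℝ} {w s : ℝ} (hH : ∀ i j, HasDerivAt (fun t => H t i j) (w * (c i * c j)) s)
    (hdet : (H s).det ≠ 0) :
    HasDerivAt (fun t => (H t).det) ((H s).det * (w * (c ⬝ᵥ (H s)⁻¹ *ᵥ c))) s := by
  have h1 := hasDerivAt_det (H' := of fun i j => w * (c i * c j)) hH
  refine h1.congr_deriv ?_
  have h2 : ∀ i, ((H s).updateCol i fun k => w * (c k * c i)).det
      = w * (c i * ((H s).adjugate *ᵥ c) i) := fun i => by
    have : (fun k => w * (c k * c i)) = (w * c i) • c := by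
      funext k
      simp
      ring
    rw [this, det_updateCol_smul, ← cramer_apply, cramer_eq_adjugate_mulVec]
    ring
  simp only [of_apply, h2]
  rw [← Finset.mul_sum, inv_def, smul_mulVec, dotProduct_smul, smul_eq_mul,
    Ring.inverse_eq_inv, dotProduct]
  field_simp

open Matrix in
lemma differentiableAt_inv_entry {n : Type*} [Fintype n] [DecidableEq n] {H : ℝ → Matrix n n ℝ}
    {s : ℝ} (hH : ∀ i j, DifferentiableAt ℝ (fun t => H t i j) s) (hdet : (H s).det ≠ 0) (i j : n) :
    DifferentiableAt ℝ (fun t => (H t)⁻¹ i j) s := by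
  have hd : ∀ {G : ℝ → Matrix n n ℝ}, (∀ i j, DifferentiableAt ℝ (fun t => G t i j) s) →
      DifferentiableAt ℝ (fun t => (G t).det) s := fun hG =>
    (hasDerivAt_det (H' := of fun i j => deriv (fun t => _) s)
      fun i j => (hG i j).hasDerivAt).differentiableAt
  have h1 : (fun t => (H t)⁻¹ i j) = fun t => ((H t).det)⁻¹ * (H t).adjugate i j := by
    funext t
    rw [inv_def, Matrix.smul_apply, smul_eq_mul, Ring.inverse_eq_inv]
  rw [h1]
  refine ((hd hH).inv hdet).mul ?_
  simp only [adjugate_apply]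
  refine hd fun k l => ?_
  by_cases hk : k = j
  · subst hk
    simp only [updateRow_self]
    exact differentiableAt_const _
  · simp only [updateRow_ne hk]
    exact hH k l

open Matrix in
/-- The derivative of `x ⬝ H⁻¹ y` when `H' = w c cᵀ`. -/
lemma hasDerivAt_dotProduct_inv {n : Type*} [Fintype n] [DecidableEq n] {H : ℝ → Matrix n n ℝ}
    {c : n → ℝ} {w s : ℝ} (hH : ∀ i j, HasDerivAt (fun t => H t i j) (w * (c i * c j)) s)
    (hdet : ∀ t, (H t).det ≠ 0) {x y : ℝ → n → ℝ} {x' y' : n → ℝ}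
    (hx : ∀ i, HasDerivAt (fun t => x t i) (x' i) s)
    (hy : ∀ i, HasDerivAt (fun t => y t i) (y' i) s) :
    HasDerivAt (fun t => x t ⬝ᵥ (H t)⁻¹ *ᵥ y t)
      (x' ⬝ᵥ (H s)⁻¹ *ᵥ y s + x s ⬝ᵥ (H s)⁻¹ *ᵥ y'
        - w * (x s ⬝ᵥ (H s)⁻¹ *ᵥ c) * (c ⬝ᵥ (H s)⁻¹ *ᵥ y s)) s := by
  set A' : Matrix n n ℝ := of fun i j => deriv (fun t => (H t)⁻¹ i j) s with hA'
  have hA : ∀ i j, HasDerivAt (fun t => (H t)⁻¹ i j) (A' i j) s := fun i j =>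
    (differentiableAt_inv_entry (fun i j => (hH i j).differentiableAt) (hdet s) i j).hasDerivAt
  have h1 : A' * H s + (H s)⁻¹ * (w • vecMulVec c c) = 0 := by
    ext i j
    have h2 : HasDerivAt (fun t => ∑ k, (H t)⁻¹ i k * H t k j)
        (∑ k, (A' i k * H s k j + (H s)⁻¹ i k * (w * (c k * c j)))) s :=
      HasDerivAt.fun_sum fun k _ => (hA i k).mul (hH k j)
    have h3 : (fun t => ∑ k, (H t)⁻¹ i k * H t k j) = fun _ => (1 : Matrix n n ℝ) i j := by
      funext t
      rw [← nonsing_inv_mul (H t) (isUnit_iff_ne_zero.2 (hdet t)), mul_apply]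
    rw [h3] at h2
    have := h2.unique (hasDerivAt_const s _)
    rw [Finset.sum_add_distrib] at this
    rw [Matrix.add_apply, mul_apply, mul_apply]
    simpa [vecMulVec_apply] using this
  have h4 : A' = -((H s)⁻¹ * (w • vecMulVec c c) * (H s)⁻¹) := by
    have : A' * H s * (H s)⁻¹ = -((H s)⁻¹ * (w • vecMulVec c c)) * (H s)⁻¹ := by
      rw [eq_neg_of_add_eq_zero_left h1]
    rwa [mul_nonsing_inv_cancel_right _ _ (isUnit_iff_ne_zero.2 (hdet s)), neg_mul] at this
  have h5 : HasDerivAt (fun t => x t ⬝ᵥ (H t)⁻¹ *ᵥ y t)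
      (∑ i, (x' i * ∑ j, (H s)⁻¹ i j * y s j
        + x s i * ∑ j, (A' i j * y s j + (H s)⁻¹ i j * y' j))) s :=
    HasDerivAt.fun_sum fun i _ => (hx i).mul
      (HasDerivAt.fun_sum fun j _ => (hA i j).mul (hy j))
  refine h5.congr_deriv ?_
  have h6 : ∑ i, (x' i * ∑ j, (H s)⁻¹ i j * y s j
        + x s i * ∑ j, (A' i j * y s j + (H s)⁻¹ i j * y' j))
      = x' ⬝ᵥ (H s)⁻¹ *ᵥ y s + x s ⬝ᵥ (H s)⁻¹ *ᵥ y' + x s ⬝ᵥ A' *ᵥ y s := by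
    simp only [dotProduct, mulVec, Finset.sum_add_distrib, mul_add]
    ring
  have h7 : x s ⬝ᵥ A' *ᵥ y s = - (w * (x s ⬝ᵥ (H s)⁻¹ *ᵥ c) * (c ⬝ᵥ (H s)⁻¹ *ᵥ y s)) := by
    rw [h4, Matrix.mul_smul, Matrix.smul_mul, neg_mulVec, smul_mulVec, ← mulVec_mulVec, ← mulVec_mulVec,
      vecMulVec_mulVec, dotProduct_neg, dotProduct_smul, mulVec_smul, dotProduct_smul]
    simp
    ring
  rw [h6, h7]
  ring

/-! ### Hankel matrices of a semiclassical moment sequence -/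

namespace Hankel
open Matrix

/-- The Hankel matrix `μ_{i+j}` of size `N`. -/
def mat (μ : ℕ → ℝ) (N : ℕ) : Matrix (Fin N) (Fin N) ℝ := of fun i j => μ (i + j)

/-- The nilpotent shift, which is multiplication by the variable on `1, x, …, x^n` modulo
`x^{n+1}`. -/
def shift (n : ℕ) : Matrix (Fin (n + 1)) (Fin (n + 1)) ℝ :=
  of fun i j => if (j : ℕ) = i + 1 then 1 else 0

/-- The matrix of `(1 + x²) d/dx - n x`, which preserves the span of `1, x, …, x^n`. -/
def rotGen (n : ℕ) : Matrix (Fin (n + 1)) (Fin (n + 1)) ℝ :=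
  of fun i j => (if (j : ℕ) + 1 = i then (i : ℝ) else 0) +
    if (j : ℕ) = i + 1 then (i : ℝ) - n else 0

/-- The last vector of the standard basis. -/
def top (n : ℕ) : Fin (n + 1) → ℝ := Pi.single (Fin.last n) 1

/-- The moments `μ_{n+1}, …, μ_{2n+1}` pairing `1, x, …, x^n` with `x^{n+1}`. -/
def next (μ : ℕ → ℝ) (n : ℕ) : Fin (n + 1) → ℝ := fun i => μ (n + 1 + i)

/-- The vector of monomials `1, s, …, s^{N-1}`. -/
def mono (N : ℕ) (s : ℝ) : Fin N → ℝ := fun i => s ^ (i : ℕ)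

/-- The derivative of the vector of monomials. -/
def monoDeriv (N : ℕ) (s : ℝ) : Fin N → ℝ := fun i => i * s ^ ((i : ℕ) - 1)

lemma top_apply (n : ℕ) (i : Fin (n + 1)) : top n i = if (i : ℕ) = n then 1 else 0 := by
  simp only [top, Pi.single_apply, Fin.ext_iff, Fin.val_last]

lemma shift_mulVec (n : ℕ) {v : Fin (n + 1) → ℝ} (f : ℕ → ℝ) (hv : ∀ k, v k = f k)
    (i : Fin (n + 1)) : (shift n *ᵥ v) i = f (i + 1) - top n i * f (n + 1) := by
  obtain rfl : v = fun k : Fin (n + 1) => f k := funext hv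
  have h1 : (shift n *ᵥ fun k => f k) i
      = ∑ k ∈ Finset.range (n + 1), if k = (i : ℕ) + 1 then f k else 0 := by
    rw [Finset.sum_range]
    simp [shift, mulVec, dotProduct]
  rw [h1, Finset.sum_ite_eq', top_apply]
  have := i.isLt
  by_cases h : (i : ℕ) = n
  · simp [h]
  · rw [if_pos (by simp; omega), if_neg h]
    simp

lemma rotGen_mulVec (n : ℕ) {v : Fin (n + 1) → ℝ} (f : ℕ → ℝ) (hv : ∀ k, v k = f k)
    (i : Fin (n + 1)) : (rotGen n *ᵥ v) i = i * f (i - 1) + (i - n) * f (i + 1) := by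
  obtain rfl : v = fun k : Fin (n + 1) => f k := funext hv
  have h1 : (rotGen n *ᵥ fun k => f k) i
      = ∑ k ∈ Finset.range (n + 1), ((if k + 1 = (i : ℕ) then (i : ℝ) * f k else 0) +
        if k = (i : ℕ) + 1 then ((i : ℝ) - n) * f k else 0) := by
    rw [Finset.sum_range]
    simp [rotGen, mulVec, dotProduct, add_mul]
  have hi := i.isLt
  rw [h1, Finset.sum_add_distrib, Finset.sum_ite_eq']
  congr 1
  · rcases h : (i : ℕ) with _ | m
    · simp
    · rw [Finset.sum_eq_single_of_mem m (by simp; omega) (fun k _ hk => if_neg (by omega))]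
      simp
  · by_cases h : (i : ℕ) = n
    · simp [h]
    · rw [if_pos (by simp; omega)]

lemma rotGen_top (n : ℕ) : rotGen n *ᵥ top n = -(shift n *ᵥ top n) := by
  funext i
  have hi := i.isLt
  rw [Pi.neg_apply, rotGen_mulVec n (fun m => if m = n then 1 else 0) (top_apply n),
    shift_mulVec n (fun m => if m = n then 1 else 0) (top_apply n)]
  rcases hi' : (i : ℕ) with _ | m
  · rcases n with _ | n <;> simp
    split_ifs with h2
    · simp [h2]
    · simp
  · simp only [Nat.add_sub_cancel, show m ≠ n by omega, if_false]
    simp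
    split_ifs with h2
    · rw [← h2]; push_cast; ring
    · simp

lemma shift_mono (n : ℕ) (s : ℝ) :
    shift n *ᵥ mono (n + 1) s = s • mono (n + 1) s - s ^ (n + 1) • top n := by
  funext i
  have := shift_mulVec n (v := mono (n + 1) s) (fun k => s ^ k) (fun _ => rfl) i
  rw [this]
  simp [mono]
  ring

lemma shift_monoDeriv (n : ℕ) (s : ℝ) : shift n *ᵥ monoDeriv (n + 1) s
      = mono (n + 1) s + s • monoDeriv (n + 1) s - ((n + 1 : ℝ) * s ^ n) • top n := by
  funext i
  have := shift_mulVec n (v := monoDeriv (n + 1) s) (fun k => k * s ^ (k - 1)) (fun _ => rfl) i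
  rw [this]
  simp [mono, monoDeriv]
  rcases h : (i : ℕ) with _ | m
  · simp; ring
  · simp; ring

lemma one_add_sq_smul_monoDeriv (n : ℕ) (s : ℝ) : (1 + s ^ 2) • monoDeriv (n + 1) s
      = rotGen n *ᵥ mono (n + 1) s + (n * s) • mono (n + 1) s := by
  funext i
  have := rotGen_mulVec n (v := mono (n + 1) s) (fun k => s ^ k) (fun _ => rfl) i
  rw [Pi.add_apply, this]
  simp only [mono, monoDeriv, Pi.smul_apply, smul_eq_mul]
  rcases h : (i : ℕ) with _ | m
  · simp
  · simp; ring

lemma mat_isSymm (μ : ℕ → ℝ) (N : ℕ) : (mat μ N)ᵀ = mat μ N := by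
  ext i j
  simp [mat, add_comm]

lemma trace_shift (n : ℕ) : (shift n).trace = 0 := by
  simp [trace, shift]

lemma trace_rotGen (n : ℕ) : (rotGen n).trace = 0 := by
  simp [trace, rotGen]

lemma trace_shift_mul_shift (n : ℕ) : (shift n * shift n).trace = 0 := by
  refine Finset.sum_eq_zero fun i _ => ?_
  have := shift_mulVec n (fun k => if (i : ℕ) = k + 1 then 1 else 0) (fun _ => rfl) i
  have hi := i.isLt
  rw [if_neg (by omega), if_neg (by omega)] at this
  simpa [mul_apply, mulVec, dotProduct, shift] using this

lemma trace_rotGen_mul_shift (n : ℕ) : (rotGen n * shift n).trace = (n : ℝ) * (n + 1) / 2 := by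
  have h : ∀ i : Fin (n + 1), (rotGen n * shift n) i i = (i : ℕ) := fun i => by
    have := rotGen_mulVec n (fun k => if (i : ℕ) = k + 1 then 1 else 0) (fun _ => rfl) i
    rw [mul_apply]
    simp only [mulVec, dotProduct] at this
    simp only [shift, of_apply]
    rw [this]
    rcases hi : (i : ℕ) with _ | m <;> simp
  simp only [trace, diag_apply, h]
  rw [← Finset.sum_range (fun k => (k : ℝ)), ← Nat.cast_sum]
  have := Finset.sum_range_id_mul_two (n + 1)
  have h2 : ((∑ i ∈ Finset.range (n + 1), i : ℕ) : ℝ) * 2 = (n + 1) * n := by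
    exact_mod_cast this
  linarith

section Identities
variable {μ : ℕ → ℝ} {n : ℕ} {s w a : ℝ}

/-- Multiplication by the variable: the shift of a Hankel matrix is the Hankel matrix of the shifted
moments up to its last row. -/
lemma shift_mul_mat : shift n * mat μ (n + 1) + vecMulVec (top n) (next μ n)
    = mat (fun k => μ (k + 1)) (n + 1) := by
  ext i j
  have := shift_mulVec n (fun k => μ (k + j)) (fun _ => rfl) i
  simp only [mulVec, dotProduct] at this
  rw [Matrix.add_apply, mul_apply, vecMulVec_apply]
  simp only [mat, of_apply, next]
  rw [this, show (i : ℕ) + 1 + j = i + j + 1 by ring]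
  ring

lemma mat_mul_shift : mat μ (n + 1) * (shift n)ᵀ + vecMulVec (next μ n) (top n)
    = mat (fun k => μ (k + 1)) (n + 1) := by
  have := congrArg transpose (shift_mul_mat (μ := μ) (n := n))
  rwa [transpose_add, transpose_mul, transpose_vecMulVec, mat_isSymm, mat_isSymm] at this

lemma mat_mul_top : mat μ (n + 1) *ᵥ top n = fun i : Fin (n + 1) => μ (n + i) := by
  funext i
  simp [top, mulVec, mat, add_comm]

lemma shift_next : shift n *ᵥ next μ n + μ (2 * n + 2) • top n
    = fun i : Fin (n + 1) => μ (n + i + 2) := by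
  funext i
  have := shift_mulVec n (v := next μ n) (fun k => μ (n + 1 + k)) (fun _ => rfl) i
  rw [Pi.add_apply, this, Pi.smul_apply, smul_eq_mul,
    show n + 1 + (n + 1) = 2 * n + 2 by ring, show n + 1 + ((i : ℕ) + 1) = n + i + 2 by ring]
  ring

lemma mat_add_two : mat (fun k => μ (k + 2)) (n + 1)
    = shift n * mat μ (n + 1) * (shift n)ᵀ + vecMulVec (shift n *ᵥ next μ n) (top n)
      + vecMulVec (top n) (shift n *ᵥ next μ n) + μ (2 * n + 2) • vecMulVec (top n) (top n) := by
  have h1 := mat_mul_shift (μ := fun k => μ (k + 1)) (n := n)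
  have h2 := shift_mul_mat (μ := μ) (n := n)
  have h3 : next (fun k => μ (k + 1)) n = shift n *ᵥ next μ n + μ (2 * n + 2) • top n := by
    rw [shift_next]
    funext i
    simp only [next]
    congr 1
    ring
  simp only [add_assoc] at h1
  rw [show (fun k => μ (k + 2)) = fun k => μ (k + (1 + 1)) from rfl, ← h1, h3, ← h2, add_mul,
    vecMulVec_mul, vecMul_transpose, add_vecMulVec, smul_vecMulVec]
  abel

/-- The moment form of the Pearson equation, `∫ d(x^k (1+x²) w) = s^k (1+s²) w(s)` for a weight
`w = (1+x²)^{-(n+1)-a}` on `(-∞, s)`. -/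
def PearsonRec (μ : ℕ → ℝ) (n : ℕ) (a s w : ℝ) : Prop :=
  ∀ k : ℕ, k ≤ 2 * n + 1 →
    k * μ (k - 1) + (k - 2 * n - 2 * a) * μ (k + 1) = s ^ k * (1 + s ^ 2) * w

/-- The Pearson recurrence as a Lyapunov relation for the Hankel matrix. -/
lemma rotGen_mul_mat (h : PearsonRec μ n a s w) :
    rotGen n * mat μ (n + 1) + mat μ (n + 1) * (rotGen n)ᵀ
      = (2 * a) • mat (fun k => μ (k + 1)) (n + 1)
        + ((1 + s ^ 2) * w) • vecMulVec (mono (n + 1) s) (mono (n + 1) s) := by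
  have h1 : ∀ i j, (rotGen n * mat μ (n + 1)) i j
      = i * μ (i - 1 + j) + (i - n) * μ (i + 1 + j) := fun i j => by
    have := rotGen_mulVec n (fun k => μ (k + j)) (fun _ => rfl) i
    simp only [mulVec, dotProduct] at this
    rw [mul_apply]
    simp only [mat, of_apply]
    exact this
  ext i j
  have h2 : (mat μ (n + 1) * (rotGen n)ᵀ) i j = (rotGen n * mat μ (n + 1)) j i := by
    rw [← transpose_apply (rotGen n * mat μ (n + 1)), transpose_mul, mat_isSymm]
  have hi := i.isLt
  have hj := j.isLt
  have h3 := h (i + j) (by omega)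
  rw [Matrix.add_apply, h2, h1, h1]
  simp only [Matrix.add_apply, Matrix.smul_apply, vecMulVec_apply, mat, of_apply, mono,
    smul_eq_mul]
  rw [← pow_add, show (i : ℕ) + 1 + j = i + j + 1 by ring, show (j : ℕ) + 1 + i = i + j + 1 by ring]
  have h4 : (i : ℝ) * μ (i - 1 + j) = i * μ (i + j - 1) := by
    rcases h' : (i : ℕ) with _ | m
    · simp
    · rw [show m + 1 - 1 + (j : ℕ) = m + 1 + j - 1 by omega]
  have h5 : (j : ℝ) * μ (j - 1 + i) = j * μ (i + j - 1) := by
    rcases h' : (j : ℕ) with _ | m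
    · simp
    · rw [show m + 1 - 1 + (i : ℕ) = i + (m + 1) - 1 by omega]
  rw [h4, h5]
  push_cast at h3
  linarith

lemma rotGen_next (h : PearsonRec μ n a s w) :
    rotGen n *ᵥ next μ n = ((1 + s ^ 2) * w * s ^ (n + 1)) • mono (n + 1) s
      - (n + 1 : ℝ) • (mat μ (n + 1) *ᵥ top n)
      + (2 * a - 1) • (shift n *ᵥ next μ n + μ (2 * n + 2) • top n) := by
  rw [shift_next, mat_mul_top]
  funext i
  have := rotGen_mulVec n (v := next μ n) (fun k => μ (n + 1 + k)) (fun _ => rfl) i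
  have hi := i.isLt
  have h3 := h (n + 1 + i) (by omega)
  rw [this]
  simp only [Pi.add_apply, Pi.sub_apply, Pi.smul_apply, smul_eq_mul, mono]
  have h4 : (i : ℝ) * μ (n + 1 + (i - 1)) = i * μ (n + i) := by
    rcases h' : (i : ℕ) with _ | m
    · simp
    · rw [show n + 1 + (m + 1 - 1) = n + (m + 1) by omega]
  rw [show n + 1 + (i : ℕ) - 1 = n + i by omega, show n + 1 + (i : ℕ) + 1 = n + i + 2 by omega] at h3
  rw [h4, show n + 1 + ((i : ℕ) + 1) = n + i + 2 by omega]
  push_cast at h3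
  rw [pow_add] at h3
  linarith

/-- The Pearson recurrence for the Hankel matrix of the shifted moments. -/
lemma rotGen_mul_mat_succ (h : PearsonRec μ n a s w) :
    rotGen n * mat (fun k => μ (k + 1)) (n + 1) + mat (fun k => μ (k + 1)) (n + 1) * (rotGen n)ᵀ
      + mat μ (n + 1) + (1 - 2 * a) • mat (fun k => μ (k + 2)) (n + 1)
      = (s * (1 + s ^ 2) * w) • vecMulVec (mono (n + 1) s) (mono (n + 1) s) := by
  have h1 : ∀ i j, (rotGen n * mat (fun k => μ (k + 1)) (n + 1)) i j
      = i * μ (i + j) + (i - n) * μ (i + j + 2) := fun i j => by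
    have := rotGen_mulVec n (fun k => μ (k + j + 1)) (fun _ => rfl) i
    simp only [mulVec, dotProduct] at this
    rw [mul_apply]
    simp only [mat, of_apply]
    rw [this, show (i : ℕ) + 1 + j + 1 = i + j + 2 by ring]
    rcases h' : (i : ℕ) with _ | m
    · simp
    · rw [show m + 1 - 1 + (j : ℕ) + 1 = m + 1 + j by omega]
  ext i j
  have h2 : (mat (fun k => μ (k + 1)) (n + 1) * (rotGen n)ᵀ) i j
      = (rotGen n * mat (fun k => μ (k + 1)) (n + 1)) j i := by
    rw [← transpose_apply (rotGen n * _), transpose_mul, mat_isSymm]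
  have hi := i.isLt
  have hj := j.isLt
  have h3 := h (i + j + 1) (by omega)
  rw [Matrix.add_apply, Matrix.add_apply, Matrix.add_apply, h2, h1, h1]
  simp only [Matrix.smul_apply, vecMulVec_apply, mat, of_apply, mono, smul_eq_mul]
  rw [← pow_add, add_comm (j : ℕ) i]
  rw [Nat.add_sub_cancel, pow_succ] at h3
  push_cast at h3
  linarith

end Identities
end Hankel

namespace Hankel
open Matrix

/-! ### Bilinear identities and the `σ`-form of the differential equation -/

section Scalars
variable {μ : ℕ → ℝ} {n : ℕ} {s w a : ℝ}

/-- The bilinear form of the inverse of the Hankel matrix. -/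
def form (μ : ℕ → ℝ) (n : ℕ) (x y : Fin (n + 1) → ℝ) : ℝ := x ⬝ᵥ (mat μ (n + 1))⁻¹ *ᵥ y

lemma form_add_left (x x' y : Fin (n + 1) → ℝ) :
    form μ n (x + x') y = form μ n x y + form μ n x' y := add_dotProduct ..

lemma form_add_right (x y y' : Fin (n + 1) → ℝ) :
    form μ n x (y + y') = form μ n x y + form μ n x y' := by
  rw [form, mulVec_add, dotProduct_add]; rfl

lemma form_smul_left (c : ℝ) (x y : Fin (n + 1) → ℝ) :
    form μ n (c • x) y = c * form μ n x y := by
  rw [form, smul_dotProduct]; rfl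

lemma form_smul_right (c : ℝ) (x y : Fin (n + 1) → ℝ) :
    form μ n x (c • y) = c * form μ n x y := by
  rw [form, mulVec_smul, dotProduct_smul]; rfl

lemma form_neg_left (x y : Fin (n + 1) → ℝ) : form μ n (-x) y = -form μ n x y :=
  neg_dotProduct ..

lemma form_neg_right (x y : Fin (n + 1) → ℝ) : form μ n x (-y) = -form μ n x y := by
  rw [form, mulVec_neg, dotProduct_neg]; rfl

lemma form_sub_left (x x' y : Fin (n + 1) → ℝ) :
    form μ n (x - x') y = form μ n x y - form μ n x' y := sub_dotProduct ..

lemma form_sub_right (x y y' : Fin (n + 1) → ℝ) :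
    form μ n x (y - y') = form μ n x y - form μ n x y' := by
  rw [form, mulVec_sub, dotProduct_sub]; rfl

lemma inv_mat_isSymm : ((mat μ (n + 1))⁻¹)ᵀ = (mat μ (n + 1))⁻¹ := by
  rw [transpose_nonsing_inv, mat_isSymm]

lemma form_comm (x y : Fin (n + 1) → ℝ) : form μ n x y = form μ n y x := by
  rw [form, dotProduct_mulVec, ← mulVec_transpose, inv_mat_isSymm, dotProduct_comm]
  rfl

lemma form_mat (hdet : (mat μ (n + 1)).det ≠ 0) (x y : Fin (n + 1) → ℝ) :
    form μ n x (mat μ (n + 1) *ᵥ y) = x ⬝ᵥ y := by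
  rw [form, mulVec_mulVec, nonsing_inv_mul _ (isUnit_iff_ne_zero.2 hdet), one_mulVec]

/-- Sandwiching a matrix between two copies of the inverse Hankel matrix. -/
lemma form_sandwich (X : Matrix (Fin (n + 1)) (Fin (n + 1)) ℝ)
    (hdet : (mat μ (n + 1)).det ≠ 0) (x y : Fin (n + 1) → ℝ) :
    ((mat μ (n + 1))⁻¹ *ᵥ x) ⬝ᵥ (X * mat μ (n + 1)) *ᵥ ((mat μ (n + 1))⁻¹ *ᵥ y)
      = form μ n x (X *ᵥ y) := by
  rw [mulVec_mulVec, mul_assoc, mul_nonsing_inv _ (isUnit_iff_ne_zero.2 hdet), mul_one,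
    dotProduct_comm]
  exact form_comm _ _

lemma form_sandwich_transpose (X : Matrix (Fin (n + 1)) (Fin (n + 1)) ℝ)
    (hdet : (mat μ (n + 1)).det ≠ 0) (x y : Fin (n + 1) → ℝ) :
    ((mat μ (n + 1))⁻¹ *ᵥ x) ⬝ᵥ (mat μ (n + 1) * Xᵀ) *ᵥ ((mat μ (n + 1))⁻¹ *ᵥ y)
      = form μ n (X *ᵥ x) y := by
  rw [form_comm, ← form_sandwich X hdet y x, dotProduct_comm]
  conv_rhs => rw [dotProduct_mulVec, ← mulVec_transpose, transpose_mul, mat_isSymm]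

lemma vecMulVec_sandwich (u v x y : Fin (n + 1) → ℝ) :
    ((mat μ (n + 1))⁻¹ *ᵥ x) ⬝ᵥ vecMulVec u v *ᵥ ((mat μ (n + 1))⁻¹ *ᵥ y)
      = form μ n u x * form μ n v y := by
  rw [vecMulVec_mulVec]
  simp only [op_smul_eq_smul, dotProduct_smul, smul_eq_mul]
  rw [form, form, dotProduct_comm u]
  ring

lemma form_shift (hdet : (mat μ (n + 1)).det ≠ 0) (x y : Fin (n + 1) → ℝ) :
    form μ n x (shift n *ᵥ y) + form μ n (top n) x * form μ n (next μ n) y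
      = form μ n (shift n *ᵥ x) y + form μ n (next μ n) x * form μ n (top n) y := by
  rw [← form_sandwich _ hdet, ← vecMulVec_sandwich, ← form_sandwich_transpose _ hdet,
    ← vecMulVec_sandwich, ← dotProduct_add, ← dotProduct_add, ← add_mulVec, ← add_mulVec,
    shift_mul_mat, mat_mul_shift]

lemma form_rotGen (hdet : (mat μ (n + 1)).det ≠ 0) (h : PearsonRec μ n a s w)
    (x y : Fin (n + 1) → ℝ) :
    form μ n x (rotGen n *ᵥ y) + form μ n (rotGen n *ᵥ x) y
      = 2 * a * (form μ n x (shift n *ᵥ y) + form μ n (top n) x * form μ n (next μ n) y)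
        + (1 + s ^ 2) * w * (form μ n (mono (n + 1) s) x * form μ n (mono (n + 1) s) y) := by
  rw [← form_sandwich _ hdet, ← form_sandwich_transpose _ hdet, ← dotProduct_add, ← add_mulVec,
    rotGen_mul_mat h, ← form_sandwich _ hdet, ← vecMulVec_sandwich, ← vecMulVec_sandwich,
    ← dotProduct_add, ← add_mulVec, shift_mul_mat, add_mulVec, dotProduct_add, smul_mulVec,
    smul_mulVec, dotProduct_smul, dotProduct_smul]
  rfl

lemma trace_inv_mul_vecMulVec (u v : Fin (n + 1) → ℝ) :
    ((mat μ (n + 1))⁻¹ * vecMulVec u v).trace = form μ n v u := by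
  rw [mul_vecMulVec, trace_vecMulVec, dotProduct_comm]
  rfl

lemma trace_inv_mul (X : Matrix (Fin (n + 1)) (Fin (n + 1)) ℝ)
    (hdet : (mat μ (n + 1)).det ≠ 0) :
    ((mat μ (n + 1))⁻¹ * (X * mat μ (n + 1))).trace = X.trace := by
  rw [trace_mul_comm, mul_assoc, mul_nonsing_inv _ (isUnit_iff_ne_zero.2 hdet), mul_one]

lemma trace_inv_mul_transpose (X : Matrix (Fin (n + 1)) (Fin (n + 1)) ℝ) :
    ((mat μ (n + 1))⁻¹ * Xᵀ).trace = ((mat μ (n + 1))⁻¹ * X).trace := by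
  rw [← trace_transpose, transpose_mul, transpose_transpose, inv_mat_isSymm, trace_mul_comm]

/-- The trace of the Pearson relation: the kernel at the end point in terms of the
off-diagonal entry `form top next`. -/
lemma form_mono_mono (hdet : (mat μ (n + 1)).det ≠ 0) (h : PearsonRec μ n a s w) :
    (1 + s ^ 2) * w * form μ n (mono (n + 1) s) (mono (n + 1) s)
      = -(2 * a * form μ n (top n) (next μ n)) := by
  have h1 := congrArg (fun X => ((mat μ (n + 1))⁻¹ * X).trace) (rotGen_mul_mat h)
  simp only [mul_add, trace_add, ← shift_mul_mat, Matrix.mul_smul, trace_smul,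
    trace_inv_mul_vecMulVec, smul_eq_mul] at h1
  have h2 : mat μ (n + 1) * (rotGen n)ᵀ = (rotGen n * mat μ (n + 1))ᵀ := by
    rw [transpose_mul, mat_isSymm]
  rw [h2, trace_inv_mul_transpose, trace_inv_mul _ hdet, trace_inv_mul _ hdet, trace_rotGen,
    trace_shift, form_comm (next μ n)] at h1
  linarith

lemma trace_inv_mul_mat_add_two (hdet : (mat μ (n + 1)).det ≠ 0) :
    ((mat μ (n + 1))⁻¹ * mat (fun k => μ (k + 2)) (n + 1)).trace
      = form μ n (next μ n) (shift n *ᵥ top n) + form μ n (top n) (shift n *ᵥ next μ n)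
        + μ (2 * n + 2) * form μ n (top n) (top n) := by
  have h1 : shift n * mat μ (n + 1)
      = mat μ (n + 1) * (shift n)ᵀ + vecMulVec (next μ n) (top n)
        - vecMulVec (top n) (next μ n) := by
    rw [mat_mul_shift, ← shift_mul_mat, add_sub_cancel_right]
  rw [mat_add_two, h1]
  simp only [mul_add, add_mul, sub_mul, mul_sub, trace_add, trace_sub, Matrix.mul_smul, trace_smul,
    trace_inv_mul_vecMulVec, smul_eq_mul, vecMulVec_mul, vecMul_transpose]
  rw [← mul_assoc, ← mul_assoc, nonsing_inv_mul _ (isUnit_iff_ne_zero.2 hdet), one_mul,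
    ← transpose_mul, trace_transpose, trace_shift_mul_shift, form_comm (shift n *ᵥ top n),
    form_comm (shift n *ᵥ next μ n)]
  ring

/-- The trace of the Pearson relation multiplied by the variable. -/
lemma trace_rotGen_succ (hdet : (mat μ (n + 1)).det ≠ 0) (h : PearsonRec μ n a s w) :
    (n : ℝ) * (n + 1) + 2 * form μ n (next μ n) (rotGen n *ᵥ top n) + (n + 1)
      + (1 - 2 * a) * (form μ n (next μ n) (shift n *ᵥ top n)
        + form μ n (top n) (shift n *ᵥ next μ n) + μ (2 * n + 2) * form μ n (top n) (top n))
      = s * (1 + s ^ 2) * w * form μ n (mono (n + 1) s) (mono (n + 1) s) := by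
  have h1 := congrArg (fun X => ((mat μ (n + 1))⁻¹ * X).trace) (rotGen_mul_mat_succ h)
  have h2 : mat (fun k => μ (k + 1)) (n + 1) * (rotGen n)ᵀ
      = (rotGen n * mat (fun k => μ (k + 1)) (n + 1))ᵀ := by
    rw [transpose_mul, mat_isSymm]
  have h3 : ((mat μ (n + 1))⁻¹ * (rotGen n * mat (fun k => μ (k + 1)) (n + 1))).trace
      = (n : ℝ) * (n + 1) / 2 + form μ n (next μ n) (rotGen n *ᵥ top n) := by
    rw [← shift_mul_mat, mul_add, ← mul_assoc (rotGen n), mul_add, trace_add,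
      trace_inv_mul _ hdet, trace_rotGen_mul_shift, mul_vecMulVec, trace_inv_mul_vecMulVec]
  simp only [mul_add, trace_add, Matrix.mul_smul, trace_smul, trace_inv_mul_vecMulVec, smul_eq_mul,
    h2, trace_inv_mul_transpose, h3, trace_inv_mul_mat_add_two hdet,
    nonsing_inv_mul _ (isUnit_iff_ne_zero.2 hdet), trace_one, Fintype.card_fin] at h1
  push_cast at h1
  linarith

/-- The Christoffel–Darboux identity on the diagonal. -/
lemma christoffelDarboux (hdet : (mat μ (n + 1)).det ≠ 0) :
    form μ n (mono (n + 1) s) (mono (n + 1) s)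
      = ((n + 1) * s ^ n - form μ n (next μ n) (monoDeriv (n + 1) s))
          * form μ n (top n) (mono (n + 1) s)
        - form μ n (top n) (monoDeriv (n + 1) s)
          * (s ^ (n + 1) - form μ n (next μ n) (mono (n + 1) s)) := by
  have h1 := form_shift hdet (monoDeriv (n + 1) s) (mono (n + 1) s)
  rw [shift_mono, shift_monoDeriv] at h1
  simp only [form_add_left, form_sub_left, form_sub_right, form_smul_left, form_smul_right] at h1
  rw [form_comm (monoDeriv (n + 1) s) (top n)] at h1
  linarith

/-- The equation of motion of the orthogonal polynomial of degree `n` at the end point. -/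
lemma deriv_form_top_mono (hdet : (mat μ (n + 1)).det ≠ 0) (h : PearsonRec μ n a s w) :
    (1 + s ^ 2) * (form μ n (top n) (monoDeriv (n + 1) s)
        - w * form μ n (top n) (mono (n + 1) s) * form μ n (mono (n + 1) s) (mono (n + 1) s))
      = ((2 * a + n + 1) * s - form μ n (top n) (next μ n)) * form μ n (top n) (mono (n + 1) s)
        - (2 * a + 1) * form μ n (top n) (top n)
          * (s ^ (n + 1) - form μ n (next μ n) (mono (n + 1) s)) := by
  have h1 := congrArg (form μ n (top n)) (one_add_sq_smul_monoDeriv n s)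
  have h2 := form_rotGen hdet h (top n) (mono (n + 1) s)
  have h3 := form_shift hdet (top n) (mono (n + 1) s)
  rw [rotGen_top, form_neg_left, form_comm (mono (n + 1) s) (top n)] at h2
  simp only [form_add_right, form_smul_right, form_sub_right, shift_mono] at h1 h2 h3
  rw [form_comm (next μ n) (top n)] at h3
  linear_combination h1 + h2 - h3

/-- The equation of motion of the monic orthogonal polynomial of degree `n + 1` at the end
point. -/
lemma deriv_sub_form_next_mono (hdet : (mat μ (n + 1)).det ≠ 0) (h : PearsonRec μ n a s w) :
    (1 + s ^ 2) * ((n + 1) * s ^ n - form μ n (next μ n) (monoDeriv (n + 1) s)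
        - w * (s ^ (n + 1) - form μ n (next μ n) (mono (n + 1) s))
          * form μ n (mono (n + 1) s) (mono (n + 1) s))
      = ((n + 1) * s + form μ n (top n) (next μ n))
          * (s ^ (n + 1) - form μ n (next μ n) (mono (n + 1) s))
        + (2 * a - 1) * (μ (2 * n + 2) - form μ n (next μ n) (next μ n))
          * form μ n (top n) (mono (n + 1) s) := by
  have h1 := congrArg (form μ n (next μ n)) (one_add_sq_smul_monoDeriv n s)
  have h2 := form_rotGen hdet h (next μ n) (mono (n + 1) s)
  have h3 := form_shift hdet (next μ n) (mono (n + 1) s)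
  have h4 : form μ n (mat μ (n + 1) *ᵥ top n) (mono (n + 1) s) = s ^ n := by
    rw [form_comm, form_mat hdet]
    simp [top, mono]
  rw [rotGen_next h, form_comm (mono (n + 1) s) (next μ n)] at h2
  simp only [form_add_right, form_smul_right, form_sub_right, shift_mono, form_add_left,
    form_sub_left, form_smul_left, h4] at h1 h2 h3
  rw [form_comm (next μ n) (top n)] at h2 h3
  linear_combination -h1 - h2 - (2 * a - 1) * h3

/-- The conserved quantity of the linear system for the two last orthogonal polynomials: it expresses
the quotient of the squared norms of these polynomials by the off-diagonal entry `form top next` and the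
polynomials at the end point, and makes the elimination in `sigma_form_algebra` close. -/
lemma first_integral (hdet : (mat μ (n + 1)).det ≠ 0) (h : PearsonRec μ n a s w) :
    (4 * a ^ 2 - 1) * (form μ n (top n) (top n)
        * (μ (2 * n + 2) - form μ n (next μ n) (next μ n)))
      = (n + 1) * (n + 1 + 2 * a) + 2 * a * s * form μ n (top n) (next μ n)
        + form μ n (top n) (next μ n) ^ 2
        - 2 * a * (1 + s ^ 2) * (w * form μ n (top n) (mono (n + 1) s)
          * (s ^ (n + 1) - form μ n (next μ n) (mono (n + 1) s))) := by
  have e1 := form_mono_mono hdet h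
  have e5 := trace_rotGen_succ hdet h
  have es := form_shift hdet (top n) (next μ n)
  have er := form_rotGen hdet h (top n) (next μ n)
  have en := congrArg (form μ n (top n)) (rotGen_next h)
  have h4 : top n ⬝ᵥ top n = 1 := by simp [top]
  simp only [form_add_right, form_smul_right, form_sub_right, form_mat hdet, h4] at en
  rw [rotGen_top, form_neg_left, form_comm (mono (n + 1) s) (top n),
    form_comm (mono (n + 1) s) (next μ n), form_comm (shift n *ᵥ top n)] at er
  rw [rotGen_top, form_neg_right] at e5
  rw [form_comm (next μ n) (top n), form_comm (shift n *ᵥ top n)] at es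
  linear_combination -e5 - s * e1 + es - 2 * a * (en - er)

end Scalars

/-- The algebra behind the `σ`-form: the quantities are `X = w p q`, `S = -(2a+1) U w q²` and
`T = (2a-1) W w p²`; the sum and the difference of `S` and `T` are the second derivative and a
polynomial in the lower ones, and their product is given by the first integral. -/
lemma sigma_form_algebra {a s N w p q U V W σ2 : ℝ}
    (h1 : (4 * a ^ 2 - 1) * (U * W)
      = N * (N + 2 * a) + 2 * a * s * V + V ^ 2 - 2 * a * (1 + s ^ 2) * (w * p * q))
    (h2 : -(2 * a * V) = w * ((2 * V - 2 * a * s) * p * q + (2 * a - 1) * W * p ^ 2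
      + (2 * a + 1) * U * q ^ 2))
    (h3 : (1 + s ^ 2) * σ2
      = -(2 * a) * (w * ((2 * a - 1) * W * p ^ 2 - (2 * a + 1) * U * q ^ 2))) :
    (1 + s ^ 2) ^ 2 * σ2 ^ 2
      - 4 * a ^ 2 * (-(2 * a * V) - s * (-(2 * a) * (w * p * q))) ^ 2
      + 4 * -(2 * a * V) * (-(2 * a) * (w * p * q))
          * (-(2 * a * V) - 2 * s * (-(2 * a) * (w * p * q)))
      + 4 * N * (N + 2 * a) * (-(2 * a) * (w * p * q)) ^ 2
      + 4 * (1 + s ^ 2) * (-(2 * a) * (w * p * q)) ^ 3 = 0 := by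
  set X := w * p * q with hX
  set S := -(2 * a + 1) * U * w * q ^ 2 with hS
  set T := (2 * a - 1) * W * w * p ^ 2 with hT
  have hTS : T * S = -((4 * a ^ 2 - 1) * (U * W)) * X ^ 2 := by rw [hX, hS, hT]; ring
  have h2' : T - S = -(2 * a * V) - (2 * V - 2 * a * s) * X := by rw [h2, hX, hS, hT]; ring
  have h3' : (1 + s ^ 2) * σ2 = -(2 * a) * (T + S) := by rw [h3, hS, hT]; ring
  rw [h1] at hTS
  have h4 : (1 + s ^ 2) ^ 2 * σ2 ^ 2 = 4 * a ^ 2 * ((T - S) ^ 2 + 4 * (T * S)) := by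
    rw [← mul_pow, h3']; ring
  rw [h4, hTS, h2']
  ring

lemma hasDerivAt_mono (N : ℕ) (s : ℝ) (i : Fin N) :
    HasDerivAt (fun t => mono N t i) (monoDeriv N s i) s := hasDerivAt_pow (i : ℕ) s

/-- The Jimbo–Miwa–Okamoto `σ`-form of Painlevé VI for the diagonal kernel at the end point. -/
theorem sigma_ode {μ : ℕ → ℝ → ℝ} {w : ℝ → ℝ} {n : ℕ} {a : ℝ}
    (hμ : ∀ k ≤ 2 * n + 2, ∀ s, HasDerivAt (μ k) (s ^ k * w s) s)
    (hw : ∀ s, HasDerivAt w (-(2 * (n + 1 + a) * s / (1 + s ^ 2)) * w s) s)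
    (hrec : ∀ s, PearsonRec (fun k => μ k s) n a s (w s))
    (hdet : ∀ s, (mat (fun k => μ k s) (n + 1)).det ≠ 0) {σ σ1 σ2 : ℝ → ℝ}
    (hσ : ∀ s, σ s = (1 + s ^ 2) * w s
      * form (fun k => μ k s) n (mono (n + 1) s) (mono (n + 1) s))
    (h1 : ∀ s, HasDerivAt σ (σ1 s) s) (h2 : ∀ s, HasDerivAt σ1 (σ2 s) s) (s : ℝ) :
    (1 + s ^ 2) ^ 2 * σ2 s ^ 2 - 4 * a ^ 2 * (σ s - s * σ1 s) ^ 2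
      + 4 * σ s * σ1 s * (σ s - 2 * s * σ1 s)
      + 4 * (n + 1) * (n + 1 + 2 * a) * σ1 s ^ 2 + 4 * (1 + s ^ 2) * σ1 s ^ 3 = 0 := by
  set U : ℝ → ℝ := fun s => form (fun k => μ k s) n (top n) (top n)
  set V : ℝ → ℝ := fun s => form (fun k => μ k s) n (top n) (next (fun k => μ k s) n) with hV
  set W : ℝ → ℝ := fun s => μ (2 * n + 2) s
    - form (fun k => μ k s) n (next (fun k => μ k s) n) (next (fun k => μ k s) n)
  set p : ℝ → ℝ := fun s => form (fun k => μ k s) n (top n) (mono (n + 1) s) with hp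
  set q : ℝ → ℝ := fun s => s ^ (n + 1)
    - form (fun k => μ k s) n (next (fun k => μ k s) n) (mono (n + 1) s) with hq
  have hH : ∀ s, ∀ i j : Fin (n + 1), HasDerivAt (fun t => mat (fun k => μ k t) (n + 1) i j)
      (w s * (mono (n + 1) s i * mono (n + 1) s j)) s := fun s i j => by
    have hi := i.isLt
    have hj := j.isLt
    refine (hμ (i + j) (by omega) s).congr_deriv ?_
    simp only [mono]
    ring
  have htop : ∀ s, ∀ i, HasDerivAt (fun _ : ℝ => top n i) ((0 : Fin (n + 1) → ℝ) i) s :=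
    fun s i => hasDerivAt_const _ _
  have hnext : ∀ s, ∀ i, HasDerivAt (fun t => next (fun k => μ k t) n i)
      (((w s * s ^ (n + 1)) • mono (n + 1) s) i) s := fun s i => by
    have hi := i.isLt
    refine (hμ (n + 1 + i) (by omega) s).congr_deriv ?_
    simp only [mono, Pi.smul_apply, smul_eq_mul]
    ring
  have hσV : σ = fun s => -(2 * a) * V s := by
    funext s
    rw [hσ, form_mono_mono (hdet s) (hrec s)]
    simp only [hV]
    ring
  have hVd : ∀ s, HasDerivAt V (w s * p s * q s) s := fun s => by
    refine (hasDerivAt_dotProduct_inv (hH s) hdet (htop s) (hnext s)).congr_deriv ?_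
    rw [mulVec_smul, dotProduct_smul, zero_dotProduct, smul_eq_mul]
    have := form_comm (μ := fun k => μ k s) (next (fun k => μ k s) n) (mono (n + 1) s)
    simp only [hp, hq, this]
    simp only [form]
    ring
  have hpd : ∀ s, HasDerivAt p ((((2 * a + n + 1) * s - V s) * p s
      - (2 * a + 1) * U s * q s) / (1 + s ^ 2)) s := fun s => by
    refine (hasDerivAt_dotProduct_inv (hH s) hdet (htop s)
      (hasDerivAt_mono (n + 1) s)).congr_deriv ?_
    rw [eq_div_iff (by positivity), zero_dotProduct, ← deriv_form_top_mono (hdet s) (hrec s)]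
    simp only [form]
    ring
  have hqd : ∀ s, HasDerivAt q ((((n + 1) * s + V s) * q s
      + (2 * a - 1) * W s * p s) / (1 + s ^ 2)) s := fun s => by
    refine ((hasDerivAt_pow (n + 1) s).sub (hasDerivAt_dotProduct_inv (hH s) hdet (hnext s)
      (hasDerivAt_mono (n + 1) s))).congr_deriv ?_
    rw [eq_div_iff (by positivity), ← deriv_sub_form_next_mono (hdet s) (hrec s), smul_dotProduct]
    simp only [form, smul_eq_mul]
    push_cast
    ring
  have hσ1 : σ1 = fun s => -(2 * a) * (w s * p s * q s) := by
    funext s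
    have := (hVd s).const_mul (-(2 * a))
    rw [← hσV] at this
    exact (h1 s).unique this
  have hσ2 : (1 + s ^ 2) * σ2 s = -(2 * a) * (w s * ((2 * a - 1) * W s * p s ^ 2
      - (2 * a + 1) * U s * q s ^ 2)) := by
    have := ((((hw s).mul (hpd s)).mul (hqd s)).const_mul (-(2 * a))).unique (hσ1 ▸ h2 s)
    rw [← this]
    have h0 : (1 + s ^ 2) ≠ 0 := by positivity
    simp only [Pi.mul_apply]
    field_simp
    ring
  have hcd : -(2 * a * V s) = w s * ((2 * V s - 2 * a * s) * p s * q s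
      + (2 * a - 1) * W s * p s ^ 2 + (2 * a + 1) * U s * q s ^ 2) := by
    have e1 := form_mono_mono (hdet s) (hrec s)
    have e2 := christoffelDarboux (s := s) (hdet s)
    have e3 := deriv_form_top_mono (hdet s) (hrec s)
    have e4 := deriv_sub_form_next_mono (hdet s) (hrec s)
    simp only [V, W, U, p, q]
    linear_combination -e1 + (1 + s ^ 2) * w s * e2
      + w s * form (fun k => μ k s) n (top n) (mono (n + 1) s) * e4
      - w s * (s ^ (n + 1) - form (fun k => μ k s) n (next (fun k => μ k s) n) (mono (n + 1) s))
        * e3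
  have := sigma_form_algebra (first_integral (hdet s) (hrec s)) hcd hσ2
  rw [hσ1, hσV]
  linear_combination this

end Hankel

/-! ### The finite `N` differential equation for the Cauchy ensemble -/

namespace CauchyEnsemble
open Matrix Hankel

/-- The Hankel matrix of the Cauchy weight restricted to `(-∞, s)`. -/
def hankel (a : ℝ) (N : ℕ) (s : ℝ) : Matrix (Fin N) (Fin N) ℝ :=
  mat (fun k => cauchyMoment a N k s) N

/-- The Hankel matrix of the Cauchy weight on the whole line. -/
def hankelTotal (a : ℝ) (N : ℕ) : Matrix (Fin N) (Fin N) ℝ := mat (cauchyTotal a N) N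

/-- The bilinear form of the inverse of the Hankel matrix of the restricted weight. -/
def invForm (a : ℝ) (N : ℕ) (s : ℝ) (x y : Fin N → ℝ) : ℝ := x ⬝ᵥ (hankel a N s)⁻¹ *ᵥ y

variable {a : ℝ} {N : ℕ}

lemma integrable_moment (ha : 0 ≤ a) (i j : Fin N) :
    Integrable fun x => x ^ ((i : ℕ) + j) * cauchyWeight a N x := by
  refine integrable_pow_mul_cauchyWeight ?_
  have : ((i + j + 2 : ℕ) : ℝ) ≤ (2 * N : ℕ) := by
    have := i.isLt
    have := j.isLt
    exact_mod_cast (by omega)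
  push_cast at *
  linarith

lemma dotProduct_mono_mul (v u : Fin N → ℝ) (x : ℝ) :
    (v ⬝ᵥ mono N x) * (mono N x ⬝ᵥ u) * cauchyWeight a N x
      = ∑ i, ∑ j, v i * u j * (x ^ ((i : ℕ) + j) * cauchyWeight a N x) := by
  rw [dotProduct, dotProduct, Finset.sum_mul_sum, Finset.sum_mul]
  refine Finset.sum_congr rfl fun i _ => ?_
  rw [Finset.sum_mul]
  refine Finset.sum_congr rfl fun j _ => ?_
  simp only [mono]
  ring

lemma dotProduct_mat_integral {I : Set ℝ} (ha : 0 ≤ a) (v u : Fin N → ℝ) :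
    v ⬝ᵥ mat (fun k => ∫ x in I, x ^ k * cauchyWeight a N x) N *ᵥ u
      = ∫ x in I, (v ⬝ᵥ mono N x) * (mono N x ⬝ᵥ u) * cauchyWeight a N x := by
  simp only [dotProduct_mono_mul]
  have hi : ∀ i j : Fin N, IntegrableOn
      (fun x => v i * u j * (x ^ ((i : ℕ) + j) * cauchyWeight a N x)) I := fun i j =>
    ((integrable_moment ha i j).const_mul _).integrableOn
  rw [integral_finsetSum _ fun i _ => integrable_finsetSum _ fun j _ => hi i j]
  simp only [dotProduct, mulVec, Finset.mul_sum]
  refine Finset.sum_congr rfl fun i _ => ?_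
  rw [integral_finsetSum _ fun j _ => hi i j]
  refine Finset.sum_congr rfl fun j _ => ?_
  rw [integral_const_mul, mat, of_apply]
  ring

lemma posDef_mat_integral {I : Set ℝ} (hI' : volume I ≠ 0) (ha : 0 ≤ a) :
    (mat (fun k => ∫ x in I, x ^ k * cauchyWeight a N x) N).PosDef := by
  refine PosDef.of_dotProduct_mulVec_pos ?_ fun v hv => ?_
  · ext i j
    simp [mat, add_comm]
  have hs : star v = v := by ext i; simp
  rw [hs, dotProduct_mat_integral ha]
  have hnn : ∀ x, 0 ≤ (v ⬝ᵥ mono N x) * (mono N x ⬝ᵥ v) * cauchyWeight a N x := fun x => by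
    rw [dotProduct_comm v]
    exact mul_nonneg (mul_self_nonneg _) (cauchyWeight_pos a N x).le
  have hint : Integrable fun x => (v ⬝ᵥ mono N x) * (mono N x ⬝ᵥ v) * cauchyWeight a N x := by
    simp only [dotProduct_mono_mul]
    exact integrable_finsetSum _ fun i _ => integrable_finsetSum _ fun j _ =>
      (integrable_moment ha i j).const_mul _
  rw [setIntegral_pos_iff_support_of_nonneg_ae (ae_of_all _ hnn) hint.integrableOn]
  set P : Polynomial ℝ := ∑ i : Fin N, Polynomial.C (v i) * Polynomial.X ^ (i : ℕ) with hP
  have hPe : ∀ x, P.eval x = v ⬝ᵥ mono N x := fun x => by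
    simp [hP, Polynomial.eval_finsetSum, dotProduct, mono]
  have hP0 : P ≠ 0 := by
    obtain ⟨i, hi⟩ := Function.ne_iff.1 hv
    intro h0
    apply hi
    have := congrArg (fun q => Polynomial.coeff q i) h0
    simpa [hP, Polynomial.finsetSum_coeff, Polynomial.coeff_X_pow, Fin.val_inj] using this
  have hfin : {x | P.IsRoot x}.Finite := Polynomial.finite_setOfPred_isRoot hP0
  have hsub : I \ {x | P.IsRoot x}
      ⊆ (Function.support fun x => (v ⬝ᵥ mono N x) * (mono N x ⬝ᵥ v) * cauchyWeight a N x) ∩ I := by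
    rintro x ⟨hx, hx'⟩
    refine ⟨?_, hx⟩
    have h1 : v ⬝ᵥ mono N x ≠ 0 := by rw [← hPe]; exact hx'
    rw [Function.mem_support, dotProduct_comm (mono N x)]
    exact mul_ne_zero (mul_ne_zero h1 h1) (cauchyWeight_pos a N x).ne'
  refine lt_of_lt_of_le ?_ (measure_mono hsub)
  rw [measure_sdiff_null (hfin.measure_zero volume)]
  exact pos_iff_ne_zero.2 hI'

lemma posDef_hankel (ha : 0 ≤ a) (s : ℝ) : (hankel a N s).PosDef :=
  posDef_mat_integral (by simp) ha

lemma posDef_hankelTotal (ha : 0 ≤ a) : (hankelTotal a N).PosDef := by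
  have := posDef_mat_integral (a := a) (N := N) (I := univ) (by simp) ha
  simp only [setIntegral_univ] at this
  exact this

lemma det_hankel_ne_zero (ha : 0 ≤ a) (s : ℝ) : (hankel a N s).det ≠ 0 :=
  (posDef_hankel ha s).det_pos.ne'

lemma hasDerivAt_hankel (ha : 0 ≤ a) (s : ℝ) (i j : Fin N) :
    HasDerivAt (fun t => hankel a N t i j)
      (cauchyWeight a N s * (mono N s i * mono N s j)) s := by
  refine (hasDerivAt_cauchyMoment (a := a) (N := N) (k := i + j) ?_ s).congr_deriv ?_
  · have : ((i + j + 2 : ℕ) : ℝ) ≤ (2 * N : ℕ) := by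
      have := i.isLt
      have := j.isLt
      exact_mod_cast (by omega)
    push_cast at *
    linarith
  · simp only [mono]
    ring

/-- The second derivative of the vector of monomials. -/
def monoDeriv₂ (N : ℕ) (s : ℝ) : Fin N → ℝ :=
  fun i => i * (((i : ℕ) - 1 : ℕ) * s ^ ((i : ℕ) - 1 - 1))

lemma hasDerivAt_monoDeriv (N : ℕ) (s : ℝ) (i : Fin N) :
    HasDerivAt (fun t => monoDeriv N t i) (monoDeriv₂ N s i) s :=
  (hasDerivAt_pow ((i : ℕ) - 1) s).const_mul _

/-- The diagonal kernel without its weight. -/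
def diag (a : ℝ) (N : ℕ) (s : ℝ) : ℝ := invForm a N s (mono N s) (mono N s)

/-- The first derivative of `CauchyEnsemble.diag`. -/
def diag₁ (a : ℝ) (N : ℕ) (s : ℝ) : ℝ :=
  2 * invForm a N s (mono N s) (monoDeriv N s) - cauchyWeight a N s * diag a N s ^ 2

/-- The logarithmic derivative of the weight. -/
def logDerivWeight (a : ℝ) (N : ℕ) (s : ℝ) : ℝ := -(2 * (N + a) * s / (1 + s ^ 2))

/-- The second derivative of `CauchyEnsemble.diag`. -/
def diag₂ (a : ℝ) (N : ℕ) (s : ℝ) : ℝ :=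
  2 * (invForm a N s (monoDeriv N s) (monoDeriv N s) + invForm a N s (mono N s) (monoDeriv₂ N s)
      - cauchyWeight a N s * diag a N s * invForm a N s (mono N s) (monoDeriv N s))
    - (logDerivWeight a N s * cauchyWeight a N s * diag a N s ^ 2
      + cauchyWeight a N s * (2 * diag a N s * diag₁ a N s))

/-- The function `σ_N(s) = (1 + s²) R(s, s)`, in terms of the inverse of the Hankel matrix. -/
def sigma (a : ℝ) (N : ℕ) (s : ℝ) : ℝ := (1 + s ^ 2) * cauchyWeight a N s * diag a N s

/-- The first derivative of `CauchyEnsemble.sigma`. -/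
def sigma₁ (a : ℝ) (N : ℕ) (s : ℝ) : ℝ :=
  (2 - 2 * (N + a)) * (s * cauchyWeight a N s) * diag a N s
    + (1 + s ^ 2) * cauchyWeight a N s * diag₁ a N s

/-- The second derivative of `CauchyEnsemble.sigma`. -/
def sigma₂ (a : ℝ) (N : ℕ) (s : ℝ) : ℝ :=
  (2 - 2 * (N + a)) * (cauchyWeight a N s + s * (logDerivWeight a N s * cauchyWeight a N s))
      * diag a N s
    + (2 - 2 * (N + a)) * (s * cauchyWeight a N s) * diag₁ a N s
    + ((2 - 2 * (N + a)) * (s * cauchyWeight a N s) * diag₁ a N s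
      + (1 + s ^ 2) * cauchyWeight a N s * diag₂ a N s)

lemma invForm_comm (s : ℝ) (x y : Fin N → ℝ) : invForm a N s x y = invForm a N s y x := by
  have h : ((hankel a N s)⁻¹)ᵀ = (hankel a N s)⁻¹ := by
    rw [transpose_nonsing_inv, hankel, mat_isSymm]
  rw [invForm, dotProduct_mulVec, ← mulVec_transpose, h, dotProduct_comm]
  rfl

lemma hasDerivAt_diag (ha : 0 ≤ a) (s : ℝ) : HasDerivAt (diag a N) (diag₁ a N s) s := by
  refine (hasDerivAt_dotProduct_inv (hasDerivAt_hankel ha s) (det_hankel_ne_zero ha)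
    (hasDerivAt_mono N s) (hasDerivAt_mono N s)).congr_deriv ?_
  have := invForm_comm (a := a) (N := N) s (monoDeriv N s) (mono N s)
  simp only [diag₁, diag, invForm] at *
  linear_combination this

lemma hasDerivAt_diag₁ (ha : 0 ≤ a) (s : ℝ) : HasDerivAt (diag₁ a N) (diag₂ a N s) s := by
  have h1 := hasDerivAt_dotProduct_inv (hasDerivAt_hankel (N := N) ha s) (det_hankel_ne_zero ha)
    (hasDerivAt_mono N s) (hasDerivAt_monoDeriv N s)
  refine ((h1.const_mul 2).sub ((hasDerivAt_cauchyWeight a N s).mul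
    ((hasDerivAt_diag ha s).pow 2))).congr_deriv ?_
  simp only [diag₂, logDerivWeight, invForm, Pi.pow_apply, diag]
  push_cast
  ring

lemma hasDerivAt_sigma (ha : 0 ≤ a) (s : ℝ) : HasDerivAt (sigma a N) (sigma₁ a N s) s := by
  have h1 : HasDerivAt (fun x : ℝ => 1 + x ^ 2) (2 * s) s := by
    simpa using (hasDerivAt_pow 2 s).const_add 1
  refine ((h1.mul (hasDerivAt_cauchyWeight a N s)).mul (hasDerivAt_diag ha s)).congr_deriv ?_
  simp only [sigma₁, Pi.mul_apply]
  field_simp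
  ring

lemma hasDerivAt_sigma₁ (ha : 0 ≤ a) (s : ℝ) : HasDerivAt (sigma₁ a N) (sigma₂ a N s) s := by
  have h1 : HasDerivAt (fun x : ℝ => 1 + x ^ 2) (2 * s) s := by
    simpa using (hasDerivAt_pow 2 s).const_add 1
  have hw := hasDerivAt_cauchyWeight a N s
  refine (((((hasDerivAt_id s).mul hw).const_mul (2 - 2 * (N + a))).mul
    (hasDerivAt_diag ha s)).add ((h1.mul hw).mul (hasDerivAt_diag₁ ha s))).congr_deriv ?_
  simp only [sigma₂, Pi.mul_apply, logDerivWeight, id]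
  field_simp
  ring

/-- The incomplete moments `μ_0, …, μ_{2n+2}` of the Cauchy weight with `N = n + 1`. The integrals
of the last two diverge when `a` is small, so they are defined by the Pearson recurrence. -/
def extMoment (a : ℝ) (n k : ℕ) (s : ℝ) : ℝ :=
  if k ≤ 2 * n then cauchyMoment a (n + 1) k s
  else if k = 2 * n + 1 then
    (s ^ (2 * n) * (1 + s ^ 2) * cauchyWeight a (n + 1) s
      - (2 * n : ℕ) * cauchyMoment a (n + 1) (2 * n - 1) s) / (-(2 * a))
  else (s ^ (2 * n + 1) * (1 + s ^ 2) * cauchyWeight a (n + 1) s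
      - (2 * n + 1 : ℕ) * cauchyMoment a (n + 1) (2 * n) s) / (1 - 2 * a)

lemma hasDerivAt_extMoment {n : ℕ} (ha : 0 < a) (ha' : a ≠ 1 / 2) {k : ℕ} (hk : k ≤ 2 * n + 2)
    (s : ℝ) : HasDerivAt (extMoment a n k) (s ^ k * cauchyWeight a (n + 1) s) s := by
  have hm : ∀ k : ℕ, k ≤ 2 * n → HasDerivAt (cauchyMoment a (n + 1) k)
      (s ^ k * cauchyWeight a (n + 1) s) s := fun k hk => by
    refine hasDerivAt_cauchyMoment ?_ s
    have : (k : ℝ) ≤ (2 * n : ℕ) := by exact_mod_cast hk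
    push_cast at *
    linarith
  by_cases h1 : k ≤ 2 * n
  · have : extMoment a n k = cauchyMoment a (n + 1) k := by
      funext t; rw [extMoment, if_pos h1]
    rw [this]
    exact hm k h1
  by_cases h2 : k = 2 * n + 1
  · have : extMoment a n k = fun s => (s ^ (2 * n) * (1 + s ^ 2) * cauchyWeight a (n + 1) s
      - (2 * n : ℕ) * cauchyMoment a (n + 1) (2 * n - 1) s) / (-(2 * a)) := by
      funext t; rw [extMoment, if_neg h1, if_pos h2]
    rw [this]
    refine (((hasDerivAt_pearson a (n + 1) (2 * n) s).sub
      ((hm (2 * n - 1) (by omega)).const_mul _)).div_const _).congr_deriv ?_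
    rw [h2]
    have : -(2 * a) ≠ 0 := by simp [ha.ne']
    field_simp
    push_cast
    ring
  · obtain rfl : k = 2 * n + 2 := by omega
    have : extMoment a n (2 * n + 2)
      = fun s => (s ^ (2 * n + 1) * (1 + s ^ 2) * cauchyWeight a (n + 1) s
      - (2 * n + 1 : ℕ) * cauchyMoment a (n + 1) (2 * n) s) / (1 - 2 * a) := by
      funext t; rw [extMoment, if_neg h1, if_neg h2]
    rw [this]
    refine (((hasDerivAt_pearson a (n + 1) (2 * n + 1) s).sub
      ((hm (2 * n) le_rfl).const_mul _)).div_const _).congr_deriv ?_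
    have : 1 - 2 * a ≠ 0 := fun h => ha' (by linarith)
    rw [Nat.add_sub_cancel]
    field_simp
    push_cast
    ring

lemma pearsonRec_extMoment {n : ℕ} (ha : 0 < a) (ha' : a ≠ 1 / 2) (s : ℝ) :
    PearsonRec (fun k => extMoment a n k s) n a s (cauchyWeight a (n + 1) s) := by
  intro k hk
  have h2a : -(2 * a) ≠ 0 := by simp [ha.ne']
  have h1a : 1 - 2 * a ≠ 0 := fun h => ha' (by linarith)
  rcases (by omega : k + 1 ≤ 2 * n ∨ k = 2 * n ∨ k = 2 * n + 1) with h | rfl | rfl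
  · simp only [extMoment, if_pos (show k - 1 ≤ 2 * n by omega), if_pos h]
    rw [← cauchyMoment_rec]
    · push_cast; ring
    · have : ((k + 1 : ℕ) : ℝ) ≤ (2 * n : ℕ) := by exact_mod_cast h
      push_cast at *
      linarith
  · simp only [extMoment, if_pos (show 2 * n - 1 ≤ 2 * n by omega),
      if_neg (show ¬ 2 * n + 1 ≤ 2 * n by omega), if_true]
    push_cast
    field_simp
    ring
  · simp only [extMoment, Nat.add_sub_cancel, le_refl, if_true,
      if_neg (show ¬ 2 * n + 1 + 1 ≤ 2 * n by omega),
      if_neg (show ¬ 2 * n + 1 + 1 = 2 * n + 1 by omega)]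
    push_cast
    field_simp
    ring

lemma mat_extMoment (n : ℕ) (s : ℝ) :
    mat (fun k => extMoment a n k s) (n + 1) = hankel a (n + 1) s := by
  ext i j
  have := i.isLt
  have := j.isLt
  simp only [mat, hankel, of_apply, extMoment]
  rw [if_pos (by omega)]

/-- The polynomial relation between `σ_N` and its derivatives. -/
def odeExpr (a : ℝ) (N : ℕ) (s : ℝ) : ℝ :=
  (1 + s ^ 2) ^ 2 * sigma₂ a N s ^ 2 - 4 * a ^ 2 * (sigma a N s - s * sigma₁ a N s) ^ 2
      + 4 * sigma a N s * sigma₁ a N s * (sigma a N s - 2 * s * sigma₁ a N s)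
      + 4 * N * (N + 2 * a) * sigma₁ a N s ^ 2 + 4 * (1 + s ^ 2) * sigma₁ a N s ^ 3

lemma odeExpr_eq_zero_of_generic {n : ℕ} (ha : 0 < a) (ha' : a ≠ 1 / 2) (s : ℝ) :
    odeExpr a (n + 1) s = 0 := by
  have hw : ∀ s, HasDerivAt (cauchyWeight a (n + 1))
      (-(2 * (n + 1 + a) * s / (1 + s ^ 2)) * cauchyWeight a (n + 1) s) s := fun s => by
    simpa using hasDerivAt_cauchyWeight a (n + 1) s
  have := sigma_ode (μ := fun k s => extMoment a n k s) (w := cauchyWeight a (n + 1)) (n := n)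
    (a := a) (fun k hk s => hasDerivAt_extMoment ha ha' hk s) hw
    (fun s => pearsonRec_extMoment ha ha' s)
    (fun s => by rw [mat_extMoment]; exact det_hankel_ne_zero ha.le s)
    (σ := sigma a (n + 1)) (σ1 := sigma₁ a (n + 1)) (σ2 := sigma₂ a (n + 1))
    (fun s => by rw [form, mat_extMoment]; rfl)
    (fun s => hasDerivAt_sigma ha.le s) (fun s => hasDerivAt_sigma₁ ha.le s) s
  rw [odeExpr]
  push_cast
  exact this

lemma continuous_cauchyWeight_param (N : ℕ) (s : ℝ) :
    Continuous fun a => cauchyWeight a N s := by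
  have h0 : (0 : ℝ) < 1 + s ^ 2 := by positivity
  unfold cauchyWeight
  exact Continuous.rpow continuous_const (by fun_prop) fun _ => Or.inl h0.ne'

lemma continuousOn_cauchyMoment {k : ℕ} (hk : k + 2 ≤ 2 * N) (s : ℝ) :
    ContinuousOn (fun a => cauchyMoment a N k s) (Ici 0) := by
  intro a₀ _
  refine continuousWithinAt_of_dominated (bound := fun x => |x ^ k * cauchyWeight 0 N x|)
    (Eventually.of_forall fun a => ?_) ?_ ?_ (ae_of_all _ fun x => ?_)
  · have := continuous_cauchyWeight a N
    exact (by fun_prop : Continuous _).aestronglyMeasurable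
  · filter_upwards [self_mem_nhdsWithin] with a ha
    refine ae_of_all _ fun x => ?_
    rw [Real.norm_eq_abs, abs_mul, abs_mul, abs_of_pos (cauchyWeight_pos a N x),
      abs_of_pos (cauchyWeight_pos 0 N x)]
    refine mul_le_mul_of_nonneg_left ?_ (abs_nonneg _)
    refine Real.rpow_le_rpow_of_exponent_le (by nlinarith [sq_nonneg x]) ?_
    have : (0 : ℝ) ≤ a := ha
    linarith
  · refine (integrable_pow_mul_cauchyWeight ?_).abs.integrableOn
    have : ((k + 2 : ℕ) : ℝ) ≤ (2 * N : ℕ) := by exact_mod_cast hk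
    push_cast at *
    linarith
  · exact ((continuous_cauchyWeight_param N x).const_mul _).continuousWithinAt

lemma continuousOn_invForm (s : ℝ) (x y : Fin N → ℝ) :
    ContinuousOn (fun a => invForm a N s x y) (Ici 0) := by
  have hH : ContinuousOn (fun a => hankel a N s) (Ici 0) :=
    continuousOn_pi.2 fun i => continuousOn_pi.2 fun j =>
      continuousOn_cauchyMoment (by have := i.isLt; have := j.isLt; omega) s
  have hd : ContinuousOn (fun a => (hankel a N s).det) (Ici 0) :=
    (Continuous.matrix_det continuous_id).comp_continuousOn hH
  have hadj : ContinuousOn (fun a => (hankel a N s).adjugate) (Ici 0) :=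
    (Continuous.matrix_adjugate continuous_id).comp_continuousOn hH
  have h : (fun a => invForm a N s x y)
      = fun a => ∑ i, x i * ∑ j, ((hankel a N s).det)⁻¹ * (hankel a N s).adjugate i j * y j := by
    funext a
    simp only [invForm, dotProduct, mulVec, inv_def, Matrix.smul_apply, smul_eq_mul,
      Ring.inverse_eq_inv]
  rw [h]
  refine continuousOn_finsetSum _ fun i _ => ContinuousOn.mul continuousOn_const <|
    continuousOn_finsetSum _ fun j _ => ContinuousOn.mul (ContinuousOn.mul
      (hd.inv₀ fun a ha => det_hankel_ne_zero ha s) ?_) continuousOn_const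
  exact continuousOn_pi.1 (continuousOn_pi.1 hadj i) j

lemma continuousOn_odeExpr (s : ℝ) : ContinuousOn (fun a => odeExpr a N s) (Ici 0) := by
  have hw := (continuous_cauchyWeight_param N s).continuousOn (s := Ici 0)
  have h0 : ContinuousOn (fun a => diag a N s) (Ici 0) := continuousOn_invForm s _ _
  have h1 := continuousOn_invForm s (mono N s) (monoDeriv N s)
  have h2 := continuousOn_invForm s (monoDeriv N s) (monoDeriv N s)
  have h3 := continuousOn_invForm s (mono N s) (monoDeriv₂ N s)
  have hl : ContinuousOn (fun a => logDerivWeight a N s) (Ici 0) := by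
    unfold logDerivWeight
    fun_prop
  unfold odeExpr sigma sigma₁ sigma₂ diag₂ diag₁
  fun_prop

/-- The Painlevé VI `σ`-form equation for the Cauchy ensemble. The algebraic derivation excludes
`a = 0` and `a = 1/2`, which are reached by continuity in `a`. -/
theorem odeExpr_eq_zero {n : ℕ} (ha : 0 ≤ a) (s : ℝ) : odeExpr a (n + 1) s = 0 := by
  have h1 : Tendsto (fun b => odeExpr b (n + 1) s) (𝓝[>] a) (𝓝 (odeExpr a (n + 1) s)) :=
    (continuousOn_odeExpr s a ha).mono (fun b hb => ha.trans (le_of_lt hb))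
  refine tendsto_nhds_unique h1 (tendsto_const_nhds.congr' ?_)
  have h2 : ∀ᶠ b in 𝓝[>] a, b ≠ 1 / 2 := by
    by_cases h : a = 1 / 2
    · filter_upwards [self_mem_nhdsWithin] with b hb
      exact fun h' => absurd hb (by simp [h, h'])
    · exact nhdsWithin_le_nhds (isOpen_ne.mem_nhds h)
  filter_upwards [self_mem_nhdsWithin, h2] with b hb hb'
  exact (odeExpr_eq_zero_of_generic (lt_of_le_of_lt ha hb) hb' s).symm

end CauchyEnsemble

/-! ### The correlation kernel and its resolvent -/

namespace CauchyEnsemble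
open Matrix Hankel Polynomial

variable {a : ℝ} {N : ℕ}

/-- The first `N` coefficients of a polynomial. -/
def coeffVec (N : ℕ) (p : ℝ[X]) : Fin N → ℝ := fun i => p.coeff i

lemma eval_eq_coeffVec {p : ℝ[X]} (hp : p.natDegree < N) (x : ℝ) :
    p.eval x = coeffVec N p ⬝ᵥ mono N x := by
  rw [eval_eq_sum_range' hp, Finset.sum_range]
  rfl

lemma integral_eval_mul_eval (ha : 0 ≤ a) {p q : ℝ[X]} (hp : p.natDegree < N)
    (hq : q.natDegree < N) : ∫ x, p.eval x * q.eval x * cauchyWeight a N x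
      = coeffVec N p ⬝ᵥ hankelTotal a N *ᵥ coeffVec N q := by
  have := dotProduct_mat_integral (I := univ) ha (coeffVec N p) (coeffVec N q)
  simp only [setIntegral_univ] at this
  refine Eq.trans ?_ this.symm
  congr 1
  funext x
  rw [eval_eq_coeffVec hp, eval_eq_coeffVec hq, dotProduct_comm (mono N x)]

lemma coeffVec_ne_zero {p : ℝ[X]} (hp : p.natDegree < N) (h0 : p ≠ 0) : coeffVec N p ≠ 0 := by
  intro h
  apply h0
  ext i
  by_cases hi : i < N
  · exact congrFun h ⟨i, hi⟩
  · rw [coeff_eq_zero_of_natDegree_lt (by omega), coeff_zero]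

lemma monicOrthPoly_monic_natDegree (w : ℝ → ℝ) (n : ℕ) :
    (monicOrthPoly w n).Monic ∧ (monicOrthPoly w n).natDegree = n := by
  induction n using Nat.strong_induction_on with
  | _ n ih =>
    rw [monicOrthPoly]
    set S := ∑ k : Fin n, C ((∫ x, x ^ n * (monicOrthPoly w k).eval x * w x) /
        ∫ x, (monicOrthPoly w k).eval x ^ 2 * w x) * monicOrthPoly w k
    have hS : S.degree < n := by
      refine (degree_sum_le _ _).trans_lt ?_
      refine (Finset.sup_lt_iff (WithBot.bot_lt_coe n)).2 fun k _ => ?_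
      rw [← smul_eq_C_mul]
      refine (degree_smul_le _ _).trans_lt ?_
      rw [degree_eq_natDegree (ih k k.isLt).1.ne_zero, (ih k k.isLt).2]
      exact Nat.cast_lt.2 k.isLt
    refine ⟨monic_X_pow_sub hS, natDegree_eq_of_degree_eq_some ?_⟩
    rw [degree_sub_eq_left_of_degree_lt (by rwa [degree_X_pow]), degree_X_pow]

lemma natDegree_monicOrthPoly (w : ℝ → ℝ) (n : ℕ) : (monicOrthPoly w n).natDegree = n :=
  (monicOrthPoly_monic_natDegree w n).2

lemma monicOrthPoly_ne_zero (w : ℝ → ℝ) (n : ℕ) : monicOrthPoly w n ≠ 0 :=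
  (monicOrthPoly_monic_natDegree w n).1.ne_zero

/-- The squared norm of a monic orthogonal polynomial, as a quadratic form. -/
lemma norm_sq_monicOrthPoly (ha : 0 ≤ a) {n : ℕ} (hn : n < N) :
    ∫ x, (monicOrthPoly (cauchyWeight a N) n).eval x ^ 2 * cauchyWeight a N x
      = coeffVec N (monicOrthPoly (cauchyWeight a N) n) ⬝ᵥ
        hankelTotal a N *ᵥ coeffVec N (monicOrthPoly (cauchyWeight a N) n) := by
  rw [← integral_eval_mul_eval ha (by rwa [natDegree_monicOrthPoly])
    (by rwa [natDegree_monicOrthPoly])]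
  simp only [sq]

lemma norm_sq_monicOrthPoly_pos (ha : 0 ≤ a) {n : ℕ} (hn : n < N) :
    0 < ∫ x, (monicOrthPoly (cauchyWeight a N) n).eval x ^ 2 * cauchyWeight a N x := by
  rw [norm_sq_monicOrthPoly ha hn]
  have hs : ∀ v : Fin N → ℝ, star v = v := fun v => by ext i; simp
  have := (posDef_hankelTotal (N := N) ha).dotProduct_mulVec_pos
    (coeffVec_ne_zero (by rwa [natDegree_monicOrthPoly])
      (monicOrthPoly_ne_zero (cauchyWeight a N) n))
  rwa [hs] at this

lemma hankelTotal_form_comm (x y : Fin N → ℝ) :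
    x ⬝ᵥ hankelTotal a N *ᵥ y = y ⬝ᵥ hankelTotal a N *ᵥ x := by
  rw [dotProduct_mulVec, ← mulVec_transpose, hankelTotal, mat_isSymm, dotProduct_comm]

lemma monicOrthPoly_orthogonal (ha : 0 ≤ a) {n : ℕ} (hn : n < N) : ∀ k < n,
    coeffVec N (monicOrthPoly (cauchyWeight a N) k) ⬝ᵥ
      hankelTotal a N *ᵥ coeffVec N (monicOrthPoly (cauchyWeight a N) n) = 0 := by
  induction n using Nat.strong_induction_on with
  | _ n ih =>
    intro k hk
    set w := cauchyWeight a N with hw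
    have h1 : coeffVec N (monicOrthPoly w n) = coeffVec N (X ^ n)
        - ∑ j : Fin n, ((∫ x, x ^ n * (monicOrthPoly w j).eval x * w x) /
          ∫ x, (monicOrthPoly w j).eval x ^ 2 * w x) • coeffVec N (monicOrthPoly w j) := by
      funext i
      rw [monicOrthPoly]
      simp [coeffVec, finsetSum_coeff]
    have h2 : ∫ x, x ^ n * (monicOrthPoly w k).eval x * w x = coeffVec N (monicOrthPoly w k) ⬝ᵥ
        hankelTotal a N *ᵥ coeffVec N (X ^ n) := by
      rw [hankelTotal_form_comm, ← integral_eval_mul_eval ha (by rwa [natDegree_X_pow])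
        (by rw [natDegree_monicOrthPoly]; omega)]
      simp [hw]
    rw [h1, mulVec_sub, dotProduct_sub, mulVec_sum, dotProduct_sum,
      Finset.sum_eq_single (⟨k, hk⟩ : Fin n), mulVec_smul, dotProduct_smul, smul_eq_mul,
      ← norm_sq_monicOrthPoly ha (hk.trans hn), ← hw, div_mul_cancel₀, h2, sub_self]
    · exact (norm_sq_monicOrthPoly_pos ha (hk.trans hn)).ne'
    · intro j _ hj
      rw [mulVec_smul, dotProduct_smul]
      have hj' : (j : ℕ) ≠ k := fun h => hj (Fin.ext h)
      rcases lt_or_gt_of_ne hj' with h | h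
      · rw [hankelTotal_form_comm, ih k hk (hk.trans hn) j h, smul_zero]
      · rw [ih j j.isLt (j.isLt.trans hn) k h, smul_zero]
    · simp

lemma coeffVec_orthonormalPoly (n : ℕ) : coeffVec N (orthonormalPoly (cauchyWeight a N) n)
    = (Real.sqrt (∫ x, (monicOrthPoly (cauchyWeight a N) n).eval x ^ 2
        * cauchyWeight a N x))⁻¹ • coeffVec N (monicOrthPoly (cauchyWeight a N) n) := by
  funext i
  simp [coeffVec, orthonormalPoly]

lemma orthonormalPoly_orthonormal (ha : 0 ≤ a) (k l : Fin N) :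
    coeffVec N (orthonormalPoly (cauchyWeight a N) k) ⬝ᵥ
      hankelTotal a N *ᵥ coeffVec N (orthonormalPoly (cauchyWeight a N) l)
      = (1 : Matrix (Fin N) (Fin N) ℝ) k l := by
  rw [coeffVec_orthonormalPoly, coeffVec_orthonormalPoly, smul_dotProduct, mulVec_smul,
    dotProduct_smul, smul_eq_mul, smul_eq_mul]
  by_cases h : k = l
  · subst h
    have := norm_sq_monicOrthPoly_pos ha k.isLt
    rw [← norm_sq_monicOrthPoly ha k.isLt, one_apply_eq, ← mul_assoc, ← mul_inv,
      Real.mul_self_sqrt this.le, inv_mul_cancel₀ this.ne']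
  · rw [one_apply_ne h]
    have h' : (k : ℕ) ≠ l := fun h' => h (Fin.ext h')
    rcases lt_or_gt_of_ne h' with h' | h'
    · rw [monicOrthPoly_orthogonal ha l.isLt _ h']
      simp
    · rw [hankelTotal_form_comm, monicOrthPoly_orthogonal ha k.isLt _ h']
      simp

/-- The Christoffel–Darboux sum is the inverse of the Hankel matrix in the monomial basis. -/
lemma sum_orthonormalPoly (ha : 0 ≤ a) (x y : ℝ) :
    ∑ l ∈ Finset.range N, (orthonormalPoly (cauchyWeight a N) l).eval x
        * (orthonormalPoly (cauchyWeight a N) l).eval y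
      = mono N x ⬝ᵥ (hankelTotal a N)⁻¹ *ᵥ mono N y := by
  set T : Matrix (Fin N) (Fin N) ℝ :=
    of fun l => coeffVec N (orthonormalPoly (cauchyWeight a N) l) with hT
  have h1 : T * (hankelTotal a N * Tᵀ) = 1 := by
    ext k l
    rw [← orthonormalPoly_orthonormal ha k l, mul_apply]
    simp only [dotProduct, mulVec, mul_apply, transpose_apply, hT, of_apply]
  have h2 : (hankelTotal a N)⁻¹ = Tᵀ * T := by
    refine inv_eq_right_inv ?_
    rw [← mul_assoc]
    exact mul_eq_one_comm.1 h1
  have h3 : ∀ (l : Fin N) (x : ℝ),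
      (orthonormalPoly (cauchyWeight a N) l).eval x = (T *ᵥ mono N x) l := fun l x => by
    rw [eval_eq_coeffVec (N := N)]
    · rfl
    · rw [orthonormalPoly, ← smul_eq_C_mul]
      refine (natDegree_smul_le _ _).trans_lt ?_
      rw [natDegree_monicOrthPoly]
      exact l.isLt
  rw [h2, ← mulVec_mulVec, dotProduct_mulVec, vecMul_transpose, Finset.sum_range]
  simp only [h3]
  rfl

/-- The monomials multiplied by the square root of the weight. -/
def basisFun (a : ℝ) (N : ℕ) (x : ℝ) : Fin N → ℝ := Real.sqrt (cauchyWeight a N x) • mono N x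

lemma basisFun_form (A : Matrix (Fin N) (Fin N) ℝ) (x y : ℝ) :
    basisFun a N x ⬝ᵥ A *ᵥ basisFun a N y
      = Real.sqrt (cauchyWeight a N x * cauchyWeight a N y) * (mono N x ⬝ᵥ A *ᵥ mono N y) := by
  rw [basisFun, basisFun, smul_dotProduct, mulVec_smul, dotProduct_smul, smul_eq_mul, smul_eq_mul,
    Real.sqrt_mul (cauchyWeight_pos a N x).le]
  ring

lemma cauchyKernel_eq (ha : 0 ≤ a) (x y : ℝ) :
    cauchyKernel a N x y = basisFun a N x ⬝ᵥ (hankelTotal a N)⁻¹ *ᵥ basisFun a N y := by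
  rw [basisFun_form, ← sum_orthonormalPoly ha]
  rfl

lemma memLp_basisFun (ha : 0 ≤ a) (I : Set ℝ) (i : Fin N) :
    MemLp (fun x => basisFun a N x i) 2 (volume.restrict I) := by
  have hc : Continuous fun x => basisFun a N x i := by
    have := continuous_cauchyWeight a N
    simp only [basisFun, mono, Pi.smul_apply, smul_eq_mul]
    fun_prop
  refine (memLp_two_iff_integrable_sq hc.aestronglyMeasurable).2 ?_
  have : (fun x => basisFun a N x i ^ 2)
      = fun x => x ^ ((i : ℕ) + i) * cauchyWeight a N x := by
    funext x
    simp only [basisFun, mono, Pi.smul_apply, smul_eq_mul]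
    rw [mul_pow, Real.sq_sqrt (cauchyWeight_pos a N x).le]
    ring
  rw [this]
  exact (integrable_moment ha i i).integrableOn

lemma memLp_basisFun_dotProduct (ha : 0 ≤ a) (I : Set ℝ) (v : Fin N → ℝ) :
    MemLp (fun x => basisFun a N x ⬝ᵥ v) 2 (volume.restrict I) := by
  simp only [dotProduct]
  refine memLp_finsetSum _ fun i _ => ?_
  simpa only [mul_comm] using (memLp_basisFun ha I i).const_mul (v i)

lemma mat_integral_Ioi (ha : 0 ≤ a) (s : ℝ) :
    mat (fun k => ∫ x in Ioi s, x ^ k * cauchyWeight a N x) N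
      = hankelTotal a N - hankel a N s := by
  ext i j
  have := intervalIntegral.integral_Iic_add_Ioi (b := s) (integrable_moment ha i j).integrableOn
    (integrable_moment ha i j).integrableOn
  rw [Matrix.sub_apply]
  simp only [mat, hankelTotal, hankel, of_apply, cauchyTotal, cauchyMoment]
  linarith

lemma integral_basisFun_mul (ha : 0 ≤ a) (s : ℝ) (v u : Fin N → ℝ) :
    ∫ z in Ioi s, (v ⬝ᵥ basisFun a N z) * (basisFun a N z ⬝ᵥ u)
      = v ⬝ᵥ (hankelTotal a N - hankel a N s) *ᵥ u := by
  rw [← mat_integral_Ioi ha, dotProduct_mat_integral ha]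
  congr 1
  funext z
  rw [basisFun, dotProduct_smul, smul_dotProduct, smul_eq_mul, smul_eq_mul]
  linear_combination (v ⬝ᵥ mono N z) * (mono N z ⬝ᵥ u)
    * Real.mul_self_sqrt (cauchyWeight_pos a N z).le

/-- The resolvent kernel on `(s, ∞)` in terms of the Hankel matrix of the weight restricted to
`(-∞, s)`. -/
def resolvent (a : ℝ) (N : ℕ) (s x y : ℝ) : ℝ :=
  basisFun a N x ⬝ᵥ (hankel a N s)⁻¹ *ᵥ basisFun a N y

lemma form_comm_of_symm {A : Matrix (Fin N) (Fin N) ℝ} (hA : Aᵀ = A) (x y : Fin N → ℝ) :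
    x ⬝ᵥ A *ᵥ y = (A *ᵥ x) ⬝ᵥ y := by
  rw [dotProduct_mulVec, ← mulVec_transpose, hA]

lemma hankel_isUnit (ha : 0 ≤ a) (s : ℝ) : IsUnit (hankel a N s).det :=
  isUnit_iff_ne_zero.2 (det_hankel_ne_zero ha s)

lemma hankelTotal_isUnit (ha : 0 ≤ a) : IsUnit (hankelTotal a N).det :=
  isUnit_iff_ne_zero.2 (posDef_hankelTotal ha).det_pos.ne'

lemma hankel_inv_symm (s : ℝ) : ((hankel a N s)⁻¹)ᵀ = (hankel a N s)⁻¹ := by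
  rw [transpose_nonsing_inv, hankel, mat_isSymm]

lemma hankelTotal_inv_symm : ((hankelTotal a N)⁻¹)ᵀ = (hankelTotal a N)⁻¹ := by
  rw [transpose_nonsing_inv, hankelTotal, mat_isSymm]

/-- On the span of `basisFun` the operator with kernel `K_N` is `H(∞)⁻¹ (H(∞) - H(s))`, so both
resolvent equations are matrix identities. -/
lemma isResolventKernel_resolvent (ha : 0 ≤ a) (s : ℝ) :
    IsResolventKernel (cauchyKernel a N) (Ioi s) (resolvent a N s) where
  memLp_left y := memLp_basisFun_dotProduct ha _ _
  memLp_right x := by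
    have : (fun z => resolvent a N s x z)
        = fun z => basisFun a N z ⬝ᵥ ((hankel a N s)⁻¹ *ᵥ basisFun a N x) := by
      funext z
      rw [resolvent, form_comm_of_symm (hankel_inv_symm s), dotProduct_comm]
    rw [this]
    exact memLp_basisFun_dotProduct ha _ _
  eq_left x y := by
    have h : ∀ z, cauchyKernel a N x z * resolvent a N s z y
        = (((hankelTotal a N)⁻¹ *ᵥ basisFun a N x) ⬝ᵥ basisFun a N z)
          * (basisFun a N z ⬝ᵥ ((hankel a N s)⁻¹ *ᵥ basisFun a N y)) := fun z => by
      rw [cauchyKernel_eq ha, form_comm_of_symm hankelTotal_inv_symm, resolvent]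
    simp only [h]
    rw [integral_basisFun_mul ha, ← form_comm_of_symm hankelTotal_inv_symm, cauchyKernel_eq ha,
      mulVec_mulVec, mulVec_mulVec, mul_sub, nonsing_inv_mul _ (hankelTotal_isUnit ha), sub_mul,
      one_mul, mul_assoc, mul_nonsing_inv _ (hankel_isUnit ha s), mul_one, sub_mulVec,
      dotProduct_sub, resolvent]
    ring
  eq_right x y := by
    have h : ∀ z, resolvent a N s x z * cauchyKernel a N z y
        = (((hankel a N s)⁻¹ *ᵥ basisFun a N x) ⬝ᵥ basisFun a N z)
          * (basisFun a N z ⬝ᵥ ((hankelTotal a N)⁻¹ *ᵥ basisFun a N y)) := fun z => by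
      rw [cauchyKernel_eq ha, resolvent, form_comm_of_symm (hankel_inv_symm s)]
    simp only [h]
    rw [integral_basisFun_mul ha, ← form_comm_of_symm (hankel_inv_symm s), cauchyKernel_eq ha,
      mulVec_mulVec, mulVec_mulVec, mul_sub, nonsing_inv_mul _ (hankel_isUnit ha s), sub_mul,
      one_mul, mul_assoc, mul_nonsing_inv _ (hankelTotal_isUnit ha), mul_one, sub_mulVec,
      dotProduct_sub, resolvent]
    ring

/-- The resolvent equation forces `R(·, y)` into the finite dimensional span of `basisFun`, everywhere
and not only almost everywhere; its coefficients solve a linear system with matrix `H(s)`. -/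
lemma eq_resolvent (ha : 0 ≤ a) (s : ℝ) {R : ℝ → ℝ → ℝ}
    (hR : IsResolventKernel (cauchyKernel a N) (Ioi s) R) : R = resolvent a N s := by
  funext x y
  set v : Fin N → ℝ := fun i => ∫ z in Ioi s, basisFun a N z i * R z y with hv
  set r : Fin N → ℝ := (hankelTotal a N)⁻¹ *ᵥ (basisFun a N y + v) with hr
  have hlin : ∀ u : Fin N → ℝ,
      ∫ z in Ioi s, (u ⬝ᵥ basisFun a N z) * R z y = u ⬝ᵥ v := fun u => by
    have : ∀ z, (u ⬝ᵥ basisFun a N z) * R z y = ∑ i, u i * (basisFun a N z i * R z y) :=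
      fun z => by simp only [dotProduct, Finset.sum_mul, mul_assoc]
    simp only [this]
    have hint : ∀ i, Integrable (fun z => u i * (basisFun a N z i * R z y))
        (volume.restrict (Ioi s)) := fun i =>
      ((memLp_basisFun ha (Ioi s) i).integrable_mul (hR.memLp_left y)).const_mul (u i)
    rw [integral_finsetSum _ fun i _ => hint i]
    simp only [integral_const_mul, dotProduct, hv]
  have hRr : ∀ x, R x y = basisFun a N x ⬝ᵥ r := fun x => by
    have h := hR.eq_left x y
    simp only [cauchyKernel_eq ha, form_comm_of_symm hankelTotal_inv_symm] at h
    rw [h, hlin, ← dotProduct_add, ← form_comm_of_symm hankelTotal_inv_symm]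
  have hvr : v = (hankelTotal a N - hankel a N s) *ᵥ r := by
    funext i
    have := integral_basisFun_mul ha s (Pi.single i 1) r
    rw [single_one_dotProduct] at this
    rw [← this, hv]
    simp only [single_one_dotProduct, hRr]
  have hHr : hankel a N s *ᵥ r = basisFun a N y := by
    have h1 : hankelTotal a N *ᵥ r = basisFun a N y + v := by
      rw [hr, mulVec_mulVec, mul_nonsing_inv _ (hankelTotal_isUnit ha), one_mulVec]
    rw [sub_mulVec, h1] at hvr
    exact (add_right_cancel (sub_eq_iff_eq_add.1 hvr.symm |>.trans (add_comm _ _))).symm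
  rw [hRr, resolvent, ← hHr, mulVec_mulVec, nonsing_inv_mul _ (hankel_isUnit ha s), one_mulVec]

theorem existsUnique_resolvent (ha : 0 ≤ a) (s : ℝ) :
    ∃! R : ℝ → ℝ → ℝ, IsResolventKernel (cauchyKernel a N) (Ioi s) R :=
  ⟨resolvent a N s, isResolventKernel_resolvent ha s, fun _ hR => eq_resolvent ha s hR⟩

/-- The function `σ_N` of the statement is `(1 + s²)` times the logarithmic derivative of
`det H(s)`. -/
theorem cauchySigma_eq (ha : 0 ≤ a) (s : ℝ) : cauchySigma a N s = sigma a N s := by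
  have h : ∃ R, IsResolventKernel (cauchyKernel a N) (Ioi s) R :=
    ⟨_, isResolventKernel_resolvent ha s⟩
  rw [cauchySigma, resolventKernel, dif_pos h, eq_resolvent ha s h.choose_spec, resolvent,
    basisFun_form, Real.sqrt_mul_self (cauchyWeight_pos a N s).le, sigma, diag, invForm, mul_assoc]

end CauchyEnsemble

/-! ### Gap probabilities as ratios of Hankel determinants -/

open Matrix in
/-- Andréief's identity for the square of a determinant. -/
lemma integral_prod_mul_det_sq {N : ℕ} (ν : Measure ℝ) [SigmaFinite ν] (f : Fin N → ℝ → ℝ)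
    (u : ℝ → ℝ) (hint : ∀ j k, Integrable (fun x => f j x * f k x * u x) ν) :
    ∫ x : Fin N → ℝ, (∏ l, u (x l)) * (of fun i j => f j (x i)).det ^ 2 ∂(Measure.pi fun _ => ν)
      = (N.factorial : ℝ) * (of fun j k => ∫ x, f j x * f k x * u x ∂ν).det := by
  have h1 : ∀ x : Fin N → ℝ, (∏ l, u (x l)) * (of fun i j => f j (x i)).det ^ 2
      = ∑ σ : Equiv.Perm (Fin N), ∑ τ : Equiv.Perm (Fin N),
        ((σ.sign : ℤ) : ℝ) * ((τ.sign : ℤ) : ℝ)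
          * ∏ i, (f (σ i) (x i) * f (τ i) (x i) * u (x i)) := fun x => by
    rw [← det_transpose, det_apply', sq, Finset.sum_mul_sum, Finset.mul_sum]
    refine Finset.sum_congr rfl fun σ _ => ?_
    rw [Finset.mul_sum]
    refine Finset.sum_congr rfl fun τ _ => ?_
    simp only [transpose_apply, of_apply, Finset.prod_mul_distrib]
    ring
  have h2 : ∀ σ τ : Equiv.Perm (Fin N), Integrable (fun x : Fin N → ℝ =>
      ((σ.sign : ℤ) : ℝ) * ((τ.sign : ℤ) : ℝ)
          * ∏ i, (f (σ i) (x i) * f (τ i) (x i) * u (x i))) (Measure.pi fun _ => ν) :=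
    fun σ τ => (Integrable.fintype_prod (f := fun i y => f (σ i) y * f (τ i) y * u y)
      fun i => hint (σ i) (τ i)).const_mul _
  simp only [h1]
  rw [integral_finsetSum _ fun σ _ => integrable_finsetSum _ fun τ _ => h2 σ τ]
  have h3 : ∀ σ : Equiv.Perm (Fin N), ∫ x : Fin N → ℝ, ∑ τ : Equiv.Perm (Fin N),
      ((σ.sign : ℤ) : ℝ) * ((τ.sign : ℤ) : ℝ)
          * ∏ i, (f (σ i) (x i) * f (τ i) (x i) * u (x i)) ∂(Measure.pi fun _ => ν)
      = (of fun j k => ∫ x, f j x * f k x * u x ∂ν).det := fun σ => by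
    rw [integral_finsetSum _ fun τ _ => h2 σ τ, ← det_transpose, det_apply']
    refine Fintype.sum_equiv (Equiv.mulRight σ⁻¹) _ _ fun τ => ?_
    rw [integral_const_mul,
      integral_fintype_prod_eq_prod (f := fun i y => f (σ i) y * f (τ i) y * u y)]
    simp only [Equiv.coe_mulRight, transpose_apply, of_apply, Equiv.Perm.sign_mul,
      Equiv.Perm.sign_inv, Units.val_mul, Int.cast_mul]
    rw [mul_comm (((τ.sign : ℤ)) : ℝ)]
    congr 1
    refine Fintype.prod_equiv σ _ _ fun i => ?_
    simp
  simp only [h3, Finset.sum_const, Finset.card_univ, Fintype.card_perm, Fintype.card_fin,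
    nsmul_eq_mul]

lemma norm_circlePoint_sub (L x y : ℝ) :
    ‖circlePoint L y - circlePoint L x‖ = 2 * |Real.sin (Real.pi * (y - x) / L)| := by
  have h : circlePoint L y - circlePoint L x = Complex.exp (Complex.I * (2 * Real.pi * x / L : ℝ))
      * (Complex.exp (Complex.I * (2 * (Real.pi * (y - x) / L) : ℝ)) - 1) := by
    rw [mul_sub, ← Complex.exp_add, circlePoint, circlePoint]
    congr 2
    · push_cast; ring
    · push_cast; ring_nf
  rw [h, norm_mul, mul_comm Complex.I, Complex.norm_exp_ofReal_mul_I, one_mul,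
    Complex.norm_exp_I_mul_ofReal_sub_one, mul_div_cancel_left₀ _ two_ne_zero, norm_mul]
  simp

lemma norm_one_sub_circlePoint (L x : ℝ) :
    ‖1 - circlePoint L x‖ = 2 * |Real.sin (Real.pi * x / L)| := by
  have h := norm_circlePoint_sub L 0 x
  rw [sub_zero, norm_sub_rev] at h
  rw [← h]
  simp [circlePoint]

open Matrix in
/-- The density of the circular Jacobi ensemble in terms of a projective Vandermonde
determinant. -/
lemma circularJacobiDensity_eq (a L : ℝ) (N : ℕ) : ∃ c : ℝ, 0 < c ∧ ∀ x : Fin N → ℝ,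
    circularJacobiDensity a L N x = c * ((∏ l, |Real.sin (Real.pi * x l / L)| ^ (2 * a))
      * (of fun i j : Fin N => Real.cos (Real.pi * x i / L) ^ (j : ℕ)
        * Real.sin (Real.pi * x i / L) ^ (j.rev : ℕ)).det ^ 2) := by
  refine ⟨(∏ _l : Fin N, (2 : ℝ) ^ (2 * a)) * ∏ j : Fin N, ∏ _k ∈ Finset.Ioi j, (4 : ℝ),
    by positivity, fun x => ?_⟩
  have h1 : (of fun i j : Fin N => Real.cos (Real.pi * x i / L) ^ (j : ℕ)
        * Real.sin (Real.pi * x i / L) ^ (j.rev : ℕ))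
      = projVandermonde (fun i => Real.cos (Real.pi * x i / L))
        (fun i => Real.sin (Real.pi * x i / L)) := by
    ext i j
    rw [projVandermonde_apply]
    rfl
  rw [h1, det_projVandermonde, ← Finset.prod_pow, circularJacobiDensity]
  simp only [← Finset.prod_pow, norm_circlePoint_sub, norm_one_sub_circlePoint]
  have h2 : ∀ l, (2 * |Real.sin (Real.pi * x l / L)|) ^ (2 * a)
      = 2 ^ (2 * a) * |Real.sin (Real.pi * x l / L)| ^ (2 * a) := fun l =>
    Real.mul_rpow (by norm_num) (abs_nonneg _)
  have h3 : ∀ j k, (2 * |Real.sin (Real.pi * (x k - x j) / L)|) ^ 2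
      = 4 * (Real.cos (Real.pi * x k / L) * Real.sin (Real.pi * x j / L)
        - Real.cos (Real.pi * x j / L) * Real.sin (Real.pi * x k / L)) ^ 2 := fun j k => by
    rw [mul_pow, sq_abs, show Real.pi * (x k - x j) / L = Real.pi * x k / L - Real.pi * x j / L by
      ring, Real.sin_sub]
    ring
  simp only [h2, h3, Finset.prod_mul_distrib]
  ring

/-- The inverse of `x ↦ cot (π x / L)`. -/
def stereo (L l : ℝ) : ℝ := L / Real.pi * (Real.pi / 2 - Real.arctan l)

lemma hasDerivAt_stereo (L l : ℝ) :
    HasDerivAt (stereo L) (-(L / Real.pi / (1 + l ^ 2))) l := by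
  refine (((Real.hasDerivAt_arctan l).const_sub (Real.pi / 2)).const_mul (L / Real.pi)).congr_deriv
    ?_
  ring

lemma stereo_injective {L : ℝ} (hL : 0 < L) : Function.Injective (stereo L) := by
  intro x y h
  have h0 : L / Real.pi ≠ 0 := (div_pos hL Real.pi_pos).ne'
  have := mul_left_cancel₀ h0 h
  exact Real.arctan_injective (by linarith)

lemma stereo_cot {L x : ℝ} (hx : 0 < x) (hxL : x < L) :
    stereo L (Real.cot (Real.pi * x / L)) = x := by
  have hL : 0 < L := hx.trans hxL
  have h1 : 0 < Real.pi * x / L := by positivity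
  have h2 : Real.pi * x / L < Real.pi := by
    rw [div_lt_iff₀ hL]
    exact mul_lt_mul_of_pos_left hxL Real.pi_pos
  rw [stereo, ← Real.tan_inv_eq_cot, ← Real.tan_pi_div_two_sub,
    Real.arctan_tan (by linarith) (by linarith)]
  field_simp
  ring

lemma mem_Ioo_stereo {L : ℝ} (hL : 0 < L) (l : ℝ) : stereo L l ∈ Ioo 0 L := by
  have h1 := Real.arctan_lt_pi_div_two l
  have h2 := Real.neg_pi_div_two_lt_arctan l
  have hp : 0 < L / Real.pi := div_pos hL Real.pi_pos
  refine ⟨mul_pos hp (by linarith), ?_⟩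
  calc stereo L l < L / Real.pi * Real.pi := mul_lt_mul_of_pos_left (by linarith) hp
    _ = L := by field_simp

lemma cot_anti {L x y : ℝ} (hx : 0 < x) (hxy : x < y) (hy : y < L) :
    Real.cot (Real.pi * y / L) < Real.cot (Real.pi * x / L) := by
  have hp : 0 < L / Real.pi := div_pos (hx.trans (hxy.trans hy)) Real.pi_pos
  have h1 := stereo_cot hx (hxy.trans hy)
  have h2 := stereo_cot (hx.trans hxy) hy
  have h3 : Real.arctan (Real.cot (Real.pi * y / L)) < Real.arctan (Real.cot (Real.pi * x / L)) := by
    rw [stereo] at h1 h2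
    by_contra h
    have := mul_le_mul_of_nonneg_left (not_lt.1 h) hp.le
    nlinarith
  exact Real.arctan_lt_arctan_iff.1 h3

lemma image_stereo_Iio {L x : ℝ} (hx : 0 < x) (hxL : x < L) :
    stereo L '' Iio (Real.cot (Real.pi * x / L)) = Ioo x L := by
  have hL := hx.trans hxL
  ext y
  constructor
  · rintro ⟨l, hl, rfl⟩
    refine ⟨?_, (mem_Ioo_stereo hL l).2⟩
    have hp : 0 < L / Real.pi := div_pos hL Real.pi_pos
    rw [← stereo_cot hx hxL]
    refine mul_lt_mul_of_pos_left ?_ hp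
    have := Real.arctan_strictMono hl
    linarith
  · rintro ⟨h1, h2⟩
    exact ⟨Real.cot (Real.pi * y / L), cot_anti hx h1 h2, stereo_cot (hx.trans h1) h2⟩

lemma image_stereo_univ {L : ℝ} (hL : 0 < L) : stereo L '' univ = Ioo 0 L := by
  ext y
  constructor
  · rintro ⟨l, -, rfl⟩
    exact mem_Ioo_stereo hL l
  · rintro ⟨h1, h2⟩
    exact ⟨Real.cot (Real.pi * y / L), mem_univ _, stereo_cot h1 h2⟩

/-- The product of two columns of the projective Vandermonde matrix and the singular factor. -/
def circleMonomial (a L : ℝ) (N : ℕ) (j k : Fin N) (x : ℝ) : ℝ :=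
  (Real.cos (Real.pi * x / L) ^ (j : ℕ) * Real.sin (Real.pi * x / L) ^ (j.rev : ℕ))
    * (Real.cos (Real.pi * x / L) ^ (k : ℕ) * Real.sin (Real.pi * x / L) ^ (k.rev : ℕ))
    * |Real.sin (Real.pi * x / L)| ^ (2 * a)

lemma continuous_circleMonomial {a : ℝ} (ha : 0 ≤ a) (L : ℝ) (N : ℕ) (j k : Fin N) :
    Continuous (circleMonomial a L N j k) := by
  unfold circleMonomial
  have h : Continuous fun x : ℝ => |Real.sin (Real.pi * x / L)| ^ (2 * a) :=
    Continuous.rpow_const (by fun_prop) fun x => Or.inr (by linarith)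
  fun_prop

/-- The half angle substitution takes the singular factor, the Vandermonde factors and the Jacobian
together to the Cauchy weight. -/
lemma circleMonomial_stereo (a : ℝ) {L : ℝ} (hL : 0 < L) (N : ℕ) (j k : Fin N) (l : ℝ) :
    |(-(L / Real.pi / (1 + l ^ 2)))| * circleMonomial a L N j k (stereo L l)
      = L / Real.pi * (l ^ ((j : ℕ) + k) * cauchyWeight a N l) := by
  have h0 : (0 : ℝ) < 1 + l ^ 2 := by positivity
  have hp := Real.pi_pos
  set r := Real.sqrt (1 + l ^ 2) with hr
  have hr0 : 0 < r := Real.sqrt_pos.2 h0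
  have hr2 : r ^ 2 = 1 + l ^ 2 := Real.sq_sqrt h0.le
  have h1 : Real.pi * stereo L l / L = Real.pi / 2 - Real.arctan l := by
    rw [stereo]; field_simp
  have h2 : |(-(L / Real.pi / (1 + l ^ 2)))| = L / Real.pi / (1 + l ^ 2) := by
    rw [abs_neg, abs_of_pos (by positivity)]
  have h3 : (1 / r) ^ (2 * a) = (1 + l ^ 2) ^ (-a) := by
    rw [one_div, Real.inv_rpow hr0.le, hr, Real.sqrt_eq_rpow, ← Real.rpow_mul h0.le,
      ← Real.rpow_neg h0.le]
    congr 1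
    ring
  have h4 : cauchyWeight a N l = ((1 + l ^ 2) ^ N)⁻¹ * (1 + l ^ 2) ^ (-a) := by
    rw [cauchyWeight, sub_eq_add_neg, Real.rpow_add h0, Real.rpow_neg h0.le, Real.rpow_natCast]
  rw [circleMonomial, h1, Real.cos_pi_div_two_sub, Real.sin_pi_div_two_sub, Real.cos_arctan,
    Real.sin_arctan, ← hr, abs_of_pos (by positivity : 0 < 1 / r), h3, h4, h2, ← hr2]
  have hj : (j.rev : ℕ) + j + 1 = N := by have := Fin.val_rev j; omega
  have hk : (k.rev : ℕ) + k + 1 = N := by have := Fin.val_rev k; omega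
  have h5 : (r ^ 2) ^ N = r ^ (j : ℕ) * r ^ (j.rev : ℕ) * (r ^ (k : ℕ) * r ^ (k.rev : ℕ)) * r ^ 2 := by
    rw [← pow_add, ← pow_add, ← pow_add, ← pow_add, ← pow_mul]
    congr 1
    omega
  rw [h5, div_pow, div_pow, div_pow, div_pow, one_pow, one_pow, pow_add]
  field_simp

lemma setIntegral_circleMonomial {a L : ℝ} (hL : 0 < L) {N : ℕ} (j k : Fin N) {I : Set ℝ}
    (hI : MeasurableSet I) : ∫ x in stereo L '' I, circleMonomial a L N j k x
      = L / Real.pi * ∫ l in I, l ^ ((j : ℕ) + k) * cauchyWeight a N l := by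
  rw [integral_image_eq_integral_abs_deriv_smul hI
    (fun l _ => (hasDerivAt_stereo L l).hasDerivWithinAt) (stereo_injective hL).injOn,
    ← integral_const_mul]
  simp only [smul_eq_mul, circleMonomial_stereo a hL]

open Matrix in
/-- The probability, up to normalisation, that all points lie in the image of `I` is the Hankel
determinant of the Cauchy weight on `I`. -/
lemma setIntegral_circularJacobiDensity {a L : ℝ} (ha : 0 ≤ a) (hL : 0 < L) {N : ℕ} {c : ℝ}
    (hc : ∀ x : Fin N → ℝ,
    circularJacobiDensity a L N x = c * ((∏ l, |Real.sin (Real.pi * x l / L)| ^ (2 * a))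
      * (of fun i j : Fin N => Real.cos (Real.pi * x i / L) ^ (j : ℕ)
        * Real.sin (Real.pi * x i / L) ^ (j.rev : ℕ)).det ^ 2))
    {S I : Set ℝ} (hI : MeasurableSet I) (hS : S =ᵐ[volume] stereo L '' I) (hSL : S ⊆ Icc 0 L) :
    ∫ y in {y : Fin N → ℝ | ∀ l, y l ∈ S}, circularJacobiDensity a L N y
      = c * ((N.factorial : ℝ) * ((L / Real.pi) ^ N
        * (Hankel.mat (fun p => ∫ l in I, l ^ p * cauchyWeight a N l) N).det)) := by
  have hset : {y : Fin N → ℝ | ∀ l, y l ∈ S} = univ.pi fun _ => S := by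
    ext y; simp
  simp only [hc, integral_const_mul]
  rw [hset, volume_pi, Measure.restrict_pi_pi,
    integral_prod_mul_det_sq (volume.restrict S)
      (fun j x => Real.cos (Real.pi * x / L) ^ (j : ℕ) * Real.sin (Real.pi * x / L) ^ (j.rev : ℕ))
      (fun x => |Real.sin (Real.pi * x / L)| ^ (2 * a)) fun j k =>
        ((continuous_circleMonomial ha L N j k).continuousOn.integrableOn_Icc).mono_set hSL]
  congr 2
  have : (of fun j k : Fin N => ∫ x in S,
      (Real.cos (Real.pi * x / L) ^ (j : ℕ) * Real.sin (Real.pi * x / L) ^ (j.rev : ℕ))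
      * (Real.cos (Real.pi * x / L) ^ (k : ℕ) * Real.sin (Real.pi * x / L) ^ (k.rev : ℕ))
      * |Real.sin (Real.pi * x / L)| ^ (2 * a))
      = (L / Real.pi) • Hankel.mat (fun p => ∫ l in I, l ^ p * cauchyWeight a N l) N := by
    ext j k
    rw [Matrix.smul_apply, of_apply, Measure.restrict_congr_set hS, Hankel.mat, of_apply,
      smul_eq_mul, ← setIntegral_circleMonomial hL j k hI]
    rfl
  rw [this, det_smul, Fintype.card_fin]

namespace CauchyEnsemble

/-- The gap probability as a function of the end point on the real line. -/
def gapDet (a : ℝ) (N : ℕ) (s : ℝ) : ℝ := (hankel a N s).det / (hankelTotal a N).det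

end CauchyEnsemble

open CauchyEnsemble

/-- The gap probability on the circle is the probability that no eigenvalue of the Cauchy ensemble
exceeds `cot (π x / L)`. -/
lemma circularJacobiGap_eq_gapDet {a L x : ℝ} (ha : 0 ≤ a) (N : ℕ) (hx : 0 < x) (hxL : x < L) :
    circularJacobiGap a L N x = gapDet a N (Real.cot (Real.pi * x / L)) := by
  have hL := hx.trans hxL
  obtain ⟨c, hc0, hc⟩ := circularJacobiDensity_eq a L N
  have hnull : ∀ᵐ y : ℝ, y ∉ ({0, x} : Set ℝ) :=
    compl_mem_ae_iff.2 ((Set.toFinite {0, x}).measure_zero volume)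
  have h1 := setIntegral_circularJacobiDensity ha hL hc (S := {y | y ∈ Ico 0 L ∧ y ∉ Ioo 0 x})
    (I := Iio (Real.cot (Real.pi * x / L))) measurableSet_Iio (by
      rw [image_stereo_Iio hx hxL]
      filter_upwards [hnull] with y hy
      simp only [mem_insert_iff, mem_singleton_iff, not_or] at hy
      refine propext ⟨fun h => ⟨?_, h.1.2⟩, fun h => ⟨⟨hx.le.trans (le_of_lt h.1), h.2⟩,
        fun h' => absurd h'.2 (not_lt.2 (le_of_lt h.1))⟩⟩
      by_contra hlt
      exact h.2 ⟨lt_of_le_of_ne h.1.1 (Ne.symm hy.1), lt_of_le_of_ne (not_lt.1 hlt) hy.2⟩)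
    fun y hy => ⟨hy.1.1, hy.1.2.le⟩
  have h2 := setIntegral_circularJacobiDensity ha hL hc (S := Ico 0 L)
    (I := univ) MeasurableSet.univ (by
      rw [image_stereo_univ hL]
      exact Ioo_ae_eq_Ico.symm)
    fun y hy => ⟨hy.1, hy.2.le⟩
  have h3 : (Hankel.mat (fun p => ∫ l in Iio (Real.cot (Real.pi * x / L)),
      l ^ p * cauchyWeight a N l) N) = hankel a N (Real.cot (Real.pi * x / L)) := by
    simp only [hankel, cauchyMoment, integral_Iic_eq_integral_Iio]
  simp only [setIntegral_univ] at h2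
  have hf : (0 : ℝ) < N.factorial := by exact_mod_cast N.factorial_pos
  have hLp : 0 < (L / Real.pi) ^ N := pow_pos (div_pos hL Real.pi_pos) N
  simp only [mem_ofPred_eq] at h1
  rw [circularJacobiGap, h1, h2, h3, mul_div_mul_left _ _ hc0.ne', mul_div_mul_left _ _ hf.ne',
    mul_div_mul_left _ _ hLp.ne']
  rfl

namespace CauchyEnsemble
variable {a : ℝ} {N : ℕ}

lemma gapDet_pos (ha : 0 ≤ a) (s : ℝ) : 0 < gapDet a N s :=
  div_pos (posDef_hankel ha s).det_pos (posDef_hankelTotal ha).det_pos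

lemma hasDerivAt_gapDet (ha : 0 ≤ a) (s : ℝ) :
    HasDerivAt (gapDet a N) (gapDet a N s * (cauchyWeight a N s * diag a N s)) s := by
  refine ((hasDerivAt_det_rankOne (hasDerivAt_hankel ha s)
    (det_hankel_ne_zero ha s)).div_const _).congr_deriv ?_
  rw [gapDet, diag, invForm]
  ring

open Matrix in
lemma diag_nonneg (ha : 0 ≤ a) (s : ℝ) : 0 ≤ diag a N s := by
  have hs : ∀ v : Fin N → ℝ, star v = v := fun v => by ext i; simp
  have := (posDef_hankel (N := N) ha s).inv.posSemidef.dotProduct_mulVec_nonneg (Hankel.mono N s)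
  rwa [hs] at this

lemma monotone_gapDet (ha : 0 ≤ a) : Monotone (gapDet a N) :=
  monotone_of_hasDerivAt_nonneg (fun s => hasDerivAt_gapDet ha s) fun s =>
    mul_nonneg (gapDet_pos ha s).le (mul_nonneg (cauchyWeight_pos a N s).le (diag_nonneg ha s))

end CauchyEnsemble

/-! ### Pseudo-Jacobi polynomials and the inverse of the complete Hankel matrix -/

/-- The coefficients `b_l` of the monic polynomial `∑ b_l X^(d-l)` that solves the pseudo-Jacobi
equation `(1 + X²) π'' + (2 - 2α) X π' = d (d + 1 - 2α) π` with `β = 2α - 2d`. -/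
def pjCoeff (d : ℕ) (β : ℝ) : ℕ → ℝ
  | 0 => 1
  | 1 => 0
  | l + 2 => -(((d : ℝ) - l) * (d - l - 1)) / ((l + 2) * (β + l + 1)) * pjCoeff d β l

lemma pjCoeff_add_two (d : ℕ) (β : ℝ) (l : ℕ) : pjCoeff d β (l + 2)
    = -(((d : ℝ) - l) * (d - l - 1)) / ((l + 2) * (β + l + 1)) * pjCoeff d β l := by
  rw [pjCoeff]

lemma pjCoeff_eq_zero {d : ℕ} (β : ℝ) {l : ℕ} (h : d < l) : pjCoeff d β l = 0 := by
  induction l using Nat.strong_induction_on with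
  | _ l ih =>
    rcases l with _ | _ | l
    · omega
    · rfl
    · rw [pjCoeff_add_two]
      rcases (by omega : d < l ∨ d = l ∨ d = l + 1) with h | rfl | rfl
      · rw [ih l (by omega) h, mul_zero]
      · simp
      · simp

lemma pjCoeff_rel (d : ℕ) {β : ℝ} (hβ : 0 ≤ β) (l : ℕ) :
    (l + 2) * (β + l + 1) * pjCoeff d β (l + 2) = -(((d : ℝ) - l) * (d - l - 1)) * pjCoeff d β l := by
  have h1 : ((l : ℝ) + 2) ≠ 0 := by positivity
  have h2 : (β + l + 1) ≠ 0 := by positivity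
  rw [pjCoeff_add_two]
  field_simp

lemma abs_pjCoeff_le {d : ℕ} {β : ℝ} (hβ : 0 ≤ β) (l : ℕ) :
    |pjCoeff d β l| ≤ (d : ℝ) ^ l / l.factorial := by
  induction l using Nat.strong_induction_on with
  | _ l ih =>
    by_cases hdl : d < l
    · rw [pjCoeff_eq_zero β hdl, abs_zero]
      positivity
    rcases l with _ | _ | l
    · simp [pjCoeff]
    · simp [pjCoeff]
    · have h1 : ((l : ℝ) + 2) ≤ d := by exact_mod_cast not_lt.1 hdl
      have h2 : |-(((d : ℝ) - l) * (d - l - 1)) / ((l + 2) * (β + l + 1))|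
          ≤ (d : ℝ) ^ 2 / ((l + 2) * (l + 1)) := by
        rw [abs_div, abs_neg, abs_of_nonneg (by apply mul_nonneg <;> linarith),
          abs_of_pos (by positivity)]
        have hl : (0 : ℝ) ≤ l := by positivity
        gcongr
        · nlinarith
        · linarith
      rw [pjCoeff_add_two, abs_mul]
      refine (mul_le_mul h2 (ih l (by omega)) (abs_nonneg _) (by positivity)).trans_eq ?_
      rw [Nat.factorial_succ, Nat.factorial_succ]
      push_cast
      field_simp
      ring

lemma pjCoeff_succ (d : ℕ) (β : ℝ) (l : ℕ) :
    ((d : ℝ) + 1 - l) * pjCoeff (d + 1) β l = (d + 1) * pjCoeff d β l := by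
  induction l using Nat.strong_induction_on with
  | _ l ih =>
    rcases l with _ | _ | l
    · simp [pjCoeff]
    · simp [pjCoeff]
    · have h := ih l (by omega)
      rw [pjCoeff_add_two, pjCoeff_add_two]
      push_cast
      linear_combination -((d - l) * (d - l - 1)) / ((l + 2) * (β + l + 1)) * h

/-- The moment of `π X^m`, where `π` is the polynomial with coefficients `pjCoeff d β`. -/
def pjMoment (μ : ℕ → ℝ) (d : ℕ) (β : ℝ) (m : ℕ) : ℝ :=
  ∑ l ∈ Finset.range (d + 1), pjCoeff d β l * μ (d - l + m)

/-- A moment sequence with the Pearson recurrence of a weight `(1 + x²)^{-α}` on the whole line,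
up to index `2n`. -/
def TotalRec (μ : ℕ → ℝ) (α : ℝ) (n : ℕ) : Prop :=
  ∀ k : ℕ, k + 1 ≤ 2 * n → k * μ (k - 1) + (k + 2 - 2 * α) * μ (k + 1) = 0

section Orthogonality
variable {μ : ℕ → ℝ} {α : ℝ} {n : ℕ}

/-- The differential equation of the pseudo-Jacobi polynomial, integrated against `X^m`. -/
lemma sum_pjCoeff_ode (d m : ℕ) {β : ℝ} (hβ : 0 ≤ β) :
    ∑ l ∈ Finset.range (d + 1), pjCoeff d β l * (l * (β + l - 1) * μ (d - l + m)
      + ((d : ℝ) - l) * (d - l - 1) * μ (d - l + m - 2)) = 0 := by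
  simp only [mul_add, Finset.sum_add_distrib]
  rcases d with _ | _ | d
  · simp
  · simp [Finset.sum_range_succ, pjCoeff]
  · rw [Finset.sum_range_succ', Finset.sum_range_succ']
    rw [Finset.sum_range_succ (fun l => pjCoeff (d + 2) β l * (((d + 1 + 1 : ℕ) - (l : ℝ))
      * ((d + 1 + 1 : ℕ) - l - 1) * μ (d + 1 + 1 - l + m - 2))),
      Finset.sum_range_succ (fun l => pjCoeff (d + 2) β l * (((d + 1 + 1 : ℕ) - (l : ℝ))
      * ((d + 1 + 1 : ℕ) - l - 1) * μ (d + 1 + 1 - l + m - 2)))]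
    have h : ∀ l ∈ Finset.range (d + 1), pjCoeff (d + 2) β (l + 2) * (((l + 1 + 1 : ℕ) : ℝ)
        * (β + ((l + 1 + 1 : ℕ) : ℝ) - 1) * μ (d + 1 + 1 - (l + 1 + 1) + m))
        = -(pjCoeff (d + 2) β l * (((d + 1 + 1 : ℕ) - (l : ℝ))
      * ((d + 1 + 1 : ℕ) - l - 1) * μ (d + 1 + 1 - l + m - 2))) := fun l hl => by
      have hl' := Finset.mem_range.1 hl
      have := pjCoeff_rel (d + 2) hβ l
      rw [show d + 1 + 1 - l + m - 2 = d - l + m by omega,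
        show d + 1 + 1 - (l + 1 + 1) + m = d - l + m by omega]
      push_cast at *
      linear_combination μ (d - l + m) * this
    have h1 : pjCoeff (d + 2) β (0 + 1) = 0 := rfl
    rw [Finset.sum_congr rfl h, Finset.sum_neg_distrib, h1]
    push_cast
    ring

/-- The self-adjoint form of the pseudo-Jacobi equation: the moments of the polynomial against powers
satisfy a two term recurrence. -/
lemma pjMoment_rec (hμ : TotalRec μ α n) {d m : ℕ} (hβ : 0 ≤ 2 * α - 2 * d) (h : d + m ≤ 2 * n) :
    ((d : ℝ) - m) * (d + m + 1 - 2 * α) * pjMoment μ d (2 * α - 2 * d) m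
      = m * (m - 1) * pjMoment μ d (2 * α - 2 * d) (m - 2) := by
  have h1 := sum_pjCoeff_ode (μ := μ) d m hβ
  rw [pjMoment, pjMoment, Finset.mul_sum, Finset.mul_sum, ← sub_eq_zero, ← Finset.sum_sub_distrib,
    ← neg_eq_zero, ← h1, ← Finset.sum_neg_distrib]
  refine Finset.sum_congr rfl fun l hl => ?_
  have hl' : l ≤ d := by have := Finset.mem_range.1 hl; omega
  obtain ⟨j, rfl⟩ := Nat.exists_eq_add_of_le hl'
  rw [Nat.add_sub_cancel_left]
  have h2 : (m : ℝ) * (m - 1) * μ (j + (m - 2)) = m * (m - 1) * μ (j + m - 2) := by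
    rcases m with _ | _ | m
    · simp
    · simp
    · rw [show j + (m + 1 + 1) - 2 = j + (m + 1 + 1 - 2) by omega]
  have h3 : ((j : ℝ) - m) * ((j + m + 1 - 2 * α) * μ (j + m) + (j + m - 1) * μ (j + m - 2)) = 0 := by
    rcases hjm : j + m with _ | k
    · obtain ⟨rfl, rfl⟩ : j = 0 ∧ m = 0 := by omega
      simp
    · have := hμ k (by omega)
      have hk : (j : ℝ) + m = k + 1 := by exact_mod_cast hjm
      rw [hk, show k + 1 - 2 = k - 1 by omega]
      linear_combination (j - m : ℝ) * this
  push_cast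
  linear_combination pjCoeff (l + j) (2 * α - 2 * ((l : ℝ) + j)) l * (h2 - h3)

/-- Orthogonality of the pseudo-Jacobi polynomial to lower powers. -/
lemma pjMoment_eq_zero (hμ : TotalRec μ α n) {d m : ℕ} (hβ : 0 ≤ 2 * α - 2 * d)
    (h : d + m ≤ 2 * n) (hmd : m < d) (hα : (d : ℝ) + m + 1 < 2 * α) :
    pjMoment μ d (2 * α - 2 * d) m = 0 := by
  induction m using Nat.strong_induction_on with
  | _ m ih =>
    have h1 := pjMoment_rec hμ hβ h
    have h2 : (m : ℝ) * (m - 1) * pjMoment μ d (2 * α - 2 * d) (m - 2) = 0 := by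
      rcases m with _ | _ | m
      · simp
      · simp
      · have : ((m : ℕ) : ℝ) ≤ (m + 2 : ℕ) := by exact_mod_cast (by omega)
        rw [show m + 1 + 1 - 2 = m by omega, ih m (by omega) (by omega) (by omega)
          (by push_cast at *; linarith), mul_zero]
    rw [h2] at h1
    have h3 : (m : ℝ) < d := by exact_mod_cast hmd
    have h4 : ((d : ℝ) - m) * (d + m + 1 - 2 * α) ≠ 0 :=
      mul_ne_zero (by linarith) (by linarith)
    exact (mul_eq_zero.1 h1).resolve_left h4

end Orthogonality

/-- The coefficients of the Christoffel–Darboux kernel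
`(η' F(η) G(η') - η G(η) F(η')) / (η' - η)` of two power series with coefficients `f` and `g`. -/
def cdCoeff (f g : ℕ → ℝ) (j l : ℕ) : ℝ :=
  ∑ i ∈ Finset.range (j + 1), f i * g (j + l - i) - ∑ i ∈ Finset.range j, g i * f (j + l - i)

section CD
variable {f g : ℕ → ℝ} {n : ℕ}

/-- Multiplication of the Christoffel–Darboux kernel by the difference of the variables leaves the two
products of the polynomials. -/
lemma cdCoeff_succ (j l : ℕ) :
    cdCoeff f g (j + 1) l = cdCoeff f g j (l + 1) + f (j + 1) * g l - g j * f (l + 1) := by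
  rw [cdCoeff, cdCoeff, show j + 1 + l = j + (l + 1) by ring,
    Finset.sum_range_succ (fun i => f i * g (j + (l + 1) - i)) (j + 1),
    Finset.sum_range_succ (fun i => g i * f (j + (l + 1) - i)) j,
    show j + (l + 1) - (j + 1) = l by omega, show j + (l + 1) - j = l + 1 by omega]
  ring

lemma cdCoeff_zero_left (hf : f 0 = 1) (l : ℕ) : cdCoeff f g 0 l = g l := by
  simp [cdCoeff, hf]

lemma cdCoeff_zero_right (hf : f 0 = 1) (j : ℕ) : cdCoeff f g j 0 = g j := by
  have h : ∑ i ∈ Finset.range (j + 1), f i * g (j - i)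
      = ∑ i ∈ Finset.range (j + 1), g i * f (j - i) := by
    rw [← Finset.sum_flip]
    refine Finset.sum_congr rfl fun i hi => ?_
    have := Finset.mem_range.1 hi
    rw [show j - (j - i) = i by omega, mul_comm]
  rw [cdCoeff, add_zero, h, Finset.sum_range_succ, Nat.sub_self, hf]
  ring

lemma cdCoeff_eq_zero_right (hf : ∀ l, n + 1 < l → f l = 0) (hg : ∀ l, n < l → g l = 0)
    {j l : ℕ} (hl : n < l) : cdCoeff f g j l = 0 := by
  rw [cdCoeff, Finset.sum_eq_zero, Finset.sum_eq_zero, sub_zero]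
  · intro i hi
    have := Finset.mem_range.1 hi
    rw [hf _ (by omega), mul_zero]
  · intro i hi
    have := Finset.mem_range.1 hi
    rw [hg _ (by omega), mul_zero]

lemma cdCoeff_eq_zero_left (hf : ∀ l, n + 1 < l → f l = 0) (hg : ∀ l, n < l → g l = 0)
    (l : ℕ) : cdCoeff f g (n + 1) l = 0 := by
  have h1 : ∑ i ∈ Finset.range (n + 1 + 1), f i * g (n + 1 + l - i)
      = ∑ i ∈ Finset.range (n + 1 + l + 1), f i * g (n + 1 + l - i) := by
    refine Finset.sum_subset (Finset.range_mono (by omega)) fun i _ hi => ?_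
    rw [hf i (by simpa using hi), zero_mul]
  have h2 : ∑ i ∈ Finset.range (n + 1), g i * f (n + 1 + l - i)
      = ∑ i ∈ Finset.range (n + 1 + l + 1), g i * f (n + 1 + l - i) := by
    refine Finset.sum_subset (Finset.range_mono (by omega)) fun i _ hi => ?_
    rw [hg i (by simpa using hi), zero_mul]
  rw [cdCoeff, h1, h2, sub_eq_zero, ← Finset.sum_flip]
  refine Finset.sum_congr rfl fun i hi => ?_
  have := Finset.mem_range.1 hi
  rw [show n + 1 + l - (n + 1 + l - i) = i by omega, mul_comm]

/-- The Christoffel–Darboux kernel paired with the monomial of degree `m`. -/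
def cdPairing (f g μ : ℕ → ℝ) (n j m : ℕ) : ℝ :=
  ∑ l ∈ Finset.range (n + 1), cdCoeff f g j l * μ (n - l + m)

/-- The kernel paired with a monomial depends only on the sum of the two indices, as long as the
polynomials are orthogonal to that monomial. -/
lemma cdPairing_succ {μ : ℕ → ℝ} (hf0 : f 0 = 1) (hf : ∀ l, n + 1 < l → f l = 0)
    (hg : ∀ l, n < l → g l = 0) {m : ℕ}
    (hOf : ∑ l ∈ Finset.range (n + 1 + 1), f l * μ (n + 1 - l + m) = 0)
    (hOg : ∑ l ∈ Finset.range (n + 1), g l * μ (n - l + m) = 0) (j : ℕ) :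
    cdPairing f g μ n (j + 1) m = cdPairing f g μ n j (m + 1) := by
  have h1 : cdPairing f g μ n (j + 1) m
      = ∑ l ∈ Finset.range (n + 1), cdCoeff f g j (l + 1) * μ (n - l + m)
        + f (j + 1) * ∑ l ∈ Finset.range (n + 1), g l * μ (n - l + m)
        - g j * ∑ l ∈ Finset.range (n + 1), f (l + 1) * μ (n - l + m) := by
    rw [cdPairing, Finset.mul_sum, Finset.mul_sum, ← Finset.sum_add_distrib,
      ← Finset.sum_sub_distrib]
    refine Finset.sum_congr rfl fun l _ => ?_
    rw [cdCoeff_succ]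
    ring
  have h2 : ∑ l ∈ Finset.range (n + 1), f (l + 1) * μ (n - l + m) = -μ (n + 1 + m) := by
    rw [Finset.sum_range_succ'] at hOf
    simp only [Nat.add_sub_add_right, hf0, Nat.sub_zero, one_mul] at hOf
    linarith
  have h3 : cdPairing f g μ n j (m + 1)
      = ∑ l ∈ Finset.range (n + 1), cdCoeff f g j (l + 1) * μ (n - l + m)
        + g j * μ (n + 1 + m) := by
    have h4 : cdPairing f g μ n j (m + 1)
        = ∑ l ∈ Finset.range (n + 1 + 1), cdCoeff f g j l * μ (n + 1 - l + m) := by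
      rw [Finset.sum_range_succ _ (n + 1), cdCoeff_eq_zero_right hf hg (Nat.lt_succ_self n),
        zero_mul, add_zero, cdPairing]
      refine Finset.sum_congr rfl fun l hl => ?_
      have := Finset.mem_range.1 hl
      rw [show n - l + (m + 1) = n + 1 - l + m by omega]
    rw [h4, Finset.sum_range_succ', cdCoeff_zero_right hf0]
    simp only [Nat.add_sub_add_right, Nat.sub_zero]
  rw [h1, h2, h3, hOg]
  ring

/-- The Christoffel–Darboux kernel is reproducing: its coefficients in decreasing powers invert
the Hankel matrix up to the norm of the last polynomial. -/
lemma cdPairing_eq {μ : ℕ → ℝ} (hf0 : f 0 = 1) (hf : ∀ l, n + 1 < l → f l = 0)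
    (hg : ∀ l, n < l → g l = 0)
    (hOf : ∀ m < n, ∑ l ∈ Finset.range (n + 1 + 1), f l * μ (n + 1 - l + m) = 0)
    (hOg : ∀ m < n, ∑ l ∈ Finset.range (n + 1), g l * μ (n - l + m) = 0) {j m : ℕ}
    (hj : j ≤ n) (hm : m ≤ n) :
    cdPairing f g μ n j m = if j + m = n then
      ∑ l ∈ Finset.range (n + 1), g l * μ (n - l + n) else 0 := by
  have hstep : ∀ j m, m < n → cdPairing f g μ n (j + 1) m = cdPairing f g μ n j (m + 1) :=
    fun j m hm => cdPairing_succ hf0 hf hg (hOf m hm) (hOg m hm) j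
  have h0 : ∀ m, cdPairing f g μ n 0 m = ∑ l ∈ Finset.range (n + 1), g l * μ (n - l + m) :=
    fun m => by simp only [cdPairing, cdCoeff_zero_left hf0]
  have hN : ∀ m, cdPairing f g μ n (n + 1) m = 0 := fun m => by
    simp only [cdPairing, cdCoeff_eq_zero_left hf hg, zero_mul, Finset.sum_const_zero]
  have hdown : ∀ j m, j + m ≤ n → cdPairing f g μ n j m = cdPairing f g μ n 0 (j + m) := by
    intro j
    induction j with
    | zero => intro m _; rw [zero_add]
    | succ j ih =>
      intro m h
      rw [hstep j m (by omega), ih (m + 1) (by omega), show j + (m + 1) = j + 1 + m by ring]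
  have hup : ∀ k j m, j + k = n + 1 → k ≤ m → m ≤ n → cdPairing f g μ n j m = 0 := by
    intro k
    induction k with
    | zero => intro j m h _ _; obtain rfl : j = n + 1 := by omega
              exact hN m
    | succ k ih =>
      intro j m h hkm hmn
      obtain ⟨m, rfl⟩ : ∃ m', m = m' + 1 := ⟨m - 1, by omega⟩
      rw [← hstep j m (by omega)]
      exact ih (j + 1) m (by omega) (by omega) (by omega)
  split_ifs with h
  · rw [hdown j m h.le, h, h0]
  · rcases lt_or_gt_of_ne h with h | h
    · rw [hdown j m h.le, h0, hOg _ h]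
    · exact hup (n + 1 - j) j m (by omega) (by omega) hm

end CD

namespace CauchyEnsemble
variable {a : ℝ} {N n : ℕ}

lemma totalRec_cauchyTotal (ha : 0 ≤ a) (n : ℕ) :
    TotalRec (cauchyTotal a (n + 1)) (n + 1 + a) n := by
  intro k hk
  have h : ((k + 1 : ℕ) : ℝ) ≤ (2 * n : ℕ) := by exact_mod_cast hk
  push_cast at h
  have := cauchyTotal_rec (a := a) (N := n + 1) (k := k) (by push_cast; linarith)
  push_cast at this
  exact this

/-- The squared norm of the monic orthogonal polynomial of degree `n` for `N = n + 1`. -/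
def topNorm (a : ℝ) (n : ℕ) : ℝ := pjMoment (cauchyTotal a (n + 1)) n (2 * a + 2) n

lemma pjMoment_cauchyTotal_eq_zero (ha : 0 ≤ a) {m : ℕ} (hm : m < n) :
    pjMoment (cauchyTotal a (n + 1)) n (2 * a + 2) m = 0 := by
  have hm' : (m : ℝ) < n := by exact_mod_cast hm
  have := pjMoment_eq_zero (totalRec_cauchyTotal ha n) (d := n) (m := m)
    (by linarith) (by omega) hm (by linarith)
  rwa [show 2 * ((n : ℝ) + 1 + a) - 2 * n = 2 * a + 2 by ring] at this

lemma pjMoment_cauchyTotal_succ_eq_zero (ha : 0 ≤ a) {m : ℕ} (hm : m < n) :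
    pjMoment (cauchyTotal a (n + 1)) (n + 1) (2 * a) m = 0 := by
  have hm' : (m : ℝ) < n := by exact_mod_cast hm
  have := pjMoment_eq_zero (totalRec_cauchyTotal ha n) (d := n + 1) (m := m)
    (by push_cast; linarith) (by omega) (by omega)
    (by push_cast; have : (m : ℝ) + 1 ≤ n := by exact_mod_cast hm
        linarith)
  rwa [show 2 * ((n : ℝ) + 1 + a) - 2 * (n + 1 : ℕ) = 2 * a by push_cast; ring] at this

/-- The coefficients of the correlation kernel in decreasing powers, up to `topNorm`. -/
def kerCoeff (a : ℝ) (n : ℕ) : ℕ → ℕ → ℝ :=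
  cdCoeff (pjCoeff (n + 1) (2 * a)) (pjCoeff n (2 * a + 2))

open Matrix Hankel in
/-- The inverse of the complete Hankel matrix, explicitly. -/
lemma kerCoeff_mul_hankelTotal (ha : 0 ≤ a) :
    (of fun i j : Fin (n + 1) => kerCoeff a n i.rev j.rev) * hankelTotal a (n + 1)
      = topNorm a n • (1 : Matrix (Fin (n + 1)) (Fin (n + 1)) ℝ) := by
  ext i k
  have h := cdPairing_eq (f := pjCoeff (n + 1) (2 * a)) (g := pjCoeff n (2 * a + 2))
    (μ := cauchyTotal a (n + 1)) rfl (fun l hl => pjCoeff_eq_zero _ hl)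
    (fun l hl => pjCoeff_eq_zero _ hl)
    (fun m hm => pjMoment_cauchyTotal_succ_eq_zero ha hm)
    (fun m hm => pjMoment_cauchyTotal_eq_zero ha hm)
    (j := i.rev) (m := k) (by omega) (by omega)
  rw [mul_apply, ← Equiv.sum_comp Fin.revPerm]
  simp only [Fin.revPerm_apply, Fin.rev_rev, of_apply, hankelTotal, mat]
  rw [cdPairing, Finset.sum_range] at h
  simp only [Fin.val_rev, Nat.add_sub_add_right] at h ⊢
  refine Eq.trans ?_ (h.trans ?_)
  · rfl
  · rw [Matrix.smul_apply, one_apply, smul_eq_mul]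
    by_cases hik : i = k
    · subst hik
      rw [if_pos (by omega), if_pos rfl, mul_one]
      rfl
    · rw [if_neg (fun h' => hik (Fin.ext (by omega))), if_neg hik, mul_zero]

/-- Lowering `N` by one multiplies the weight by `1 + x²`. -/
lemma cauchyTotal_eq_add (ha : 0 ≤ a) {k : ℕ} (hk : k ≤ 2 * n) :
    cauchyTotal a (n + 1) k = cauchyTotal a (n + 2) k + cauchyTotal a (n + 2) (k + 2) := by
  have hk' : (k : ℝ) ≤ (2 * n : ℕ) := by exact_mod_cast hk
  push_cast at hk'
  rw [cauchyTotal, cauchyTotal, cauchyTotal, ← integral_add]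
  · congr 1
    funext x
    have h0 : (0 : ℝ) < 1 + x ^ 2 := by positivity
    have : cauchyWeight a (n + 1) x = (1 + x ^ 2) * cauchyWeight a (n + 2) x := by
      rw [cauchyWeight, cauchyWeight, ← Real.rpow_one_add' h0.le]
      · congr 1; push_cast; ring
      · push_cast; linarith
    rw [this]
    ring
  · exact integrable_pow_mul_cauchyWeight (by push_cast; linarith)
  · exact integrable_pow_mul_cauchyWeight (by push_cast; linarith)

/-- The recurrence of the norms in `N`, from the fact that the derivative of a pseudo-Jacobi
polynomial is again one, for the weight with one more factor `1 + x²`. -/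
lemma topNorm_succ (ha : 0 ≤ a) (n : ℕ) :
    (n + 2 + 2 * a) * topNorm a (n + 1) = (n + 1) * topNorm a n := by
  have hrec := totalRec_cauchyTotal ha (n + 1)
  set μ := cauchyTotal a (n + 1 + 1) with hμ
  have h0 : (n : ℝ) * ∑ l ∈ Finset.range (n + 1 + 1),
      pjCoeff (n + 1) (2 * a + 2) l * μ (n + 1 - l + n - 1) = 0 := by
    rcases n with _ | n
    · simp
    · have := pjMoment_cauchyTotal_eq_zero ha (n := n + 1 + 1) (m := n) (by omega)
      rw [pjMoment, ← hμ] at this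
      simp only [← Nat.add_assoc, Nat.add_sub_cancel]
      rw [this, mul_zero]
  have h1 : (n + 1) * topNorm a n = ∑ l ∈ Finset.range (n + 1 + 1),
      pjCoeff (n + 1) (2 * a + 2) l * (((n : ℝ) + 1 - l) * (μ (n + 1 - l + n - 1)
        + μ (n + 1 - l + (n + 1)))) := by
    rw [Finset.sum_range_succ, topNorm, pjMoment, Finset.mul_sum]
    push_cast
    rw [sub_self, zero_mul, mul_zero, add_zero]
    refine Finset.sum_congr rfl fun l hl => ?_
    have hl' := Finset.mem_range.1 hl
    rw [cauchyTotal_eq_add ha (by omega), show n - l + n + 2 = n + 1 - l + (n + 1) by omega,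
      show n - l + n = n + 1 - l + n - 1 by omega]
    linear_combination -(μ (n + 1 - l + n - 1) + μ (n + 1 - l + (n + 1)))
      * pjCoeff_succ n (2 * a + 2) l
  rw [h1, topNorm, pjMoment, ← hμ, Finset.mul_sum, ← sub_eq_zero, ← h0, Finset.mul_sum,
    ← Finset.sum_sub_distrib]
  refine Finset.sum_congr rfl fun l hl => ?_
  have hl' := Finset.mem_range.1 hl
  have h2 := hrec (n + 1 - l + n) (by omega)
  rw [Nat.cast_add, Nat.cast_sub (by omega)] at h2
  push_cast at h2
  rw [show n + 1 - l + (n + 1) = n + 1 - l + n + 1 by omega]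
  linear_combination -pjCoeff (n + 1) (2 * a + 2) l * h2

lemma topNorm_zero : topNorm a 0 = ∫ x : ℝ, cauchyWeight a 1 x := by
  simp [topNorm, pjMoment, pjCoeff, cauchyTotal]

lemma topNorm_zero_pos (ha : 0 ≤ a) : 0 < topNorm a 0 := by
  rw [topNorm_zero]
  have h := integrable_pow_mul_cauchyWeight (a := a) (N := 1) (k := 0) (by push_cast; linarith)
  simp only [pow_zero, one_mul] at h
  exact integral_pos_of_integrable_nonneg_nonzero (x := 0) (continuous_cauchyWeight _ _) h
    (fun x => (cauchyWeight_pos _ _ _).le) (cauchyWeight_pos _ _ _).ne'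

lemma topNorm_pos (ha : 0 ≤ a) : 0 < topNorm a n := by
  induction n with
  | zero => exact topNorm_zero_pos ha
  | succ n ih =>
    have h := topNorm_succ ha n
    have : 0 < ((n : ℝ) + 2 + 2 * a) * topNorm a (n + 1) := by rw [h]; positivity
    exact pos_of_mul_pos_right this (by positivity)

end CauchyEnsemble

/-! ### The norm of the last polynomial for large `N` -/

namespace CauchyEnsemble
variable {a : ℝ} {N n : ℕ}

/-- The total mass for `N = 1`: write the power as a Gamma integral and exchange the integrations. -/
lemma integral_one_add_sq_rpow (ha : 0 ≤ a) :
    Real.Gamma (a + 1) * ∫ x : ℝ, (1 + x ^ 2) ^ (-1 - a) = √Real.pi * Real.Gamma (a + 1 / 2) := by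
  set f : ℝ → ℝ → ℝ := fun x t => t ^ a * Real.exp (-((1 + x ^ 2) * t)) with hf
  have hx : ∀ x : ℝ, ∫ t in Ioi 0, f x t = Real.Gamma (a + 1) * (1 + x ^ 2) ^ (-1 - a) := fun x => by
    have h := Real.integral_rpow_mul_exp_neg_mul_Ioi (a := a + 1) (r := 1 + x ^ 2)
      (by linarith) (by positivity)
    rw [add_sub_cancel_right] at h
    rw [hf, h, one_div, Real.inv_rpow (by positivity), ← Real.rpow_neg (by positivity), mul_comm,
      neg_add']
    congr 2
    ring
  have ht : ∀ t ∈ Ioi (0 : ℝ), ∫ x, f x t = √Real.pi * (t ^ (a + 1 / 2 - 1) * Real.exp (-(1 * t))) := by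
    intro t ht
    have ht' : (0 : ℝ) < t := ht
    have : ∀ x, f x t = t ^ a * Real.exp (-(1 * t)) * Real.exp (-t * x ^ 2) := fun x => by
      rw [hf, mul_assoc, ← Real.exp_add]
      ring_nf
    simp_rw [this]
    rw [integral_const_mul, integral_gaussian, Real.sqrt_div Real.pi_pos.le, Real.sqrt_eq_rpow t,
      show a + 1 / 2 - 1 = a - 1 / 2 by ring, Real.rpow_sub ht']
    ring
  have hcont : AEStronglyMeasurable (Function.uncurry f)
      ((volume : Measure ℝ).prod (volume.restrict (Ioi 0))) := by
    apply Continuous.aestronglyMeasurable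
    simp only [hf, Function.uncurry_def]
    exact ((Real.continuous_rpow_const ha).comp continuous_snd).mul (by fun_prop)
  have hnonneg : ∀ x t, t ∈ Ioi (0 : ℝ) → ‖f x t‖ = f x t := fun x t ht => by
    have ht' : (0 : ℝ) < t := ht
    exact Real.norm_of_nonneg (by simp only [hf]; positivity)
  have hint : Integrable (Function.uncurry f) ((volume : Measure ℝ).prod (volume.restrict (Ioi 0))) := by
    rw [integrable_prod_iff hcont]
    constructor
    · refine ae_of_all _ fun x => ?_
      by_contra h
      have h1 := hx x
      rw [integral_undef (by simpa using h)] at h1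
      have : 0 < Real.Gamma (a + 1) * (1 + x ^ 2) ^ (-1 - a) :=
        mul_pos (Real.Gamma_pos_of_pos (by linarith)) (Real.rpow_pos_of_pos (by positivity) _)
      linarith
    · have : ∀ x : ℝ, ∫ t in Ioi 0, ‖f x t‖ = Real.Gamma (a + 1) * (1 + x ^ 2) ^ (-1 - a) :=
        fun x => by rw [← hx x]; exact setIntegral_congr_fun measurableSet_Ioi (hnonneg x)
      simp only [Function.uncurry_apply_pair, this]
      have h := integrable_pow_mul_cauchyWeight (a := a) (N := 1) (k := 0)
        (by push_cast; linarith)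
      simpa [cauchyWeight] using h.const_mul (Real.Gamma (a + 1))
  have h := integral_integral_swap hint
  simp_rw [hx] at h
  rw [integral_const_mul] at h
  rw [h, setIntegral_congr_fun measurableSet_Ioi ht, integral_const_mul,
    Real.integral_rpow_mul_exp_neg_mul_Ioi (by linarith) one_pos]
  simp

/-- The constant `2^{-2a-1} / (Γ(a + 1/2) Γ(a + 3/2))`. -/
def kappaLim (a : ℝ) : ℝ := (1 / 2) ^ (2 * a + 1) / (Real.Gamma (a + 1 / 2) * Real.Gamma (a + 3 / 2))

/-- The normalisation `N^{-1-2a} / topNorm a (N - 1)` for `N = n + 1`. -/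
def kappa (a : ℝ) (n : ℕ) : ℝ := ((n : ℝ) + 1) ^ (-(2 * a + 1)) / topNorm a n

lemma kappa_pos (ha : 0 ≤ a) (n : ℕ) : 0 < kappa a n :=
  div_pos (Real.rpow_pos_of_pos (by positivity) _) (topNorm_pos ha)

lemma kappaLim_pos (ha : 0 ≤ a) : 0 < kappaLim a :=
  div_pos (by positivity) (mul_pos (Real.Gamma_pos_of_pos (by linarith))
    (Real.Gamma_pos_of_pos (by linarith)))

/-- Legendre's duplication formula brings the total mass for `N = 1` into the form of `kappaLim`. -/
lemma topNorm_zero_mul_Gamma (ha : 0 ≤ a) :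
    topNorm a 0 * Real.Gamma (2 * a + 2) = (kappaLim a)⁻¹ := by
  have h1 := integral_one_add_sq_rpow ha
  have h2 := Real.Gamma_mul_Gamma_add_half_of_pos (s := a + 1) (by linarith)
  have h3 : topNorm a 0 = ∫ x : ℝ, (1 + x ^ 2) ^ (-1 - a) := by
    rw [topNorm_zero]; simp [cauchyWeight]
  rw [← h3] at h1
  have hG : 0 < Real.Gamma (a + 1) := Real.Gamma_pos_of_pos (by linarith)
  have hπ : 0 < √Real.pi := Real.sqrt_pos.2 Real.pi_pos
  have h2' : Real.Gamma (a + 1) * Real.Gamma (a + 3 / 2) * 2 ^ (2 * a + 1)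
      = Real.Gamma (2 * a + 2) * √Real.pi := by
    rw [show a + 1 + 1 / 2 = a + 3 / 2 by ring, show 2 * (a + 1) = 2 * a + 2 by ring,
      show 1 - (2 * a + 2) = -(2 * a + 1) by ring, Real.rpow_neg (by norm_num)] at h2
    rw [h2]
    field_simp
  have h4 : ((1 : ℝ) / 2) ^ (2 * a + 1) = (2 ^ (2 * a + 1))⁻¹ := by
    rw [one_div, Real.inv_rpow (by norm_num)]
  rw [kappaLim, inv_div, h4, div_inv_eq_mul]
  generalize Real.Gamma (a + 1 / 2) = G at h1 ⊢
  apply mul_left_cancel₀ (mul_pos hG hπ).ne'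
  linear_combination √Real.pi * Real.Gamma (2 * a + 2) * h1
    - √Real.pi * G * h2'

/-- The recurrence `topNorm_succ` solved in terms of Euler's sequence for `Γ(2a + 1)`. -/
lemma gammaSeq_eq (ha : 0 ≤ a) (n : ℕ) : Real.GammaSeq (2 * a + 1) n * ((2 * a + 1) * topNorm a 0)
    = (n : ℝ) ^ (2 * a + 1) * topNorm a n := by
  have h : ∀ n : ℕ, (n.factorial : ℝ) * ((2 * a + 1) * topNorm a 0)
      = topNorm a n * ∏ j ∈ Finset.range (n + 1), (2 * a + 1 + j) := fun n => by
    induction n with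
    | zero => simp; ring
    | succ n ih =>
      rw [Finset.prod_range_succ, Nat.factorial_succ]
      push_cast
      linear_combination (n + 1 : ℝ) * ih - (∏ j ∈ Finset.range (n + 1), (2 * a + 1 + (j : ℝ)))
        * topNorm_succ ha n
  have hpos : 0 < ∏ j ∈ Finset.range (n + 1), (2 * a + 1 + (j : ℝ)) :=
    Finset.prod_pos fun j _ => by positivity
  rw [Real.GammaSeq, div_mul_eq_mul_div, div_eq_iff hpos.ne']
  linear_combination (n : ℝ) ^ (2 * a + 1) * h n

lemma tendsto_kappa (ha : 0 ≤ a) : Tendsto (kappa a) atTop (𝓝 (kappaLim a)) := by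
  have h0 := topNorm_zero_pos ha
  have h1 : Tendsto (fun n : ℕ => (n : ℝ) ^ (2 * a + 1) * topNorm a n) atTop
      (𝓝 (kappaLim a)⁻¹) := by
    have := (Real.GammaSeq_tendsto_Gamma (2 * a + 1)).mul_const ((2 * a + 1) * topNorm a 0)
    simp_rw [gammaSeq_eq ha] at this
    convert this using 2
    rw [← topNorm_zero_mul_Gamma ha, show 2 * a + 2 = 2 * a + 1 + 1 by ring,
      Real.Gamma_add_one (by linarith)]
    ring
  have h2 : Tendsto (fun n : ℕ => ((n : ℝ) / (n + 1)) ^ (2 * a + 1)) atTop (𝓝 1) := by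
    have := (tendsto_natCast_div_add_atTop (1 : ℝ)).rpow_const (p := 2 * a + 1)
      (Or.inl one_ne_zero)
    simpa using this
  have h3 := h2.div h1 (inv_ne_zero (kappaLim_pos ha).ne')
  rw [one_div, inv_inv] at h3
  refine h3.congr' ?_
  filter_upwards [eventually_gt_atTop 0] with n hn
  have hn' : (0 : ℝ) < n := by exact_mod_cast hn
  have hp : 0 < (n : ℝ) ^ (2 * a + 1) := Real.rpow_pos_of_pos hn' _
  have ht : 0 < topNorm a n := topNorm_pos ha
  simp only [Pi.div_apply]
  rw [Real.div_rpow hn'.le (by positivity), kappa, Real.rpow_neg (by positivity)]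
  field_simp

end CauchyEnsemble

/-! ### Determinants of growing size -/

/-- The determinant of the `n × n` section of `1 - X`. -/
def sectionDet (X : ℕ → ℕ → ℂ) (n : ℕ) : ℂ :=
  (1 - Matrix.of fun i j : Fin n => X i j).det

/-- The increment of the section determinants. -/
def sectionStep (X : ℕ → ℕ → ℂ) (n : ℕ) : ℂ := sectionDet X (n + 1) - sectionDet X n

/-- The limit of the section determinants. -/
def limitDet (X : ℕ → ℕ → ℂ) : ℂ := 1 + ∑' n, sectionStep X n

/-- A determinant is at most the product of the `ℓ¹` norms of the rows: expanding that product gives a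
sum over all maps, of which the permutations are a part. -/
lemma norm_det_le_prod_sum {n : ℕ} (A : Matrix (Fin n) (Fin n) ℂ) :
    ‖A.det‖ ≤ ∏ i, ∑ j, ‖A i j‖ := by
  rw [← Matrix.det_transpose, Matrix.det_apply, Finset.prod_univ_sum, Fintype.piFinset_univ]
  refine (norm_sum_le _ _).trans ?_
  have h : ∀ σ : Equiv.Perm (Fin n), ‖Equiv.Perm.sign σ • ∏ i, A.transpose (σ i) i‖
      = ∏ i, ‖A i ((⇑σ : Fin n → Fin n) i)‖ := fun σ => by
    rcases Int.units_eq_one_or (Equiv.Perm.sign σ) with h | h <;>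
      simp [h, norm_prod, Matrix.transpose_apply]
  rw [Finset.sum_congr rfl fun σ _ => h σ]
  refine (Finset.sum_image (s := Finset.univ) (g := fun σ : Equiv.Perm (Fin n) => (⇑σ : Fin n → Fin n))
    (f := fun g => ∏ i, ‖A i (g i)‖) fun σ _ τ _ h => DFunLike.coe_injective h).symm.trans_le ?_
  exact Finset.sum_le_sum_of_subset_of_nonneg (Finset.subset_univ _)
    fun g _ _ => Finset.prod_nonneg fun _ _ => norm_nonneg _

lemma sectionDet_zero (X : ℕ → ℕ → ℂ) : sectionDet X 0 = 1 := by simp [sectionDet]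

lemma sectionStep_zero (X : ℕ → ℕ → ℂ) : sectionStep X 0 = -X 0 0 := by
  simp [sectionStep, sectionDet]

lemma sectionDet_eq_sum (X : ℕ → ℕ → ℂ) (n : ℕ) :
    sectionDet X n = 1 + ∑ j ∈ Finset.range n, sectionStep X j := by
  have := Finset.sum_range_sub (sectionDet X) n
  simp only [sectionStep]
  rw [this, sectionDet_zero]
  ring

open Matrix in
/-- The increment is the determinant of `1 - X` with the last row replaced by that of `-X`, since the
last row of `1 - X` is the sum of a unit vector and that row. -/
lemma sectionStep_eq (X : ℕ → ℕ → ℂ) (n : ℕ) : sectionStep X n =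
    ((1 - of fun i j : Fin (n + 1) => X i j : Matrix (Fin (n + 1)) (Fin (n + 1)) ℂ).updateRow (Fin.last n) fun j => -X n j).det := by
  set M : Matrix (Fin (n + 1)) (Fin (n + 1)) ℂ := 1 - of fun i j : Fin (n + 1) => X i j with hM
  have h1 : M = M.updateRow (Fin.last n) ((Pi.single (Fin.last n) 1) + fun j : Fin (n + 1) => -X n j) := by
    ext i j
    rw [updateRow_apply]
    split_ifs with h
    · subst h
      simp [hM, one_apply, Pi.single_apply, eq_comm, ← sub_eq_add_neg]
    · rfl
  have h2 : (M.updateRow (Fin.last n) (Pi.single (Fin.last n) 1)).det = sectionDet X n := by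
    rw [det_succ_row _ (Fin.last n), Finset.sum_eq_single (Fin.last n)]
    · simp only [updateRow_self, Pi.single_eq_same, mul_one, ← two_mul, pow_mul]
      simp only [even_two, Even.neg_pow, one_pow, one_mul, Fin.val_last]
      rw [sectionDet]
      congr 1
      ext i j
      simp [hM, one_apply, Fin.succAbove_last, updateRow_apply, Fin.castSucc_ne_last]
    · intro j _ hj
      simp [hj]
    · simp
  have h3 : sectionDet X (n + 1) = M.det := rfl
  rw [sectionStep, h3, h1, det_updateRow_add, h2, ← h1]
  ring

lemma norm_sectionStep_le {X : ℕ → ℕ → ℂ} {x : ℕ → ℝ} {n : ℕ}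
    (hX : ∀ j ≤ n, ∑ k ∈ Finset.range (n + 1), ‖X j k‖ ≤ x j) :
    ‖sectionStep X n‖ ≤ x n * Real.exp (∑ j ∈ Finset.range n, x j) := by
  rw [sectionStep_eq]
  refine (norm_det_le_prod_sum _).trans ?_
  have hx : ∀ j ≤ n, 0 ≤ x j := fun j hj =>
    (Finset.sum_nonneg fun _ _ => norm_nonneg _).trans (hX j hj)
  rw [Fin.prod_univ_castSucc, mul_comm, Real.exp_sum, Finset.prod_range (fun j => Real.exp (x j))]
  simp only [Matrix.updateRow_self, norm_neg]
  refine mul_le_mul ?_ (Finset.prod_le_prod (fun _ _ => Finset.sum_nonneg fun _ _ => norm_nonneg _)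
    fun i _ => ?_) (Finset.prod_nonneg fun _ _ => Finset.sum_nonneg fun _ _ => norm_nonneg _)
    (hx n le_rfl)
  · rw [← Finset.sum_range (fun k => ‖X n k‖)]
    exact hX n le_rfl
  · have hi : (i : ℕ) ≤ n := i.2.le
    calc _ ≤ ∑ j : Fin (n + 1), (‖(1 : Matrix (Fin (n + 1)) (Fin (n + 1)) ℂ) i.castSucc j‖
          + ‖X i j‖) := by
          refine Finset.sum_le_sum fun j _ => ?_
          rw [Matrix.updateRow_ne (Fin.castSucc_ne_last i)]
          exact norm_sub_le _ _
      _ = 1 + ∑ k ∈ Finset.range (n + 1), ‖X i k‖ := by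
          rw [Finset.sum_add_distrib, ← Finset.sum_range (fun k => ‖X i k‖)]
          congr 1
          rw [Finset.sum_eq_single i.castSucc]
          · simp
          · intro j _ hj
            simp [hj.symm]
          · simp
      _ ≤ 1 + x i := by gcongr; exact hX i hi
      _ ≤ Real.exp (x i) := by rw [add_comm]; exact Real.add_one_le_exp _

/-- Rows dominated by a summable sequence, in the form in which the truncated matrices give it. -/
lemma norm_sectionStep_le_tsum {X : ℕ → ℕ → ℂ} {x : ℕ → ℝ} (hs : Summable x) (h0 : ∀ j, 0 ≤ x j)
    (hX : ∀ j m, ∑ k ∈ Finset.range m, ‖X j k‖ ≤ x j) (n : ℕ) :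
    ‖sectionStep X n‖ ≤ x n * Real.exp (∑' j, x j) := by
  refine (norm_sectionStep_le fun j _ => hX j _).trans ?_
  gcongr
  · exact h0 n
  · exact hs.sum_le_tsum _ fun j _ => h0 j

/-- Convergence of determinants of growing size with uniformly dominated rows. -/
lemma tendsto_sectionDet {ι : Type*} {l : Filter ι} {X : ι → ℕ → ℕ → ℂ} {Y : ℕ → ℕ → ℂ}
    {x : ℕ → ℝ} {n : ι → ℕ} (hs : Summable x) (h0 : ∀ j, 0 ≤ x j) (hn : Tendsto n l atTop)
    (hX : ∀ᶠ i in l, ∀ j m, ∑ k ∈ Finset.range m, ‖X i j k‖ ≤ x j)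
    (hlim : ∀ j k, Tendsto (fun i => X i j k) l (𝓝 (Y j k))) :
    Tendsto (fun i => sectionDet (X i) (n i)) l (𝓝 (limitDet Y)) := by
  have hdet : ∀ m, Tendsto (fun i => sectionDet (X i) m) l (𝓝 (sectionDet Y m)) := fun m => by
    simp only [sectionDet]
    refine (continuous_id.matrix_det.tendsto _).comp ?_
    refine tendsto_const_nhds.sub ?_
    exact tendsto_pi_nhds.2 fun j => tendsto_pi_nhds.2 fun k => hlim j k
  have h1 : ∀ i, sectionDet (X i) (n i)
      = 1 + ∑' j, (if j < n i then sectionStep (X i) j else 0) := fun i => by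
    rw [sectionDet_eq_sum, tsum_eq_sum (s := Finset.range (n i))]
    · congr 1
      exact Finset.sum_congr rfl fun j hj => by rw [if_pos (Finset.mem_range.1 hj)]
    · intro j hj
      rw [if_neg (by simpa using hj)]
  simp_rw [h1, limitDet]
  refine tendsto_const_nhds.add (tendsto_tsum_of_dominated_convergence
    (bound := fun j => x j * Real.exp (∑' j, x j)) (hs.mul_right _) (fun j => ?_) ?_)
  · refine ((hdet (j + 1)).sub (hdet j)).congr' ?_
    filter_upwards [hn.eventually_gt_atTop j] with i hi
    rw [if_pos hi, sectionStep]
  · filter_upwards [hX] with i hi j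
    split_ifs
    · exact norm_sectionStep_le_tsum hs h0 hi j
    · rw [norm_zero]
      exact mul_nonneg (h0 j) (Real.exp_nonneg _)

/-- The limit determinant is `1 - X 0 0` up to the rows after the first. -/
lemma norm_limitDet_sub_le {X : ℕ → ℕ → ℂ} {x : ℕ → ℝ} (hs : Summable x) (h0 : ∀ j, 0 ≤ x j)
    (hX : ∀ j m, ∑ k ∈ Finset.range m, ‖X j k‖ ≤ x j) :
    ‖limitDet X - 1 + X 0 0‖ ≤ (∑' j, x (j + 1)) * Real.exp (∑' j, x j) := by
  have hb := norm_sectionStep_le_tsum hs h0 hX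
  have hsum : Summable (sectionStep X) := Summable.of_norm_bounded (hs.mul_right _) hb
  have h1 : limitDet X - 1 + X 0 0 = ∑' j, sectionStep X (j + 1) := by
    rw [limitDet, hsum.tsum_eq_zero_add, sectionStep_zero]
    ring
  rw [h1, ← tsum_mul_right]
  exact tsum_of_norm_bounded (((summable_nat_add_iff 1).2 hs).mul_right _).hasSum
    fun j => hb (j + 1)

/-! ### Scaled coefficients and the scaled matrix -/

/-- The coefficients of the hypergeometric series `₀F₁` of even order, the scaling limit of
`pjCoeff`. -/
def besselCoeff (β : ℝ) : ℕ → ℝ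
  | 0 => 1
  | 1 => 0
  | l + 2 => -1 / ((l + 2) * (β + l + 1)) * besselCoeff β l

lemma tendsto_pjCoeff_div_pow {ι : Type*} {L : Filter ι} {d : ι → ℕ} {M : ι → ℝ} {β : ℝ}
    (hM : Tendsto M L atTop) (hd : Tendsto (fun i => (d i : ℝ) / M i) L (𝓝 1)) (l : ℕ) :
    Tendsto (fun i => pjCoeff (d i) β l / M i ^ l) L (𝓝 (besselCoeff β l)) := by
  induction l using Nat.strong_induction_on with
  | _ l ih =>
    rcases l with _ | _ | l
    · simpa [pjCoeff, besselCoeff] using tendsto_const_nhds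
    · simpa [pjCoeff, besselCoeff] using tendsto_const_nhds
    · have h0 : ∀ c : ℝ, Tendsto (fun i => c / M i) L (𝓝 0) := fun c => hM.const_div_atTop c
      have h1 : Tendsto (fun i => -((d i / M i - l / M i) * (d i / M i - (l + 1) / M i))
          / ((l + 2) * (β + l + 1)) * (pjCoeff (d i) β l / M i ^ l)) L
          (𝓝 (-((1 - 0) * (1 - 0)) / ((l + 2) * (β + l + 1)) * besselCoeff β l)) :=
        ((((hd.sub (h0 _)).mul (hd.sub (h0 _))).neg).div_const _).mul (ih l (by omega))
      rw [besselCoeff]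
      rw [show (-((1 - 0) * (1 - 0)) : ℝ) = -1 by norm_num] at h1
      refine h1.congr' ?_
      filter_upwards [hM.eventually_gt_atTop 0] with i hi
      rw [pjCoeff_add_two, pow_add, ← sub_div, ← sub_div, ← sub_sub]
      field_simp
      ring

lemma cdCoeff_div_pow (f g : ℕ → ℝ) (M : ℝ) (j l : ℕ) :
    cdCoeff (fun l => f l / M ^ l) (fun l => g l / M ^ l) j l = cdCoeff f g j l / M ^ (j + l) := by
  rw [cdCoeff, cdCoeff, sub_div, Finset.sum_div, Finset.sum_div]
  congr 1 <;>
  · refine Finset.sum_congr rfl fun i hi => ?_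
    have := Finset.mem_range.1 hi
    rw [div_mul_div_comm, ← pow_add, Nat.add_sub_cancel' (by omega)]

lemma abs_cdCoeff_le {f g : ℕ → ℝ} (hf : ∀ l, |f l| ≤ 1 / l.factorial)
    (hg : ∀ l, |g l| ≤ 1 / l.factorial) (j l : ℕ) :
    |cdCoeff f g j l| ≤ 2 * 2 ^ (j + l) / (j + l).factorial := by
  have key : ∀ {f g : ℕ → ℝ}, (∀ l, |f l| ≤ 1 / l.factorial) → (∀ l, |g l| ≤ 1 / l.factorial) →
      ∀ m ≤ j + l + 1, |∑ i ∈ Finset.range m, f i * g (j + l - i)|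
        ≤ 2 ^ (j + l) / (j + l).factorial := by
    intro f g hf hg m hm
    refine (Finset.abs_sum_le_sum_abs _ _).trans ?_
    calc ∑ i ∈ Finset.range m, |f i * g (j + l - i)|
        ≤ ∑ i ∈ Finset.range (j + l + 1), |f i * g (j + l - i)| :=
          Finset.sum_le_sum_of_subset_of_nonneg (Finset.range_mono hm) fun _ _ _ => abs_nonneg _
      _ ≤ ∑ i ∈ Finset.range (j + l + 1), ((j + l).choose i : ℝ) / (j + l).factorial := by
          refine Finset.sum_le_sum fun i hi => ?_
          have hi' : i ≤ j + l := by have := Finset.mem_range.1 hi; omega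
          rw [abs_mul, Nat.cast_choose ℝ hi']
          refine (mul_le_mul (hf i) (hg _) (abs_nonneg _) (by positivity)).trans_eq ?_
          field_simp
      _ = 2 ^ (j + l) / (j + l).factorial := by
          rw [← Finset.sum_div]
          congr 1
          exact_mod_cast Nat.sum_range_choose (j + l)
  rw [cdCoeff, mul_div_assoc, two_mul]
  refine (abs_sub _ _).trans (add_le_add (key hf hg _ (by omega)) (key hg hf _ (by omega)))

lemma tendsto_cdCoeff {ι : Type*} {L : Filter ι} {f g : ι → ℕ → ℝ} {F G : ℕ → ℝ}
    (hf : ∀ l, Tendsto (fun i => f i l) L (𝓝 (F l))) (hg : ∀ l, Tendsto (fun i => g i l) L (𝓝 (G l)))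
    (j l : ℕ) : Tendsto (fun i => cdCoeff (f i) (g i) j l) L (𝓝 (cdCoeff F G j l)) :=
  (tendsto_finsetSum _ fun i _ => (hf i).mul (hg _)).sub
    (tendsto_finsetSum _ fun i _ => (hg i).mul (hf _))

/-- The entries `κ T^b 2^{j-k} ∑_l c_{jl} T^{j+l} J_{l+k}` of the scaled matrix. The factor
`2^{j-k}` is a conjugation that makes the rows summable. -/
def scaledEntry (b κ : ℝ) (c : ℕ → ℕ → ℝ) (J : ℕ → ℂ) (T : ℂ) (j k : ℕ) : ℂ :=
  κ * T ^ (b : ℂ) * (2 ^ j / 2 ^ k) * ∑' l, c j l * T ^ (j + l) * J (l + k)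

/-- The bound for the sum of the moduli of the entries in a row of the scaled matrix. -/
def rowBound (b C r : ℝ) (j : ℕ) : ℝ :=
  4 * C * r ^ b * Real.exp (2 * r) * ((4 * r) ^ j / j.factorial)

lemma rowBound_nonneg {b C r : ℝ} (hC : 0 ≤ C) (hr : 0 ≤ r) (j : ℕ) : 0 ≤ rowBound b C r j := by
  unfold rowBound; positivity

lemma hasSum_pow_div_factorial (x : ℝ) :
    HasSum (fun l : ℕ => x ^ l / l.factorial) (Real.exp x) := by
  rw [Real.exp_eq_exp_ℝ]
  exact NormedSpace.expSeries_div_hasSum_exp x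

lemma hasSum_rowBound (b C r : ℝ) : HasSum (rowBound b C r)
    (4 * C * r ^ b * Real.exp (2 * r) * Real.exp (4 * r)) :=
  (hasSum_pow_div_factorial (4 * r)).mul_left _

section Entry
variable {b κ B K r : ℝ} {c : ℕ → ℕ → ℝ} {J : ℕ → ℂ} {T : ℂ}

lemma norm_scaledEntry_term_le (hc : ∀ j l, |c j l| ≤ 2 * 2 ^ (j + l) / (j + l).factorial)
    (hJ : ∀ m, ‖J m‖ ≤ B) (hT : ‖T‖ ≤ r) (j k l : ℕ) :
    ‖c j l * T ^ (j + l) * J (l + k)‖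
      ≤ 2 * B * ((2 * r) ^ j / j.factorial) * ((2 * r) ^ l / l.factorial) := by
  have hr : 0 ≤ r := (norm_nonneg T).trans hT
  have hB : 0 ≤ B := (norm_nonneg (J 0)).trans (hJ 0)
  rw [norm_mul, norm_mul, norm_pow, Complex.norm_real, Real.norm_eq_abs]
  have hfac : (j.factorial : ℝ) * l.factorial ≤ (j + l).factorial := by
    exact_mod_cast Nat.le_of_dvd (Nat.factorial_pos _) (Nat.factorial_mul_factorial_dvd_factorial_add j l)
  calc |c j l| * ‖T‖ ^ (j + l) * ‖J (l + k)‖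
      ≤ 2 * 2 ^ (j + l) / (j.factorial * l.factorial) * r ^ (j + l) * B := by
        gcongr
        · exact (hc j l).trans (by gcongr)
        · exact hJ _
    _ = _ := by
        rw [mul_pow, mul_pow, pow_add, pow_add]
        field_simp

lemma sum_norm_scaledEntry_le (hb : 0 ≤ b)
    (hc : ∀ j l, |c j l| ≤ 2 * 2 ^ (j + l) / (j + l).factorial)
    (hJ : ∀ m, ‖J m‖ ≤ B) (hκ : |κ| ≤ K) (hT : ‖T‖ ≤ r) (j m : ℕ) :
    ∑ k ∈ Finset.range m, ‖scaledEntry b κ c J T j k‖ ≤ rowBound b (K * B) r j := by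
  have hr : 0 ≤ r := (norm_nonneg T).trans hT
  have hB : 0 ≤ B := (norm_nonneg (J 0)).trans (hJ 0)
  have hK : 0 ≤ K := (abs_nonneg κ).trans hκ
  have h1 : ∀ k, ‖scaledEntry b κ c J T j k‖ ≤ K * r ^ b * 2 ^ j
      * (2 * B * ((2 * r) ^ j / j.factorial) * Real.exp (2 * r)) * (1 / 2) ^ k := fun k => by
    have h2 : ‖∑' l, c j l * T ^ (j + l) * J (l + k)‖
        ≤ 2 * B * ((2 * r) ^ j / j.factorial) * Real.exp (2 * r) :=
      tsum_of_norm_bounded ((hasSum_pow_div_factorial (2 * r)).mul_left _)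
        (norm_scaledEntry_term_le hc hJ hT j k)
    have h3 : ‖T‖ ^ b ≤ r ^ b := Real.rpow_le_rpow (norm_nonneg _) hT hb
    rw [scaledEntry, norm_mul, norm_mul, norm_mul, Complex.norm_real, Real.norm_eq_abs,
      Complex.norm_cpow_real, norm_div, norm_pow, norm_pow, Complex.norm_two]
    calc |κ| * ‖T‖ ^ b * (2 ^ j / 2 ^ k) * ‖∑' l, c j l * T ^ (j + l) * J (l + k)‖
        ≤ K * r ^ b * (2 ^ j / 2 ^ k) * (2 * B * ((2 * r) ^ j / j.factorial) * Real.exp (2 * r)) := by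
          gcongr
      _ = _ := by rw [one_div, inv_pow]; ring
  refine (Finset.sum_le_sum fun k _ => h1 k).trans ?_
  rw [← Finset.mul_sum]
  refine (mul_le_mul_of_nonneg_left (sum_geometric_two_le m) (by positivity)).trans_eq ?_
  rw [rowBound, show (4 * r) ^ j = 2 ^ j * (2 * r) ^ j by rw [← mul_pow]; ring_nf]
  ring

/-- The entries of the scaled matrix converge when their ingredients do. -/
lemma tendsto_scaledEntry {ι : Type*} {L : Filter ι} {b B : ℝ} {κ : ι → ℝ} {c : ι → ℕ → ℕ → ℝ}
    {J : ι → ℕ → ℂ} {T : ι → ℂ} {κ₀ : ℝ} {c₀ : ℕ → ℕ → ℝ} {J₀ : ℕ → ℂ} {T₀ : ℂ}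
    (hT₀ : 0 < T₀.re) (hc : ∀ i j l, |c i j l| ≤ 2 * 2 ^ (j + l) / (j + l).factorial)
    (hJ : ∀ᶠ i in L, ∀ m, ‖J i m‖ ≤ B)
    (hκ : Tendsto κ L (𝓝 κ₀)) (hc₀ : ∀ j l, Tendsto (fun i => c i j l) L (𝓝 (c₀ j l)))
    (hJ₀ : ∀ m, Tendsto (fun i => J i m) L (𝓝 (J₀ m))) (hT : Tendsto T L (𝓝 T₀)) (j k : ℕ) :
    Tendsto (fun i => scaledEntry b (κ i) (c i) (J i) (T i) j k) L
      (𝓝 (scaledEntry b κ₀ c₀ J₀ T₀ j k)) := by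
  have h1 : Tendsto (fun i => (κ i : ℂ)) L (𝓝 κ₀) :=
    (Complex.continuous_ofReal.tendsto _).comp hκ
  have h2 : Tendsto (fun i => T i ^ (b : ℂ)) L (𝓝 (T₀ ^ (b : ℂ))) :=
    hT.cpow tendsto_const_nhds (Or.inl hT₀)
  refine ((h1.mul h2).mul_const _).mul ?_
  refine tendsto_tsum_of_dominated_convergence
    (bound := fun l => 2 * B * ((2 * (‖T₀‖ + 1)) ^ j / j.factorial)
      * ((2 * (‖T₀‖ + 1)) ^ l / l.factorial))
    ((hasSum_pow_div_factorial _).mul_left _).summable (fun l => ?_) ?_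
  · exact (((Complex.continuous_ofReal.tendsto _).comp (hc₀ j l)).mul (hT.pow _)).mul (hJ₀ _)
  · filter_upwards [hJ, hT.norm.eventually_lt_const (lt_add_one ‖T₀‖)] with i hi hTi l
    exact norm_scaledEntry_term_le (hc i) hi hTi.le j k l

end Entry

namespace CauchyEnsemble
variable {a : ℝ} {N n : ℕ}

/-- The scaled coefficients of the correlation kernel. -/
def scaledCoeff (a : ℝ) (n : ℕ) : ℕ → ℕ → ℝ :=
  cdCoeff (fun l => pjCoeff (n + 1) (2 * a) l / ((n : ℝ) + 1) ^ l)
    (fun l => pjCoeff n (2 * a + 2) l / ((n : ℝ) + 1) ^ l)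

/-- The limits of the scaled coefficients of the correlation kernel. -/
def limitCoeff (a : ℝ) : ℕ → ℕ → ℝ := cdCoeff (besselCoeff (2 * a)) (besselCoeff (2 * a + 2))

lemma scaledCoeff_eq (a : ℝ) (n j l : ℕ) :
    scaledCoeff a n j l = kerCoeff a n j l / ((n : ℝ) + 1) ^ (j + l) := cdCoeff_div_pow _ _ _ _ _

lemma abs_pjCoeff_div_pow_le {d : ℕ} {β : ℝ} (hβ : 0 ≤ β) (hd : d ≤ n + 1) (l : ℕ) :
    |pjCoeff d β l / ((n : ℝ) + 1) ^ l| ≤ 1 / l.factorial := by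
  have h : (d : ℝ) ≤ n + 1 := by exact_mod_cast hd
  rw [abs_div, abs_of_pos (a := ((n : ℝ) + 1) ^ l) (by positivity), div_le_iff₀ (by positivity)]
  refine (abs_pjCoeff_le hβ l).trans ?_
  rw [one_div_mul_eq_div]
  gcongr

lemma abs_scaledCoeff_le (ha : 0 ≤ a) (n j l : ℕ) :
    |scaledCoeff a n j l| ≤ 2 * 2 ^ (j + l) / (j + l).factorial :=
  abs_cdCoeff_le (abs_pjCoeff_div_pow_le (by linarith) le_rfl)
    (abs_pjCoeff_div_pow_le (by linarith) (Nat.le_succ n)) j l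

lemma tendsto_scaledCoeff (a : ℝ) (j l : ℕ) :
    Tendsto (fun n => scaledCoeff a n j l) atTop (𝓝 (limitCoeff a j l)) := by
  have hM : Tendsto (fun n : ℕ => (n : ℝ) + 1) atTop atTop :=
    tendsto_atTop_add_const_right _ _ tendsto_natCast_atTop_atTop
  refine tendsto_cdCoeff (fun l => tendsto_pjCoeff_div_pow hM ?_ l)
    (fun l => tendsto_pjCoeff_div_pow hM ?_ l) j l
  · refine tendsto_const_nhds.congr fun n => ?_
    rw [Nat.cast_add_one, div_self (by positivity)]
  · exact tendsto_natCast_div_add_atTop (1 : ℝ)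

lemma abs_limitCoeff_le (ha : 0 ≤ a) (j l : ℕ) :
    |limitCoeff a j l| ≤ 2 * 2 ^ (j + l) / (j + l).factorial :=
  le_of_tendsto (tendsto_scaledCoeff a j l).abs
    (Eventually.of_forall fun n => abs_scaledCoeff_le ha n j l)

end CauchyEnsemble

/-! ### The scaled moments -/

namespace CauchyEnsemble
variable {a : ℝ} {N n : ℕ}

/-- The factor `(1 + z)^{-N-a}` of the scaled weight, for `N = n + 1`. -/
def scaledWeight (a : ℝ) (n : ℕ) (z : ℂ) : ℂ := (1 + z) ^ (-((n + 1 + a : ℝ) : ℂ))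

/-- The scaled moments `∫₀¹ u^{m+2a} (1 + T²u²/N²)^{-N-a} du`, for `N = n + 1`. -/
def scaledMoment (a : ℝ) (n m : ℕ) (T : ℂ) : ℂ :=
  ∫ u in Ioc (0 : ℝ) 1, ((u ^ ((m : ℝ) + 2 * a) : ℝ) : ℂ) * scaledWeight a n ((T * u / (n + 1)) ^ 2)

lemma one_add_mem_slitPlane {z : ℂ} (hz : ‖z‖ < 1) : 1 + z ∈ Complex.slitPlane :=
  Complex.mem_slitPlane_of_norm_lt_one hz

lemma differentiableOn_scaledWeight (a : ℝ) (n : ℕ) :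
    DifferentiableOn ℂ (scaledWeight a n) (Metric.ball 0 1) := fun z hz => by
  refine DifferentiableAt.differentiableWithinAt ?_
  refine DifferentiableAt.cpow (by fun_prop) (by fun_prop) (one_add_mem_slitPlane ?_)
  simpa using hz

lemma norm_scaledArg_le {T : ℂ} {u : ℝ} (hu : u ∈ Ioc (0 : ℝ) 1) :
    ‖(T * u / (n + 1)) ^ 2‖ ≤ (‖T‖ / (n + 1)) ^ 2 := by
  have h : ‖(n + 1 : ℂ)‖ = n + 1 := by exact_mod_cast Complex.norm_natCast (n + 1)
  rw [norm_pow, norm_div, norm_mul, h, Complex.norm_real, Real.norm_of_nonneg hu.1.le]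
  have h1 := mul_le_of_le_one_right (norm_nonneg T) hu.2
  have h2 : 0 ≤ ‖T‖ * u := mul_nonneg (norm_nonneg T) hu.1.le
  gcongr

lemma norm_scaledArg_lt {T : ℂ} (hT : ‖T‖ < n + 1) {u : ℝ} (hu : u ∈ Ioc (0 : ℝ) 1) :
    ‖(T * u / (n + 1)) ^ 2‖ < 1 := by
  refine (norm_scaledArg_le hu).trans_lt ?_
  rw [sq_lt_one_iff₀ (by positivity), div_lt_one (by positivity)]
  exact hT

lemma norm_scaledWeight_sub_one_le (ha : 0 ≤ a) {z : ℂ} {ε : ℝ} (hz : ‖z‖ ≤ 1 / 2)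
    (hε : (n + 1 + a) * (3 / 2 * ‖z‖) ≤ ε) (hε1 : ε ≤ 1) : ‖scaledWeight a n z - 1‖ ≤ 2 * ε := by
  have h1 : (1 + z) ≠ 0 := Complex.slitPlane_ne_zero (one_add_mem_slitPlane (by linarith))
  have h2 : ‖Complex.log (1 + z) * (-((n + 1 + a : ℝ) : ℂ))‖ ≤ ε := by
    rw [norm_mul, norm_neg, Complex.norm_real, Real.norm_of_nonneg (by positivity), mul_comm]
    refine le_trans ?_ hε
    gcongr
    exact Complex.norm_log_one_add_half_le_self hz
  rw [scaledWeight, Complex.cpow_def_of_ne_zero h1]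
  refine (Complex.norm_exp_sub_one_le (h2.trans hε1)).trans ?_
  linarith

lemma norm_rpow_le_one (ha : 0 ≤ a) (m : ℕ) {u : ℝ} (hu : u ∈ Ioc (0 : ℝ) 1) :
    ‖((u ^ ((m : ℝ) + 2 * a) : ℝ) : ℂ)‖ ≤ 1 := by
  rw [Complex.norm_real, Real.norm_of_nonneg (Real.rpow_nonneg hu.1.le _)]
  exact Real.rpow_le_one hu.1.le hu.2 (by positivity)

lemma continuousOn_scaledIntegrand (ha : 0 ≤ a) (m : ℕ) {T : ℂ} (hT : ‖T‖ < n + 1) :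
    ContinuousOn (fun u : ℝ => ((u ^ ((m : ℝ) + 2 * a) : ℝ) : ℂ)
      * scaledWeight a n ((T * u / (n + 1)) ^ 2)) (Ioc 0 1) := by
  refine ContinuousOn.mul ?_ ?_
  · exact (Complex.continuous_ofReal.comp (Real.continuous_rpow_const (by positivity))).continuousOn
  · refine (differentiableOn_scaledWeight a n).continuousOn.comp (by fun_prop) fun u hu => ?_
    simpa using norm_scaledArg_lt hT hu

lemma integral_rpow_Ioc (ha : 0 ≤ a) (m : ℕ) :
    ∫ u in Ioc (0 : ℝ) 1, ((u ^ ((m : ℝ) + 2 * a) : ℝ) : ℂ) = 1 / (m + 2 * a + 1 : ℂ) := by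
  have hm : (0 : ℝ) ≤ m := by positivity
  rw [integral_complex_ofReal, ← intervalIntegral.integral_of_le zero_le_one,
    integral_rpow (Or.inl (by linarith)), Real.one_rpow, Real.zero_rpow (by linarith)]
  push_cast
  ring

/-- For large `N` the weight factor is uniformly close to `1`, so the scaled moments are close to
`∫₀¹ u^{m+2a} du`, uniformly in `m`. -/
lemma norm_scaledMoment_sub_le (ha : 0 ≤ a) (m : ℕ) {T : ℂ} {ε : ℝ}
    (hT : (‖T‖ / (n + 1)) ^ 2 ≤ 1 / 2)
    (hε : (n + 1 + a) * (3 / 2 * (‖T‖ / (n + 1)) ^ 2) ≤ ε) (hε1 : ε ≤ 1) :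
    ‖scaledMoment a n m T - 1 / (m + 2 * a + 1 : ℂ)‖ ≤ 2 * ε := by
  have hT' : ‖T‖ < n + 1 := by
    rw [← div_lt_one (by positivity), ← sq_lt_one_iff₀ (by positivity)]
    linarith
  have hb : ∀ u ∈ Ioc (0 : ℝ) 1, ‖scaledWeight a n ((T * u / (n + 1)) ^ 2) - 1‖ ≤ 2 * ε :=
    fun u hu => norm_scaledWeight_sub_one_le ha ((norm_scaledArg_le hu).trans hT)
      (le_trans (by gcongr; exact norm_scaledArg_le hu) hε) hε1
  have hε0 : 0 ≤ ε := le_trans (by positivity) hε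
  have h1 : IntegrableOn (fun u : ℝ => ((u ^ ((m : ℝ) + 2 * a) : ℝ) : ℂ)) (Ioc 0 1) :=
    (IntegrableOn.of_bound (by simp) (Complex.continuous_ofReal.comp
        (Real.continuous_rpow_const (by positivity))).aestronglyMeasurable 1
      ((ae_restrict_iff' measurableSet_Ioc).2 (ae_of_all _ fun u hu => norm_rpow_le_one ha m hu)))
  have h2 : IntegrableOn (fun u : ℝ => ((u ^ ((m : ℝ) + 2 * a) : ℝ) : ℂ)
      * scaledWeight a n ((T * u / (n + 1)) ^ 2)) (Ioc 0 1) := by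
    refine IntegrableOn.of_bound (by simp)
      ((continuousOn_scaledIntegrand ha m hT').aestronglyMeasurable measurableSet_Ioc) 3 ?_
    refine (ae_restrict_iff' measurableSet_Ioc).2 (ae_of_all _ fun u hu => ?_)
    rw [norm_mul]
    have h3 : ‖scaledWeight a n ((T * u / (n + 1)) ^ 2)‖ ≤ 3 := by
      have := norm_sub_norm_le (scaledWeight a n ((T * u / (n + 1)) ^ 2)) 1
      have := hb u hu
      rw [norm_one] at *
      linarith
    have := mul_le_mul (norm_rpow_le_one ha m hu) h3 (norm_nonneg _) zero_le_one
    linarith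
  rw [← integral_rpow_Ioc ha, scaledMoment, ← integral_sub h2 h1]
  have := norm_setIntegral_le_of_norm_le_const (μ := volume) (s := Ioc (0 : ℝ) 1) (C := 2 * ε)
    (f := fun u : ℝ => ((u ^ ((m : ℝ) + 2 * a) : ℝ) : ℂ)
      * scaledWeight a n ((T * u / (n + 1)) ^ 2) - ((u ^ ((m : ℝ) + 2 * a) : ℝ) : ℂ))
    (by simp) fun u hu => by
      rw [← mul_sub_one, norm_mul]
      have := mul_le_mul (norm_rpow_le_one ha m hu) (hb u hu) (norm_nonneg _) zero_le_one
      linarith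
  simpa using this

/-- The scaled moments are holomorphic in the disc of radius `N`. -/
lemma differentiableAt_scaledMoment (ha : 0 ≤ a) (m : ℕ) {T : ℂ} (hT : ‖T‖ < n + 1) :
    DifferentiableAt ℂ (scaledMoment a n m) T := by
  obtain ⟨ρ, hTρ, hρ⟩ := exists_between hT
  have hρ0 : 0 < ρ := (norm_nonneg T).trans_lt hTρ
  have hW := (differentiableOn_scaledWeight a n)
  have hW' : ContinuousOn (deriv (scaledWeight a n)) (Metric.ball 0 1) :=
    ((hW.analyticOnNhd Metric.isOpen_ball).deriv).continuousOn
  have hsub : Metric.closedBall (0 : ℂ) ((ρ / (n + 1)) ^ 2) ⊆ Metric.ball 0 1 := by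
    refine Metric.closedBall_subset_ball ?_
    rw [sq_lt_one_iff₀ (by positivity), div_lt_one (by positivity)]
    exact hρ
  obtain ⟨C, hC⟩ := (isCompact_closedBall (0 : ℂ) ((ρ / (n + 1)) ^ 2)).exists_bound_of_continuousOn
    (hW'.mono hsub)
  have hC0 : 0 ≤ C := (norm_nonneg _).trans (hC 0 (by simp; positivity))
  have hmem : ∀ S ∈ Metric.ball (0 : ℂ) ρ, ∀ u ∈ Ioc (0 : ℝ) 1,
      (S * u / (n + 1)) ^ 2 ∈ Metric.closedBall (0 : ℂ) ((ρ / (n + 1)) ^ 2) := fun S hS u hu => by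
    rw [mem_closedBall_zero_iff]
    refine (norm_scaledArg_le hu).trans ?_
    have := (mem_ball_zero_iff.1 hS).le
    gcongr
  have hTb : Metric.ball (0 : ℂ) ρ ∈ 𝓝 T := Metric.isOpen_ball.mem_nhds (by simpa using hTρ)
  have hlt : ∀ S ∈ Metric.ball (0 : ℂ) ρ, ‖S‖ < n + 1 := fun S hS => (mem_ball_zero_iff.1 hS).trans hρ
  refine (hasDerivAt_integral_of_dominated_loc_of_deriv_le (μ := volume.restrict (Ioc (0 : ℝ) 1))
    (F := fun (S : ℂ) (u : ℝ) => ((u ^ ((m : ℝ) + 2 * a) : ℝ) : ℂ)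
      * scaledWeight a n ((S * u / (n + 1)) ^ 2))
    (F' := fun (S : ℂ) (u : ℝ) => ((u ^ ((m : ℝ) + 2 * a) : ℝ) : ℂ)
      * (deriv (scaledWeight a n) ((S * u / (n + 1)) ^ 2) * (2 * (S * u / (n + 1)) * (u / (n + 1)))))
    (x₀ := T) (s := Metric.ball 0 ρ) (bound := fun _ => C * (2 * ρ)) hTb ?_ ?_ ?_ ?_ ?_ ?_).2.differentiableAt
  · filter_upwards [hTb] with S hS
    exact (continuousOn_scaledIntegrand ha m (hlt S hS)).aestronglyMeasurable measurableSet_Ioc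
  · obtain ⟨C', hC'⟩ := (isCompact_closedBall (0 : ℂ) ((ρ / (n + 1)) ^ 2)).exists_bound_of_continuousOn
      (hW.continuousOn.mono hsub)
    refine IntegrableOn.of_bound (by simp)
      ((continuousOn_scaledIntegrand ha m hT).aestronglyMeasurable measurableSet_Ioc) C' ?_
    refine (ae_restrict_iff' measurableSet_Ioc).2 (ae_of_all _ fun u hu => ?_)
    rw [norm_mul]
    have := mul_le_mul (norm_rpow_le_one ha m hu) (hC' _ (hmem T (by simpa using hTρ) u hu))
      (norm_nonneg _) zero_le_one
    linarith
  · refine ContinuousOn.aestronglyMeasurable ?_ measurableSet_Ioc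
    refine ContinuousOn.mul ?_ (ContinuousOn.mul ?_ (by fun_prop))
    · exact (Complex.continuous_ofReal.comp
        (Real.continuous_rpow_const (by positivity))).continuousOn
    · exact hW'.comp (by fun_prop) fun u hu => by simpa using norm_scaledArg_lt hT hu
  · refine (ae_restrict_iff' measurableSet_Ioc).2 (ae_of_all _ fun u hu S hS => ?_)
    have h1 := hC _ (hmem S hS u hu)
    have hn : ‖(n + 1 : ℂ)‖ = n + 1 := by exact_mod_cast Complex.norm_natCast (n + 1)
    have hu1 : ‖(u : ℂ)‖ ≤ 1 := by
      rw [Complex.norm_real, Real.norm_of_nonneg hu.1.le]; exact hu.2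
    have hS' := (mem_ball_zero_iff.1 hS).le
    have hn1 : (1 : ℝ) ≤ n + 1 := by have : (0 : ℝ) ≤ n := by positivity
                                     linarith
    have h2 : ‖2 * (S * u / (n + 1)) * (u / (n + 1))‖ ≤ 2 * ρ := by
      rw [norm_mul, norm_mul, norm_div, norm_div, norm_mul, hn, Complex.norm_two]
      calc 2 * (‖S‖ * ‖(u : ℂ)‖ / (n + 1)) * (‖(u : ℂ)‖ / (n + 1))
          ≤ 2 * (ρ * 1 / 1) * (1 / 1) := by gcongr
        _ = 2 * ρ := by ring
    rw [norm_mul, norm_mul]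
    have h3 := mul_le_mul h1 h2 (norm_nonneg _) hC0
    have h4 := mul_le_mul (norm_rpow_le_one ha m hu) h3 (by positivity) zero_le_one
    linarith
  · exact integrableOn_const (by simp)
  · refine (ae_restrict_iff' measurableSet_Ioc).2 (ae_of_all _ fun u hu S hS => ?_)
    refine HasDerivAt.const_mul _ ?_
    have h1 : HasDerivAt (scaledWeight a n) (deriv (scaledWeight a n) ((S * u / (n + 1)) ^ 2))
        ((S * u / (n + 1)) ^ 2) :=
      (hW.differentiableAt (Metric.isOpen_ball.mem_nhds (hsub (hmem S hS u hu)))).hasDerivAt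
    have h2 : HasDerivAt (fun S : ℂ => (S * u / (n + 1)) ^ 2)
        (2 * (S * u / (n + 1)) * (u / (n + 1))) S := by
      have := (((hasDerivAt_id S).mul_const (u : ℂ)).div_const (n + 1 : ℂ)).fun_pow 2
      simpa using this
    exact h1.comp S h2

/-- The substitution `x = s / u` turns the moments on `(s, ∞)` into scaled moments. -/
lemma integral_Ioi_moment (a : ℝ) (n j k : ℕ) (hj : j ≤ n) (hk : k ≤ n) {T : ℝ} (hT : 0 < T) :
    ((∫ x in Ioi ((n + 1) / T), x ^ ((n - j) + (n - k)) * cauchyWeight a (n + 1) x : ℝ) : ℂ)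
      = (((T / (n + 1)) ^ (2 * a + 1) * (T / (n + 1)) ^ (j + k) : ℝ) : ℂ)
        * scaledMoment a n (j + k) T := by
  set s : ℝ := (n + 1) / T with hs
  have hs0 : 0 < s := by positivity
  have hsT : T / (n + 1) = s⁻¹ := by rw [hs, inv_div]
  have himg : (fun u => s / u) '' Ioo 0 1 = Ioi s := by
    ext x
    simp only [mem_image, mem_Ioo, mem_Ioi]
    constructor
    · rintro ⟨u, ⟨h0, h1⟩, rfl⟩
      rw [lt_div_iff₀ h0]
      nlinarith
    · intro hx
      have hx0 := hs0.trans hx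
      exact ⟨s / x, ⟨by positivity, (div_lt_one hx0).2 hx⟩, by field_simp⟩
  have hder : ∀ u ∈ Ioo (0 : ℝ) 1, HasDerivWithinAt (fun u => s / u) (-s / u ^ 2) (Ioo 0 1) u :=
    fun u hu => by
      have := ((hasDerivAt_const u s).fun_div (hasDerivAt_id' u) hu.1.ne').hasDerivWithinAt
        (s := Ioo 0 1)
      simpa using this
  have hinj : InjOn (fun u => s / u) (Ioo 0 1) := fun u hu v hv h => by
    have hu0 := hu.1.ne'
    have hv0 := hv.1.ne'
    simp only at h
    rw [div_eq_div_iff hu0 hv0] at h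
    exact (mul_left_cancel₀ hs0.ne' h).symm
  rw [← himg, integral_image_eq_integral_abs_deriv_smul measurableSet_Ioo hder hinj, scaledMoment,
    integral_Ioc_eq_integral_Ioo, ← integral_const_mul, ← integral_complex_ofReal]
  refine setIntegral_congr_fun measurableSet_Ioo fun u hu => ?_
  have hu0 : 0 < u := hu.1
  have hz : (0 : ℝ) < 1 + (T * u / (n + 1)) ^ 2 := by positivity
  have h1 : scaledWeight a n ((T * u / (n + 1)) ^ 2)
      = (((1 + (T * u / (n + 1)) ^ 2) ^ (-((n : ℝ) + 1 + a)) : ℝ) : ℂ) := by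
    rw [scaledWeight, Complex.ofReal_cpow hz.le]
    push_cast
    rfl
  simp only [h1]
  rw [← Complex.ofReal_mul, ← Complex.ofReal_mul]
  congr 1
  obtain ⟨p, hp, rfl⟩ : ∃ p : ℝ, 0 < p ∧ u = s * p := ⟨u / s, by positivity, by field_simp⟩
  have h2 : T * (s * p) / (n + 1) = p := by rw [hs]; field_simp
  have h3 : (2 * n : ℕ) = (n - j + (n - k)) + (j + k) := by omega
  have h4 : cauchyWeight a (n + 1) p⁻¹
      = p ^ (n - j + (n - k)) * p ^ (j + k) * p ^ 2 * p ^ (2 * a) * (1 + p ^ 2) ^ (-((n : ℝ) + 1 + a)) := by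
    have h5 : 1 + p⁻¹ ^ 2 = (p ^ 2)⁻¹ * (1 + p ^ 2) := by field_simp; ring
    have h6 : ((p ^ 2)⁻¹) ^ (-((n : ℝ) + 1 + a)) = p ^ (2 * n) * p ^ 2 * p ^ (2 * a) := by
      rw [Real.inv_rpow (by positivity), ← Real.rpow_neg (by positivity), neg_neg,
        ← Real.rpow_natCast p 2, ← Real.rpow_mul hp.le, ← Real.rpow_natCast p (2 * n),
        ← Real.rpow_add hp, ← Real.rpow_add hp]
      congr 1
      push_cast
      ring
    rw [cauchyWeight, h5, show (-((n + 1 : ℕ) : ℝ) - a) = -((n : ℝ) + 1 + a) by push_cast; ring,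
      Real.mul_rpow (by positivity) (by positivity), h6, h3, pow_add]
  have h7 : s / (s * p) = p⁻¹ := by field_simp
  rw [h2, h7, h4, hsT, Real.rpow_add hu0, Real.rpow_natCast, smul_eq_mul, neg_div, abs_neg,
    abs_of_pos (by positivity), Real.inv_rpow hs0.le, Real.rpow_add hs0 (2 * a), Real.rpow_one,
    Real.mul_rpow hs0.le hp.le]
  have h8 : s ^ (2 * a) ≠ 0 := (Real.rpow_pos_of_pos hs0 _).ne'
  rw [mul_pow s p (j + k), inv_pow, inv_pow]
  field_simp

end CauchyEnsemble

/-! ### The gap probability as a determinant of growing size, and its limit -/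

namespace CauchyEnsemble
variable {a : ℝ} {N n : ℕ}

/-- The scaled matrix `X_N(T)`, for `N = n + 1`. -/
def scaledMat (a : ℝ) (n : ℕ) (T : ℂ) : ℕ → ℕ → ℂ :=
  scaledEntry (2 * a + 1) (kappa a n) (scaledCoeff a n) (fun m => scaledMoment a n m T) T

/-- The determinant `det (1 - X_N(T))`, for `N = n + 1`: the holomorphic continuation of the gap
probability in the variable `T = N / s`. -/
def scaledDet (a : ℝ) (n : ℕ) (T : ℂ) : ℂ := sectionDet (scaledMat a n T) (n + 1)

/-- The limit of the scaled matrices. -/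
def limitMat (a : ℝ) (T : ℂ) : ℕ → ℕ → ℂ :=
  scaledEntry (2 * a + 1) (kappaLim a) (limitCoeff a) (fun m => 1 / (m + 2 * a + 1)) T

/-- The limit of the gap probabilities. -/
def limitGap (a : ℝ) (T : ℂ) : ℂ := limitDet (limitMat a T)

lemma kerCoeff_eq_zero {j l : ℕ} (hl : n < l) : kerCoeff a n j l = 0 :=
  cdCoeff_eq_zero_right (fun _ h => pjCoeff_eq_zero _ h) (fun _ h => pjCoeff_eq_zero _ h) hl

lemma scaledMat_eq_sum (a : ℝ) (n : ℕ) (T : ℂ) (j k : ℕ) : scaledMat a n T j k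
    = kappa a n * T ^ ((2 * a + 1 : ℝ) : ℂ) * (2 ^ j / 2 ^ k)
      * ∑ l ∈ Finset.range (n + 1), scaledCoeff a n j l * T ^ (j + l) * scaledMoment a n (l + k) T := by
  rw [scaledMat, scaledEntry, tsum_eq_sum]
  intro l hl
  rw [scaledCoeff_eq, kerCoeff_eq_zero (by simpa using hl)]
  simp

open Matrix Hankel in
/-- Since `H(s) = H(∞) - ∫_s^∞`, the gap probability is the determinant of `1` minus the kernel on
`(s, ∞)`, in the basis of monomials. -/
lemma gapDet_eq_det (ha : 0 ≤ a) (s : ℝ) : gapDet a (n + 1) s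
    = (1 - (topNorm a n)⁻¹ • ((of fun i j : Fin (n + 1) => kerCoeff a n i.rev j.rev)
      * mat (fun k => ∫ x in Ioi s, x ^ k * cauchyWeight a (n + 1) x) (n + 1))).det := by
  set C : Matrix (Fin (n + 1)) (Fin (n + 1)) ℝ := of fun i j => kerCoeff a n i.rev j.rev
  have h0 : topNorm a n ≠ 0 := (topNorm_pos ha).ne'
  have h1 : C * hankelTotal a (n + 1) = topNorm a n • 1 := kerCoeff_mul_hankelTotal ha
  have h2 : (1 - (topNorm a n)⁻¹ • (C * mat (fun k => ∫ x in Ioi s,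
      x ^ k * cauchyWeight a (n + 1) x) (n + 1))) = (topNorm a n)⁻¹ • (C * hankel a (n + 1) s) := by
    rw [mat_integral_Ioi ha, mul_sub, h1, smul_sub, smul_smul, inv_mul_cancel₀ h0, one_smul,
      sub_sub_cancel]
  have h3 : C.det * (hankelTotal a (n + 1)).det = topNorm a n ^ (n + 1) := by
    rw [← det_mul, h1, det_smul, det_one, Fintype.card_fin, mul_one]
  have h4 : (hankelTotal a (n + 1)).det ≠ 0 := (hankelTotal_isUnit ha).ne_zero
  rw [h2, det_smul, det_mul, Fintype.card_fin, gapDet, inv_pow, ← h3]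
  have h5 : C.det ≠ 0 := by
    intro h
    rw [h, zero_mul] at h3
    exact pow_ne_zero _ h0 h3.symm
  field_simp

open Matrix Hankel in
/-- Reversing the indices and conjugating by the powers of `2T / N` gives the scaled matrix. -/
lemma gapDet_eq_scaledDet (ha : 0 ≤ a) {T : ℝ} (hT : 0 < T) :
    (gapDet a (n + 1) ((n + 1) / T) : ℂ) = scaledDet a n T := by
  set M := mat (fun k => ∫ x in Ioi (((n : ℝ) + 1) / T), x ^ k * cauchyWeight a (n + 1) x) (n + 1)
    with hM
  set Y : Matrix (Fin (n + 1)) (Fin (n + 1)) ℂ := Complex.ofRealHom.mapMatrix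
    ((topNorm a n)⁻¹ • ((of fun i j : Fin (n + 1) => kerCoeff a n i.rev j.rev) * M)) with hY
  have hn : (0 : ℝ) < n + 1 := by positivity
  set δ : ℂ := 2 * T / (n + 1) with hδ
  have hn' : (n + 1 : ℂ) ≠ 0 := by exact_mod_cast hn.ne'
  have hT' : (T : ℂ) ≠ 0 := by exact_mod_cast hT.ne'
  have hδ0 : δ ≠ 0 := div_ne_zero (mul_ne_zero two_ne_zero hT') hn'
  have h1 : (gapDet a (n + 1) ((n + 1) / T) : ℂ) = (1 - Y).det := by
    rw [gapDet_eq_det ha, ← Complex.ofRealHom_eq_coe, RingHom.map_det, map_sub, map_one]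
  have hentry : ∀ p q : Fin (n + 1), scaledMat a n T p q
      = δ ^ (p : ℕ) * Y p.rev q.rev * (δ ^ (q : ℕ))⁻¹ := fun p q => by
    rw [scaledMat_eq_sum, hY, RingHom.mapMatrix_apply, map_apply, Matrix.smul_apply, mul_apply,
      smul_eq_mul, ← Equiv.sum_comp Fin.revPerm, Finset.sum_range, Complex.ofRealHom_eq_coe,
      Complex.ofReal_mul, Complex.ofReal_sum, Finset.mul_sum, Finset.mul_sum, Finset.mul_sum,
      Finset.sum_mul]
    refine Finset.sum_congr rfl fun l _ => ?_
    have hm := integral_Ioi_moment a n l q (by omega) (by omega) hT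
    have hM' : M l.rev q.rev = ∫ x in Ioi (((n : ℝ) + 1) / T),
        x ^ ((n - l) + (n - q)) * cauchyWeight a (n + 1) x := by
      rw [hM]
      simp only [mat, of_apply, Fin.val_rev, Nat.add_sub_add_right]
    have hκ : (kappa a n : ℂ) * (T : ℂ) ^ ((2 * a + 1 : ℝ) : ℂ)
        = ((topNorm a n)⁻¹ : ℝ) * ((T / (n + 1)) ^ (2 * a + 1) : ℝ) := by
      rw [← Complex.ofReal_cpow hT.le, ← Complex.ofReal_mul, ← Complex.ofReal_mul, kappa,
        Real.rpow_neg hn.le, Real.div_rpow hT.le hn.le]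
      congr 1
      ring
    simp only [Fin.revPerm_apply, of_apply, Fin.rev_rev]
    rw [Complex.ofReal_mul, hM', hm, scaledCoeff_eq, hκ, Complex.ofReal_mul]
    push_cast
    rw [hδ]
    simp only [div_pow, mul_pow, pow_add]
    field_simp
  have h2 : (1 - of fun i j : Fin (n + 1) => scaledMat a n T i j)
      = diagonal (fun p : Fin (n + 1) => δ ^ (p : ℕ)) * (1 - Y).submatrix Fin.revPerm Fin.revPerm
        * diagonal (fun p : Fin (n + 1) => (δ ^ (p : ℕ))⁻¹) := by
    ext p q
    rw [mul_diagonal, diagonal_mul, Matrix.sub_apply, of_apply, hentry, submatrix_apply,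
      Matrix.sub_apply, Fin.revPerm_apply, Fin.revPerm_apply, one_apply, one_apply]
    simp only [Fin.rev_inj]
    by_cases hpq : p = q
    · subst hpq
      have : δ ^ (p : ℕ) ≠ 0 := pow_ne_zero _ hδ0
      rw [if_pos rfl, mul_sub, mul_one, sub_mul, mul_inv_cancel₀ this]
    · rw [if_neg hpq]
      ring
  rw [h1, scaledDet, sectionDet, h2, det_mul, det_mul, det_submatrix_equiv_self, det_diagonal,
    det_diagonal, mul_right_comm, ← Finset.prod_mul_distrib, Finset.prod_eq_one, one_mul]
  exact fun p _ => mul_inv_cancel₀ (pow_ne_zero _ hδ0)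

lemma differentiableAt_scaledDet (ha : 0 ≤ a) {T : ℂ} (hT : ‖T‖ < n + 1) (hT' : 0 < T.re) :
    DifferentiableAt ℂ (scaledDet a n) T := by
  have hentry : ∀ j k, DifferentiableAt ℂ (fun T => scaledMat a n T j k) T := fun j k => by
    simp only [scaledMat_eq_sum]
    have hc : DifferentiableAt ℂ (fun T : ℂ => T ^ ((2 * a + 1 : ℝ) : ℂ)) T :=
      differentiableAt_id.cpow (by fun_prop) (Or.inl hT')
    have hs : DifferentiableAt ℂ (fun T : ℂ => ∑ l ∈ Finset.range (n + 1),
        scaledCoeff a n j l * T ^ (j + l) * scaledMoment a n (l + k) T) T :=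
      DifferentiableAt.fun_sum fun l _ =>
        (DifferentiableAt.mul (by fun_prop) (differentiableAt_scaledMoment ha _ hT))
    exact ((hc.const_mul _).mul_const _).mul hs
  change DifferentiableAt ℂ (fun T => (1 - Matrix.of fun i j : Fin (n + 1) =>
    scaledMat a n T i j).det) T
  simp only [Matrix.det_apply]
  refine DifferentiableAt.fun_sum fun σ _ => ?_
  refine DifferentiableAt.const_smul (DifferentiableAt.fun_finsetProd fun i _ => ?_) _
  simp only [Matrix.sub_apply, Matrix.of_apply]
  exact (hentry _ _).const_sub _

lemma one_div_moment_le (ha : 0 ≤ a) (m : ℕ) : ‖1 / (m + 2 * a + 1 : ℂ)‖ ≤ 1 := by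
  rw [show (m + 2 * a + 1 : ℂ) = ((m + 2 * a + 1 : ℝ) : ℂ) by push_cast; rfl, norm_div, norm_one,
    Complex.norm_real, Real.norm_of_nonneg (by positivity), div_le_one (by positivity)]
  have : (0 : ℝ) ≤ m := by positivity
  linarith

section Limit
variable {T₀ : ℂ}

lemma tendsto_norm_div_succ : Tendsto (fun p : ℕ × ℂ => ‖p.2‖ / ((p.1 : ℝ) + 1))
    (atTop ×ˢ 𝓝 T₀) (𝓝 0) :=
  (tendsto_snd (f := (atTop : Filter ℕ)) (g := 𝓝 T₀)).norm.div_atTop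
    ((tendsto_atTop_add_const_right _ _ tendsto_natCast_atTop_atTop).comp tendsto_fst)

lemma tendsto_moment_error (a : ℝ) :
    Tendsto (fun p : ℕ × ℂ => ((p.1 : ℝ) + 1 + a) * (3 / 2 * (‖p.2‖ / (p.1 + 1)) ^ 2))
      (atTop ×ˢ 𝓝 T₀) (𝓝 0) := by
  have hn : Tendsto (fun p : ℕ × ℂ => (p.1 : ℝ) + 1) (atTop ×ˢ 𝓝 T₀) atTop :=
    (tendsto_atTop_add_const_right _ _ tendsto_natCast_atTop_atTop).comp tendsto_fst
  have h1 : Tendsto (fun p : ℕ × ℂ => (1 + a / ((p.1 : ℝ) + 1)) * (3 / 2 * ‖p.2‖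
      * (‖p.2‖ / (p.1 + 1)))) (atTop ×ˢ 𝓝 T₀) (𝓝 ((1 + 0) * (3 / 2 * ‖T₀‖ * 0))) :=
    ((hn.const_div_atTop a).const_add 1).mul
      ((tendsto_snd.norm.const_mul _).mul tendsto_norm_div_succ)
  rw [mul_zero, mul_zero] at h1
  refine h1.congr fun p => ?_
  have : ((p.1 : ℝ) + 1) ≠ 0 := by positivity
  field_simp

lemma eventually_norm_scaledMoment_sub_le (ha : 0 ≤ a) :
    ∀ᶠ p : ℕ × ℂ in atTop ×ˢ 𝓝 T₀, ∀ m, ‖scaledMoment a p.1 m p.2 - 1 / (m + 2 * a + 1 : ℂ)‖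
      ≤ 2 * (((p.1 : ℝ) + 1 + a) * (3 / 2 * (‖p.2‖ / (p.1 + 1)) ^ 2)) := by
  have hr2 : Tendsto (fun p : ℕ × ℂ => (‖p.2‖ / ((p.1 : ℝ) + 1)) ^ 2) (atTop ×ˢ 𝓝 T₀) (𝓝 0) := by
    simpa using (tendsto_norm_div_succ (T₀ := T₀)).pow 2
  filter_upwards [hr2.eventually_le_const (by norm_num : (0 : ℝ) < 1 / 2),
    (tendsto_moment_error a).eventually_le_const one_pos] with p h1 h2 m
  exact norm_scaledMoment_sub_le ha m h1 le_rfl h2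

lemma tendsto_scaledMoment (ha : 0 ≤ a) (m : ℕ) :
    Tendsto (fun p : ℕ × ℂ => scaledMoment a p.1 m p.2) (atTop ×ˢ 𝓝 T₀)
      (𝓝 (1 / (m + 2 * a + 1 : ℂ))) := by
  rw [tendsto_iff_norm_sub_tendsto_zero]
  have h := (tendsto_moment_error (T₀ := T₀) a).const_mul 2
  rw [mul_zero] at h
  exact squeeze_zero' (Eventually.of_forall fun _ => norm_nonneg _)
    ((eventually_norm_scaledMoment_sub_le ha).mono fun p h => h m) h

lemma eventually_norm_scaledMoment_le (ha : 0 ≤ a) :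
    ∀ᶠ p : ℕ × ℂ in atTop ×ˢ 𝓝 T₀, ∀ m, ‖scaledMoment a p.1 m p.2‖ ≤ 3 := by
  filter_upwards [eventually_norm_scaledMoment_sub_le ha,
    (tendsto_moment_error a).eventually_le_const one_pos] with p h1 h2 m
  have h3 := norm_sub_norm_le (scaledMoment a p.1 m p.2) (1 / (m + 2 * a + 1 : ℂ))
  have h4 := h1 m
  have h5 := one_div_moment_le ha m
  linarith

/-- The determinants converge along every sequence of arguments with a limit in the right half
plane. -/
lemma tendsto_scaledDet (ha : 0 ≤ a) (hT₀ : 0 < T₀.re) :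
    Tendsto (fun p : ℕ × ℂ => scaledDet a p.1 p.2) (atTop ×ˢ 𝓝 T₀) (𝓝 (limitGap a T₀)) := by
  have hsnd : Tendsto (Prod.snd : ℕ × ℂ → ℂ) (atTop ×ˢ 𝓝 T₀) (𝓝 T₀) := tendsto_snd
  have hκ : Tendsto (fun p : ℕ × ℂ => kappa a p.1) (atTop ×ˢ 𝓝 T₀) (𝓝 (kappaLim a)) :=
    (tendsto_kappa ha).comp tendsto_fst
  have hK : 0 ≤ (kappaLim a + 1) * 3 := by have := kappaLim_pos ha; positivity
  refine tendsto_sectionDet (X := fun p : ℕ × ℂ => scaledMat a p.1 p.2)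
    (x := rowBound (2 * a + 1) ((kappaLim a + 1) * 3) (‖T₀‖ + 1)) (n := fun p => p.1 + 1)
    (hasSum_rowBound _ _ _).summable (rowBound_nonneg hK (by positivity))
    ((tendsto_add_atTop_nat 1).comp tendsto_fst) ?_ fun j k => ?_
  · filter_upwards [eventually_norm_scaledMoment_le ha, hκ.eventually_le_const (lt_add_one _),
      hsnd.norm.eventually_le_const (lt_add_one _)] with p h1 h2 h3
    exact sum_norm_scaledEntry_le (by linarith) (abs_scaledCoeff_le ha p.1) h1
      ((abs_of_pos (kappa_pos ha _)).trans_le h2) h3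
  · exact tendsto_scaledEntry (κ := fun p : ℕ × ℂ => kappa a p.1)
      (c := fun p : ℕ × ℂ => scaledCoeff a p.1)
      (J := fun p m => scaledMoment a p.1 m p.2) (T := Prod.snd) hT₀
      (fun p => abs_scaledCoeff_le ha p.1) (eventually_norm_scaledMoment_le ha) hκ
      (fun j l => (tendsto_scaledCoeff a j l).comp tendsto_fst) (tendsto_scaledMoment ha) hsnd j k

end Limit

lemma exp_sub_one_le (x : ℝ) : Real.exp x - 1 ≤ x * Real.exp x := by
  have h1 := Real.add_one_le_exp (-x)
  have h2 := mul_le_mul_of_nonneg_right h1 (Real.exp_pos x).le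
  rw [← Real.exp_add, neg_add_cancel, Real.exp_zero] at h2
  linarith

/-- The behaviour of the limit at the origin. -/
lemma norm_limitGap_sub_le (ha : 0 ≤ a) : ∃ C : ℝ, ∀ T : ℂ, ‖T‖ ≤ 1 →
    ‖limitGap a T - (1 - kappaLim a * T ^ ((2 * a + 1 : ℝ) : ℂ) / (2 * a + 1))‖
      ≤ C * ‖T‖ ^ (2 * a + 2) := by
  set κ := kappaLim a with hκ
  have hκ0 : 0 < κ := kappaLim_pos ha
  refine ⟨(16 * κ * Real.exp 2 * Real.exp 4) * Real.exp (4 * κ * Real.exp 2 * Real.exp 4)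
    + κ * (4 * Real.exp 2), fun T hT => ?_⟩
  set r := ‖T‖ with hr
  have hr0 : 0 ≤ r := norm_nonneg T
  have hJ := one_div_moment_le ha
  have hrow := sum_norm_scaledEntry_le (b := 2 * a + 1) (κ := κ) (K := κ) (B := 1) (r := r)
    (T := T) (by linarith) (abs_limitCoeff_le ha) hJ (abs_of_pos hκ0).le le_rfl
  have hS := hasSum_rowBound (2 * a + 1) (κ * 1) r
  have h1 := norm_limitDet_sub_le hS.summable (rowBound_nonneg (by linarith) hr0) hrow
  have hr1 : r ^ (2 * a + 1) ≤ 1 := Real.rpow_le_one hr0 hT (by linarith)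
  have hrp : 0 ≤ r ^ (2 * a + 1) := Real.rpow_nonneg hr0 _
  have hrr : r ^ (2 * a + 1) * r = r ^ (2 * a + 2) := by
    rw [show 2 * a + 2 = (2 * a + 1) + 1 by ring]
    exact (Real.rpow_add_one' hr0 (by linarith)).symm
  have he2 : Real.exp (2 * r) ≤ Real.exp 2 := Real.exp_le_exp.2 (by linarith)
  have he4 : Real.exp (4 * r) ≤ Real.exp 4 := Real.exp_le_exp.2 (by linarith)
  have hs4 : Real.exp (4 * r) - 1 ≤ 4 * r * Real.exp 4 :=
    (exp_sub_one_le _).trans (by gcongr)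
  have hs2 : Real.exp (2 * r) - 1 ≤ 2 * r * Real.exp 2 :=
    (exp_sub_one_le _).trans (by gcongr)
  have htot : ∑' j, rowBound (2 * a + 1) (κ * 1) r j ≤ 4 * κ * Real.exp 2 * Real.exp 4 := by
    rw [hS.tsum_eq]
    calc 4 * (κ * 1) * r ^ (2 * a + 1) * Real.exp (2 * r) * Real.exp (4 * r)
        ≤ 4 * (κ * 1) * 1 * Real.exp 2 * Real.exp 4 := by gcongr
      _ = _ := by ring
  have htail : ∑' j, rowBound (2 * a + 1) (κ * 1) r (j + 1)
      ≤ (16 * κ * Real.exp 2 * Real.exp 4) * r ^ (2 * a + 2) := by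
    have h2 := hS.summable.tsum_eq_zero_add
    rw [hS.tsum_eq, rowBound] at h2
    simp only [pow_zero, Nat.factorial_zero, Nat.cast_one, div_one, mul_one] at h2
    have h3 : ∑' j, rowBound (2 * a + 1) (κ * 1) r (j + 1)
        = 4 * κ * r ^ (2 * a + 1) * Real.exp (2 * r) * (Real.exp (4 * r) - 1) := by
      rw [mul_one]
      linear_combination -h2
    rw [h3, ← hrr]
    calc 4 * κ * r ^ (2 * a + 1) * Real.exp (2 * r) * (Real.exp (4 * r) - 1)
        ≤ 4 * κ * r ^ (2 * a + 1) * Real.exp 2 * (4 * r * Real.exp 4) := by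
          have : 0 ≤ Real.exp (4 * r) - 1 := by
            have := Real.one_le_exp (show 0 ≤ 4 * r by linarith)
            linarith
          gcongr
      _ = _ := by ring
  have hfirst : ‖limitMat a T 0 0 - κ * T ^ ((2 * a + 1 : ℝ) : ℂ) / (2 * a + 1)‖
      ≤ κ * (4 * Real.exp 2) * r ^ (2 * a + 2) := by
    have hterm := norm_scaledEntry_term_le (T := T) (r := r) (abs_limitCoeff_le ha) hJ le_rfl 0 0
    have hS2 := hasSum_pow_div_factorial (2 * r)
    have hb : Summable fun l : ℕ => 2 * 1 * ((2 * r) ^ 0 / (Nat.factorial 0 : ℝ))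
        * ((2 * r) ^ l / l.factorial) := hS2.summable.mul_left _
    have hsum : Summable fun l : ℕ => limitCoeff a 0 l * T ^ (0 + l)
        * (1 / (((l + 0 : ℕ) : ℂ) + 2 * a + 1)) := Summable.of_norm_bounded hb hterm
    have hc : limitCoeff a 0 0 = 1 := by simp [limitCoeff, cdCoeff, besselCoeff]
    have h2 : ‖∑' l : ℕ, limitCoeff a 0 (l + 1) * T ^ (0 + (l + 1))
        * (1 / (((l + 1 + 0 : ℕ) : ℂ) + 2 * a + 1))‖ ≤ 4 * r * Real.exp 2 := by
      have h3 := tsum_of_norm_bounded ((summable_nat_add_iff 1).2 hb).hasSum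
        (fun l => hterm (l + 1))
      refine h3.trans ?_
      have h4 := hb.tsum_eq_zero_add
      rw [tsum_mul_left, hS2.tsum_eq] at h4
      simp only [pow_zero, Nat.factorial_zero, Nat.cast_one, div_one, mul_one] at h4 ⊢
      linarith
    rw [limitMat, scaledEntry, hsum.tsum_eq_zero_add, hc]
    simp only [pow_zero, Nat.add_zero, Nat.cast_zero, zero_add, Complex.ofReal_one, div_one,
      mul_one, one_mul] at h2 ⊢
    rw [mul_add, show (κ : ℂ) * T ^ ((2 * a + 1 : ℝ) : ℂ) * (1 / (2 * a + 1))
      = κ * T ^ ((2 * a + 1 : ℝ) : ℂ) / (2 * a + 1) by ring, add_sub_cancel_left, norm_mul, norm_mul,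
      Complex.norm_real, Real.norm_of_nonneg hκ0.le, Complex.norm_cpow_real, ← hrr]
    calc κ * r ^ (2 * a + 1) * _ ≤ κ * r ^ (2 * a + 1) * (4 * r * Real.exp 2) := by gcongr
      _ = _ := by ring
  have h5 : limitGap a T - (1 - κ * T ^ ((2 * a + 1 : ℝ) : ℂ) / (2 * a + 1))
      = (limitGap a T - 1 + limitMat a T 0 0)
        - (limitMat a T 0 0 - κ * T ^ ((2 * a + 1 : ℝ) : ℂ) / (2 * a + 1)) := by ring
  rw [h5]
  refine (norm_sub_le _ _).trans ?_
  rw [add_mul]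
  refine add_le_add (h1.trans ?_) hfirst
  calc (∑' j, rowBound (2 * a + 1) (κ * 1) r (j + 1))
        * Real.exp (∑' j, rowBound (2 * a + 1) (κ * 1) r j)
      ≤ (16 * κ * Real.exp 2 * Real.exp 4) * r ^ (2 * a + 2)
        * Real.exp (4 * κ * Real.exp 2 * Real.exp 4) := by gcongr
    _ = _ := by ring

end CauchyEnsemble

/-! ### Continuous convergence of holomorphic functions -/

section Convergence
variable {F : ℕ → ℂ → ℂ} {f : ℂ → ℂ} {V : Set ℂ}

/-- Continuous convergence implies locally uniform convergence. -/
lemma tendstoLocallyUniformlyOn_of_tendsto_prod (hV : IsOpen V)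
    (hF : ∀ z ∈ V, Tendsto (fun p : ℕ × ℂ => F p.1 p.2) (atTop ×ˢ 𝓝 z) (𝓝 (f z))) :
    TendstoLocallyUniformlyOn F f atTop V := by
  rw [Metric.tendstoLocallyUniformlyOn_iff]
  intro ε hε z hz
  have h1 := (Metric.tendsto_nhds.1 (hF z hz)) (ε / 3) (by positivity)
  obtain ⟨pa, hpa, pb, hpb, h2⟩ := eventually_prod_iff.1 h1
  have hlim : ∀ w ∈ V, Tendsto (fun n => F n w) atTop (𝓝 (f w)) := fun w hw =>
    (hF w hw).comp (tendsto_id.prodMk tendsto_const_nhds)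
  refine ⟨{w | pb w} ∩ V, mem_nhdsWithin_of_mem_nhds (inter_mem hpb (hV.mem_nhds hz)), ?_⟩
  filter_upwards [hpa] with n hn w hw
  have h3 : dist (f w) (f z) ≤ ε / 3 := by
    refine le_of_tendsto ((hlim w hw.2).dist tendsto_const_nhds) ?_
    filter_upwards [hpa] with m hm using (h2 hm hw.1).le
  have h4 := h2 hn hw.1
  have h5 := dist_triangle_right (f w) (F n w) (f z)
  have h6 : dist (F n w) (f z) < ε / 3 := h4
  linarith

lemma TendstoLocallyUniformlyOn.tendsto_prod {z : ℂ} (hV : IsOpen V)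
    (hF : TendstoLocallyUniformlyOn F f atTop V) (hz : z ∈ V) (hf : ContinuousAt f z) :
    Tendsto (fun p : ℕ × ℂ => F p.1 p.2) (atTop ×ˢ 𝓝 z) (𝓝 (f z)) := by
  rw [Metric.tendsto_nhds]
  intro ε hε
  obtain ⟨W, hW, h1⟩ := Metric.tendstoLocallyUniformlyOn_iff.1 hF (ε / 2) (by positivity) z hz
  rw [hV.nhdsWithin_eq hz] at hW
  have h2 := Metric.tendsto_nhds.1 hf (ε / 2) (by positivity)
  filter_upwards [h1.prod_mk (h2.and hW)] with p hp
  have h3 := hp.1 p.2 hp.2.2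
  have h4 := hp.2.1
  have h5 := dist_triangle_left (F p.1 p.2) (f z) (f p.2)
  linarith

/-- Continuously convergent holomorphic functions have a holomorphic limit, and their derivatives
are again holomorphic and converge continuously. -/
lemma tendsto_deriv_prod (hV : IsOpen V)
    (hF : ∀ z ∈ V, Tendsto (fun p : ℕ × ℂ => F p.1 p.2) (atTop ×ˢ 𝓝 z) (𝓝 (f z)))
    (hd : ∀ z ∈ V, ∀ᶠ p : ℕ × ℂ in atTop ×ˢ 𝓝 z, DifferentiableAt ℂ (F p.1) p.2) {z : ℂ}
    (hz : z ∈ V) : DifferentiableAt ℂ f z ∧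
      Tendsto (fun p : ℕ × ℂ => deriv (F p.1) p.2) (atTop ×ˢ 𝓝 z) (𝓝 (deriv f z)) ∧
      ∀ᶠ p : ℕ × ℂ in atTop ×ˢ 𝓝 z, DifferentiableAt ℂ (deriv (F p.1)) p.2 := by
  obtain ⟨pa, hpa, pb, hpb, h1⟩ := eventually_prod_iff.1 (hd z hz)
  obtain ⟨r, hr, hrb⟩ := Metric.mem_nhds_iff.1 (inter_mem hpb (hV.mem_nhds hz))
  have hB : IsOpen (Metric.ball z r) := Metric.isOpen_ball
  have hzB := Metric.mem_ball_self (x := z) hr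
  have hdiff : ∀ᶠ n in atTop, DifferentiableOn ℂ (F n) (Metric.ball z r) := by
    filter_upwards [hpa] with n hn w hw
    exact (h1 hn (hrb hw).1).differentiableWithinAt
  have hU := tendstoLocallyUniformlyOn_of_tendsto_prod hB fun w hw => hF w (hrb hw).2
  have hf := hU.differentiableOn hdiff hB
  refine ⟨hf.differentiableAt (hB.mem_nhds hzB), ?_, ?_⟩
  · exact (hU.deriv hdiff hB).tendsto_prod hB hzB
      ((hf.deriv hB).continuousOn.continuousAt (hB.mem_nhds hzB))
  · filter_upwards [hdiff.prod_mk (hB.mem_nhds hzB)] with p hp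
    exact (hp.1.deriv hB).differentiableAt (hB.mem_nhds hp.2)

end Convergence

/-! ### The limiting gap probability -/

namespace CauchyEnsemble
variable {a : ℝ} {N n : ℕ}

lemma isOpen_rightHalf : IsOpen {T : ℂ | 0 < T.re} := isOpen_lt continuous_const Complex.continuous_re

lemma eventually_differentiableAt_scaledDet (ha : 0 ≤ a) {z : ℂ} (hz : 0 < z.re) :
    ∀ᶠ p : ℕ × ℂ in atTop ×ˢ 𝓝 z, DifferentiableAt ℂ (scaledDet a p.1) p.2 := by
  have h1 : ∀ᶠ p : ℕ × ℂ in atTop ×ˢ 𝓝 z, ‖p.2‖ / ((p.1 : ℝ) + 1) < 1 :=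
    tendsto_norm_div_succ.eventually_lt_const one_pos
  have h2 : ∀ᶠ p : ℕ × ℂ in atTop ×ˢ 𝓝 z, 0 < p.2.re :=
    tendsto_snd.eventually (isOpen_rightHalf.mem_nhds hz)
  filter_upwards [h1, h2] with p hp1 hp2
  exact differentiableAt_scaledDet ha ((div_lt_one (by positivity)).1 hp1) hp2

lemma differentiableOn_limitGap (ha : 0 ≤ a) : DifferentiableOn ℂ (limitGap a) {T | 0 < T.re} :=
  fun _ hz => (tendsto_deriv_prod isOpen_rightHalf (fun _ h => tendsto_scaledDet ha h)
    (fun _ h => eventually_differentiableAt_scaledDet ha h) hz).1.differentiableWithinAt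

lemma tendsto_deriv_scaledDet (ha : 0 ≤ a) {z : ℂ} (hz : 0 < z.re) :
    Tendsto (fun p : ℕ × ℂ => deriv (scaledDet a p.1) p.2) (atTop ×ˢ 𝓝 z)
      (𝓝 (deriv (limitGap a) z)) :=
  (tendsto_deriv_prod isOpen_rightHalf (fun _ h => tendsto_scaledDet ha h)
    (fun _ h => eventually_differentiableAt_scaledDet ha h) hz).2.1

lemma eventually_differentiableAt_deriv_scaledDet (ha : 0 ≤ a) {z : ℂ} (hz : 0 < z.re) :
    ∀ᶠ p : ℕ × ℂ in atTop ×ˢ 𝓝 z, DifferentiableAt ℂ (deriv (scaledDet a p.1)) p.2 :=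
  (tendsto_deriv_prod isOpen_rightHalf (fun _ h => tendsto_scaledDet ha h)
    (fun _ h => eventually_differentiableAt_scaledDet ha h) hz).2.2

/-- The limiting gap probability as a function of a real variable. -/
def gap (a t : ℝ) : ℝ := (limitGap a t).re

/-- The limit of the gap probabilities along end points `N / T_n` with `T_n → t`. -/
lemma tendsto_gapDet (ha : 0 ≤ a) {t : ℝ} (ht : 0 < t) {T : ℕ → ℝ} (hT : Tendsto T atTop (𝓝 t)) :
    Tendsto (fun n : ℕ => gapDet a (n + 1) ((n + 1) / T n)) atTop (𝓝 (gap a t)) := by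
  have h1 : Tendsto (fun n => (n, (T n : ℂ))) atTop (atTop ×ˢ 𝓝 (t : ℂ)) :=
    tendsto_id.prodMk ((Complex.continuous_ofReal.tendsto t).comp hT)
  have h2 := (Complex.continuous_re.tendsto _).comp ((tendsto_scaledDet ha (T₀ := t) ht).comp h1)
  refine h2.congr' ?_
  filter_upwards [hT.eventually_const_lt ht] with n hn
  simp only [Function.comp_apply]
  rw [← gapDet_eq_scaledDet ha hn, Complex.ofReal_re]

lemma limitGap_ofReal (ha : 0 ≤ a) {t : ℝ} (ht : 0 < t) : limitGap a t = gap a t := by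
  refine Complex.ext rfl ?_
  have h1 : Tendsto (fun n : ℕ => (n, (t : ℂ))) atTop (atTop ×ˢ 𝓝 (t : ℂ)) :=
    tendsto_id.prodMk tendsto_const_nhds
  have h2 := (Complex.continuous_im.tendsto _).comp ((tendsto_scaledDet ha (T₀ := t) ht).comp h1)
  rw [Complex.ofReal_im]
  refine tendsto_nhds_unique h2 (tendsto_const_nhds.congr fun n => ?_)
  simp only [Function.comp_apply]
  rw [← gapDet_eq_scaledDet ha ht, Complex.ofReal_im]

lemma gap_nonneg (ha : 0 ≤ a) {t : ℝ} (ht : 0 < t) : 0 ≤ gap a t :=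
  ge_of_tendsto' (tendsto_gapDet ha ht tendsto_const_nhds) fun _ => (gapDet_pos ha _).le

lemma antitoneOn_gap (ha : 0 ≤ a) : AntitoneOn (gap a) (Ioi 0) := fun t ht u hu htu => by
  have ht' : 0 < t := ht
  refine le_of_tendsto_of_tendsto' (tendsto_gapDet ha hu tendsto_const_nhds)
    (tendsto_gapDet ha ht tendsto_const_nhds) fun n => monotone_gapDet ha ?_
  gcongr

lemma tendsto_gap_zero (ha : 0 ≤ a) : Tendsto (gap a) (𝓝[>] 0) (𝓝 1) := by
  obtain ⟨C, hC⟩ := norm_limitGap_sub_le ha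
  have hb : (2 * a + 1) ≠ 0 := by linarith
  have h0 : ∀ p : ℝ, 0 < p → Tendsto (fun t : ℝ => t ^ p) (𝓝[>] 0) (𝓝 0) := fun p hp => by
    have := (Real.continuousAt_rpow_const 0 p (Or.inr hp.le)).tendsto
    rw [Real.zero_rpow hp.ne'] at this
    exact this.mono_left nhdsWithin_le_nhds
  have h1 : Tendsto (fun t : ℝ => C * t ^ (2 * a + 2)
      + kappaLim a / (2 * a + 1) * t ^ (2 * a + 1)) (𝓝[>] 0) (𝓝 (C * 0 + kappaLim a / (2 * a + 1) * 0)) :=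
    ((h0 _ (by linarith)).const_mul _).add ((h0 _ (by linarith)).const_mul _)
  rw [mul_zero, mul_zero, add_zero] at h1
  rw [tendsto_iff_norm_sub_tendsto_zero]
  refine squeeze_zero' (Eventually.of_forall fun _ => norm_nonneg _) ?_ h1
  filter_upwards [Ioc_mem_nhdsGT (zero_lt_one' ℝ)] with t ht
  have hκ := kappaLim_pos ha
  have hn : ‖(t : ℂ)‖ = t := by rw [Complex.norm_real, Real.norm_of_nonneg ht.1.le]
  have h2 := hC t (by rw [hn]; exact ht.2)
  rw [hn, limitGap_ofReal ha ht.1, ← Complex.ofReal_cpow ht.1.le] at h2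
  have h3 : ‖gap a t - (1 - kappaLim a * t ^ (2 * a + 1) / (2 * a + 1))‖ ≤ C * t ^ (2 * a + 2) := by
    rw [← Complex.norm_real]
    push_cast
    exact h2
  have h4 : gap a t - 1 = (gap a t - (1 - kappaLim a * t ^ (2 * a + 1) / (2 * a + 1)))
      - kappaLim a / (2 * a + 1) * t ^ (2 * a + 1) := by ring
  rw [h4]
  refine (norm_sub_le _ _).trans (add_le_add h3 (Real.norm_of_nonneg ?_).le)
  have := ht.1
  positivity

/-- The limiting gap probability is positive: it is decreasing, so a zero would make it vanish on a
half line, hence identically by analyticity. -/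
lemma gap_pos (ha : 0 ≤ a) {t : ℝ} (ht : 0 < t) : 0 < gap a t := by
  refine (gap_nonneg ha ht).lt_of_ne' fun h0 => ?_
  have hzero : ∀ u, t ≤ u → limitGap a u = 0 := fun u hu => by
    have hu0 := ht.trans_le hu
    have h1 := antitoneOn_gap ha ht hu0 hu
    rw [limitGap_ofReal ha hu0, le_antisymm (h1.trans_eq h0) (gap_nonneg ha hu0), Complex.ofReal_zero]
  have han : AnalyticOnNhd ℂ (limitGap a) {T | 0 < T.re} :=
    (differentiableOn_limitGap ha).analyticOnNhd isOpen_rightHalf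
  have hpre : IsPreconnected {T : ℂ | 0 < T.re} :=
    (convex_halfSpace_re_gt 0).isPreconnected
  -- the zeros to the right of `t` accumulate at `t`
  have hfreq : ∃ᶠ z in 𝓝[≠] ((t : ℝ) : ℂ), limitGap a z = 0 := by
    have h1 : Tendsto (fun u : ℝ => (u : ℂ)) (𝓝[>] t) (𝓝[≠] (t : ℂ)) := by
      refine tendsto_nhdsWithin_of_tendsto_nhds_of_eventually_within _
        ((Complex.continuous_ofReal.tendsto t).mono_left nhdsWithin_le_nhds) ?_
      filter_upwards [self_mem_nhdsWithin] with u hu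
      simpa using (ne_of_gt hu : u ≠ t)
    refine h1.frequently (Eventually.frequently ?_)
    filter_upwards [self_mem_nhdsWithin] with u hu using hzero u (le_of_lt hu)
  have hall := han.eqOn_zero_of_preconnected_of_frequently_eq_zero hpre
    (z₀ := (t : ℂ)) ht hfreq
  have h1 : Tendsto (gap a) (𝓝[>] 0) (𝓝 0) := by
    refine tendsto_const_nhds.congr' ?_
    filter_upwards [self_mem_nhdsWithin] with u hu
    rw [gap, hall (show ((u : ℂ)) ∈ {T : ℂ | 0 < T.re} from hu)]
    rfl
  exact zero_ne_one (tendsto_nhds_unique h1 (tendsto_gap_zero ha))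

end CauchyEnsemble

/-! ### The scaling limit of the resolvent and its differential equation -/

/-- A complex derivative at a real point, read off from the restriction to the real axis. -/
lemma deriv_eq_ofReal_of_eventuallyEq {f : ℂ → ℂ} {g : ℝ → ℝ} {g' t : ℝ}
    (hf : DifferentiableAt ℂ f t) (hg : HasDerivAt g g' t) (h : ∀ᶠ y : ℝ in 𝓝 t, f y = g y) :
    deriv f t = g' :=
  (hf.hasDerivAt.comp_ofReal).unique
    (hg.ofReal_comp.congr_of_eventuallyEq (h.mono fun _ hy => hy))

namespace CauchyEnsemble
variable {a : ℝ} {N n : ℕ}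

/-- The scaled function `σ_N(N / T) / N`, for `N = n + 1`, continued to complex `T`. -/
def scaledSigma (a : ℝ) (n : ℕ) (T : ℂ) : ℂ :=
  -((1 + (T / (n + 1)) ^ 2) * deriv (scaledDet a n) T) / scaledDet a n T

/-- The negative logarithmic derivative of the limiting gap probability. -/
def limitSigma (a : ℝ) (T : ℂ) : ℂ := -deriv (limitGap a) T / limitGap a T

/-- The part of the right half plane in which the limiting gap probability does not vanish. -/
def regularSet (a : ℝ) : Set ℂ := {T | 0 < T.re ∧ limitGap a T ≠ 0}

lemma isOpen_regularSet (ha : 0 ≤ a) : IsOpen (regularSet a) :=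
  (differentiableOn_limitGap ha).continuousOn.isOpen_inter_preimage isOpen_rightHalf
    isOpen_compl_singleton

lemma ofReal_mem_regularSet (ha : 0 ≤ a) {t : ℝ} (ht : 0 < t) : (t : ℂ) ∈ regularSet a :=
  ⟨ht, by rw [limitGap_ofReal ha ht]; exact_mod_cast (gap_pos ha ht).ne'⟩

lemma tendsto_scaledSigma (ha : 0 ≤ a) {z : ℂ} (hz : z ∈ regularSet a) :
    Tendsto (fun p : ℕ × ℂ => scaledSigma a p.1 p.2) (atTop ×ˢ 𝓝 z) (𝓝 (limitSigma a z)) := by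
  have h1 : Tendsto (fun p : ℕ × ℂ => p.2 / ((p.1 : ℂ) + 1)) (atTop ×ˢ 𝓝 z) (𝓝 0) := by
    rw [tendsto_zero_iff_norm_tendsto_zero]
    refine (tendsto_norm_div_succ (T₀ := z)).congr fun p => ?_
    have : ‖((p.1 : ℂ) + 1)‖ = p.1 + 1 := by exact_mod_cast Complex.norm_natCast (p.1 + 1)
    rw [norm_div, this]
  have h2 := ((((h1.pow 2).const_add 1).mul (tendsto_deriv_scaledDet ha hz.1)).neg).div
    (tendsto_scaledDet ha hz.1) hz.2
  convert h2 using 2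
  · rfl
  · simp [limitSigma]

lemma eventually_differentiableAt_scaledSigma (ha : 0 ≤ a) {z : ℂ} (hz : z ∈ regularSet a) :
    ∀ᶠ p : ℕ × ℂ in atTop ×ˢ 𝓝 z, DifferentiableAt ℂ (scaledSigma a p.1) p.2 := by
  filter_upwards [eventually_differentiableAt_scaledDet ha hz.1,
    eventually_differentiableAt_deriv_scaledDet ha hz.1,
    (tendsto_scaledDet ha hz.1).eventually_ne hz.2] with p h1 h2 h3
  exact (DifferentiableAt.mul (by fun_prop) h2).neg.div h1 h3

lemma differentiableAt_limitSigma (ha : 0 ≤ a) {z : ℂ} (hz : z ∈ regularSet a) :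
    DifferentiableAt ℂ (limitSigma a) z :=
  (tendsto_deriv_prod (isOpen_regularSet ha) (fun _ h => tendsto_scaledSigma ha h)
    (fun _ h => eventually_differentiableAt_scaledSigma ha h) hz).1

lemma tendsto_deriv_scaledSigma (ha : 0 ≤ a) {z : ℂ} (hz : z ∈ regularSet a) :
    Tendsto (fun p : ℕ × ℂ => deriv (scaledSigma a p.1) p.2) (atTop ×ˢ 𝓝 z)
      (𝓝 (deriv (limitSigma a) z)) :=
  (tendsto_deriv_prod (isOpen_regularSet ha) (fun _ h => tendsto_scaledSigma ha h)
    (fun _ h => eventually_differentiableAt_scaledSigma ha h) hz).2.1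

lemma tendsto_deriv_deriv_scaledSigma (ha : 0 ≤ a) {z : ℂ} (hz : z ∈ regularSet a) :
    Tendsto (fun p : ℕ × ℂ => deriv (deriv (scaledSigma a p.1)) p.2) (atTop ×ˢ 𝓝 z)
      (𝓝 (deriv (deriv (limitSigma a)) z)) :=
  (tendsto_deriv_prod (F := fun n => deriv (scaledSigma a n)) (f := deriv (limitSigma a))
    (isOpen_regularSet ha) (fun _ h => tendsto_deriv_scaledSigma ha h)
    (fun _ h => (tendsto_deriv_prod (isOpen_regularSet ha) (fun _ h => tendsto_scaledSigma ha h)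
    (fun _ h => eventually_differentiableAt_scaledSigma ha h) h).2.2) hz).2.1

lemma scaledDet_ne_zero (ha : 0 ≤ a) {T : ℝ} (hT : 0 < T) : scaledDet a n T ≠ 0 := by
  rw [← gapDet_eq_scaledDet ha hT]
  exact_mod_cast (gapDet_pos ha _).ne'

lemma analyticAt_scaledDet (ha : 0 ≤ a) {T : ℝ} (hT : 0 < T) (hTn : T < n + 1) :
    AnalyticAt ℂ (scaledDet a n) T := by
  have hopen : IsOpen ({z : ℂ | 0 < z.re} ∩ Metric.ball 0 (n + 1)) :=
    isOpen_rightHalf.inter Metric.isOpen_ball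
  refine DifferentiableOn.analyticAt (s := {z : ℂ | 0 < z.re} ∩ Metric.ball 0 (n + 1))
    (fun z hz => (differentiableAt_scaledDet ha (by simpa using hz.2) hz.1).differentiableWithinAt)
    (hopen.mem_nhds ⟨hT, ?_⟩)
  rwa [mem_ball_zero_iff, Complex.norm_real, Real.norm_of_nonneg hT.le]

lemma analyticAt_scaledSigma (ha : 0 ≤ a) {T : ℝ} (hT : 0 < T) (hTn : T < n + 1) :
    AnalyticAt ℂ (scaledSigma a n) T := by
  have h1 := analyticAt_scaledDet ha hT hTn
  have h2 : AnalyticAt ℂ (fun T : ℂ => 1 + (T / (n + 1)) ^ 2) T := by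
    refine analyticAt_const.add (AnalyticAt.pow ?_ 2)
    exact analyticAt_id.div_const
  exact ((h2.mul h1.deriv).neg).div h1 (scaledDet_ne_zero ha hT)

lemma hasDerivAt_div_arg (c : ℝ) {T : ℝ} (hT : T ≠ 0) :
    HasDerivAt (fun y => c / y) (-c / T ^ 2) T := by
  simpa using (hasDerivAt_const T c).fun_div (hasDerivAt_id' T) hT

lemma scaledSigma_ofReal (ha : 0 ≤ a) {T : ℝ} (hT : 0 < T) (hTn : T < n + 1) :
    scaledSigma a n T = (sigma a (n + 1) ((n + 1) / T) / (n + 1) : ℝ) := by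
  have hder := deriv_eq_ofReal_of_eventuallyEq (analyticAt_scaledDet ha hT hTn).differentiableAt
    ((hasDerivAt_gapDet (N := n + 1) ha (((n : ℝ) + 1) / T)).comp T
      (hasDerivAt_div_arg ((n : ℝ) + 1) hT.ne'))
    (by filter_upwards [lt_mem_nhds hT] with y hy using (gapDet_eq_scaledDet ha hy).symm)
  rw [scaledSigma, hder, ← gapDet_eq_scaledDet ha hT, sigma]
  have hg := (gapDet_pos (N := n + 1) ha (((n : ℝ) + 1) / T)).ne'
  have hn : (n : ℝ) + 1 ≠ 0 := by positivity
  have hT0 := hT.ne'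
  have : -((1 + (T / ((n : ℝ) + 1)) ^ 2) * (gapDet a (n + 1) ((n + 1) / T)
      * (cauchyWeight a (n + 1) ((n + 1) / T) * diag a (n + 1) ((n + 1) / T))
      * (-((n : ℝ) + 1) / T ^ 2))) / gapDet a (n + 1) ((n + 1) / T)
      = (1 + ((n + 1) / T) ^ 2) * cauchyWeight a (n + 1) ((n + 1) / T)
        * diag a (n + 1) ((n + 1) / T) / (n + 1) := by
    field_simp
    ring
  rw [← this]
  push_cast
  rfl

lemma deriv_scaledSigma_ofReal (ha : 0 ≤ a) {T : ℝ} (hT : 0 < T) (hTn : T < n + 1) :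
    deriv (scaledSigma a n) T = (-sigma₁ a (n + 1) ((n + 1) / T) / T ^ 2 : ℝ) := by
  have h1 := (((hasDerivAt_sigma (N := n + 1) ha (((n : ℝ) + 1) / T)).comp T
      (hasDerivAt_div_arg ((n : ℝ) + 1) hT.ne')).div_const ((n : ℝ) + 1))
  rw [deriv_eq_ofReal_of_eventuallyEq (analyticAt_scaledSigma ha hT hTn).differentiableAt h1
    (by filter_upwards [Ioo_mem_nhds hT hTn] with y hy using scaledSigma_ofReal ha hy.1 hy.2)]
  congr 1
  have hn : (n : ℝ) + 1 ≠ 0 := by positivity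
  field_simp

lemma deriv_deriv_scaledSigma_ofReal (ha : 0 ≤ a) {T : ℝ} (hT : 0 < T) (hTn : T < n + 1) :
    deriv (deriv (scaledSigma a n)) T
      = (sigma₂ a (n + 1) ((n + 1) / T) * (n + 1) / T ^ 4
        + 2 * sigma₁ a (n + 1) ((n + 1) / T) / T ^ 3 : ℝ) := by
  have h1 := ((((hasDerivAt_sigma₁ (N := n + 1) ha (((n : ℝ) + 1) / T)).comp T
      (hasDerivAt_div_arg ((n : ℝ) + 1) hT.ne')).fun_neg).fun_div (hasDerivAt_pow 2 T)
      (pow_ne_zero 2 hT.ne'))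
  rw [deriv_eq_ofReal_of_eventuallyEq (analyticAt_scaledSigma ha hT hTn).deriv.differentiableAt h1
    (by filter_upwards [Ioo_mem_nhds hT hTn] with y hy using deriv_scaledSigma_ofReal ha hy.1 hy.2)]
  congr 1
  have hT0 := hT.ne'
  simp only [Function.comp_apply]
  field_simp
  ring

/-- The limiting resolvent function `σ` on the positive axis. -/
def sigmaLim (a t : ℝ) : ℝ := (limitSigma a t).re

/-- The derivative of `sigmaLim`. -/
def sigmaLim₁ (a t : ℝ) : ℝ := (deriv (limitSigma a) t).re

/-- The second derivative of `sigmaLim`. -/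
def sigmaLim₂ (a t : ℝ) : ℝ := (deriv (deriv (limitSigma a)) t).re

lemma analyticOnNhd_limitSigma (ha : 0 ≤ a) : AnalyticOnNhd ℂ (limitSigma a) (regularSet a) :=
  DifferentiableOn.analyticOnNhd
    (fun _ hz => (differentiableAt_limitSigma ha hz).differentiableWithinAt) (isOpen_regularSet ha)

lemma hasDerivAt_sigmaLim (ha : 0 ≤ a) {t : ℝ} (ht : 0 < t) :
    HasDerivAt (sigmaLim a) (sigmaLim₁ a t) t :=
  (differentiableAt_limitSigma ha (ofReal_mem_regularSet ha ht)).hasDerivAt.real_of_complex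

lemma hasDerivAt_sigmaLim₁ (ha : 0 ≤ a) {t : ℝ} (ht : 0 < t) :
    HasDerivAt (sigmaLim₁ a) (sigmaLim₂ a t) t :=
  (analyticOnNhd_limitSigma ha _
    (ofReal_mem_regularSet ha ht)).deriv.differentiableAt.hasDerivAt.real_of_complex

lemma contDiffAt_sigmaLim (ha : 0 ≤ a) {t : ℝ} (ht : 0 < t) : ContDiffAt ℝ 2 (sigmaLim a) t :=
  ((analyticOnNhd_limitSigma ha _
    (ofReal_mem_regularSet ha ht)).contDiffAt (n := 2)).real_of_complex

section Moving
variable {t : ℝ} {T : ℕ → ℝ}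

lemma tendsto_prod_ofReal (hT : Tendsto T atTop (𝓝 t)) :
    Tendsto (fun n => (n, (T n : ℂ))) atTop (atTop ×ˢ 𝓝 (t : ℂ)) :=
  tendsto_id.prodMk ((Complex.continuous_ofReal.tendsto t).comp hT)

lemma eventually_lt_succ (hT : Tendsto T atTop (𝓝 t)) : ∀ᶠ n : ℕ in atTop, T n < (n : ℝ) + 1 := by
  filter_upwards [hT.eventually_lt_const (lt_add_one t),
    (tendsto_natCast_atTop_atTop (R := ℝ)).eventually_ge_atTop t] with n h1 h2
  linarith

/-- The limit of `σ_N(N / T_n) / N` along `T_n → t`. -/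
lemma tendsto_sigma (ha : 0 ≤ a) (ht : 0 < t) (hT : Tendsto T atTop (𝓝 t)) :
    Tendsto (fun n : ℕ => sigma a (n + 1) ((n + 1) / T n) / ((n : ℝ) + 1)) atTop
      (𝓝 (sigmaLim a t)) := by
  have h := (Complex.continuous_re.tendsto _).comp
    ((tendsto_scaledSigma ha (ofReal_mem_regularSet ha ht)).comp (tendsto_prod_ofReal hT))
  refine h.congr' ?_
  filter_upwards [eventually_lt_succ hT, hT.eventually_const_lt ht] with n h1 h2
  simp only [Function.comp_apply]
  rw [scaledSigma_ofReal ha h2 h1, Complex.ofReal_re]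

lemma tendsto_sigma₁ (ha : 0 ≤ a) (ht : 0 < t) :
    Tendsto (fun n : ℕ => -sigma₁ a (n + 1) ((n + 1) / t) / t ^ 2) atTop (𝓝 (sigmaLim₁ a t)) := by
  have h := (Complex.continuous_re.tendsto _).comp ((tendsto_deriv_scaledSigma ha
    (ofReal_mem_regularSet ha ht)).comp (tendsto_prod_ofReal tendsto_const_nhds))
  refine h.congr' ?_
  filter_upwards [eventually_lt_succ (tendsto_const_nhds (x := t))] with n h1
  simp only [Function.comp_apply]
  rw [deriv_scaledSigma_ofReal ha ht h1, Complex.ofReal_re]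

lemma tendsto_sigma₂ (ha : 0 ≤ a) (ht : 0 < t) :
    Tendsto (fun n : ℕ => sigma₂ a (n + 1) ((n + 1) / t) * (n + 1) / t ^ 4
        + 2 * sigma₁ a (n + 1) ((n + 1) / t) / t ^ 3) atTop (𝓝 (sigmaLim₂ a t)) := by
  have h := (Complex.continuous_re.tendsto _).comp ((tendsto_deriv_deriv_scaledSigma ha
    (ofReal_mem_regularSet ha ht)).comp (tendsto_prod_ofReal tendsto_const_nhds))
  refine h.congr' ?_
  filter_upwards [eventually_lt_succ (tendsto_const_nhds (x := t))] with n h1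
  simp only [Function.comp_apply]
  rw [deriv_deriv_scaledSigma_ofReal ha ht h1, Complex.ofReal_re]

/-- The limit of the differential equation for finite `N`, divided by `N²`. -/
lemma sigmaLim_ode (ha : 0 ≤ a) (ht : 0 < t) :
    1 / t ^ 4 * (t ^ 4 * sigmaLim₂ a t + 2 * t ^ 3 * sigmaLim₁ a t) ^ 2
      - 4 * a ^ 2 * (sigmaLim a t + t * sigmaLim₁ a t) ^ 2
      - 4 * t ^ 2 * sigmaLim a t * sigmaLim₁ a t * (sigmaLim a t + 2 * t * sigmaLim₁ a t)
      + 4 * t ^ 4 * sigmaLim₁ a t ^ 2 - 4 * t ^ 4 * sigmaLim₁ a t ^ 3 = 0 := by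
  have hA := tendsto_sigma ha ht (tendsto_const_nhds (x := t))
  have hB := tendsto_sigma₁ ha ht
  have hC := tendsto_sigma₂ ha ht
  have hε : Tendsto (fun n : ℕ => 1 / ((n : ℝ) + 1)) atTop (𝓝 0) :=
    tendsto_one_div_add_atTop_nhds_zero_nat
  -- the equation for finite `N` is `P (1/N, σ, σ', σ'') = 0` with the scaled function and its
  -- derivatives in `T`; the limit is the case `1/N = 0`
  set P : ℝ × ℝ × ℝ × ℝ → ℝ := fun p =>
    (p.1 ^ 2 + 1 / t ^ 2) ^ 2 * (t ^ 4 * p.2.2.2 + 2 * t ^ 3 * p.2.2.1) ^ 2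
      - 4 * a ^ 2 * (p.2.1 + t * p.2.2.1) ^ 2
      - 4 * t ^ 2 * p.2.1 * p.2.2.1 * (p.2.1 + 2 * t * p.2.2.1)
      + 4 * (1 + 2 * a * p.1) * t ^ 4 * p.2.2.1 ^ 2
      - 4 * (p.1 ^ 2 + 1 / t ^ 2) * t ^ 6 * p.2.2.1 ^ 3 with hP
  have hPc : Continuous P := by fun_prop
  have hlim := (hPc.tendsto _).comp (hε.prodMk_nhds (hA.prodMk_nhds (hB.prodMk_nhds hC)))
  have hzero : ∀ n : ℕ, P (1 / ((n : ℝ) + 1), sigma a (n + 1) ((n + 1) / t) / ((n : ℝ) + 1),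
      -sigma₁ a (n + 1) ((n + 1) / t) / t ^ 2, sigma₂ a (n + 1) ((n + 1) / t) * (n + 1) / t ^ 4
        + 2 * sigma₁ a (n + 1) ((n + 1) / t) / t ^ 3) = 0 := fun n => by
    have h := odeExpr_eq_zero (n := n) ha (((n : ℝ) + 1) / t)
    have hn : (n : ℝ) + 1 ≠ 0 := by positivity
    have ht0 := ht.ne'
    rw [← zero_div (((n : ℝ) + 1) ^ 2), ← h, odeExpr, hP]
    push_cast
    field_simp
    ring
  have h0 := tendsto_nhds_unique hlim (tendsto_const_nhds.congr fun n => (hzero n).symm)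
  rw [hP] at h0
  have ht0 := ht.ne'
  rw [← h0]
  field_simp
  ring

end Moving

end CauchyEnsemble

/-! ### The behaviour at the spectrum singularity -/

namespace CauchyEnsemble
variable {a : ℝ} {N n : ℕ}

lemma hasDerivAt_gap (ha : 0 ≤ a) {t : ℝ} (ht : 0 < t) :
    HasDerivAt (gap a) (-(sigmaLim a t * gap a t)) t := by
  have h1 := ((differentiableOn_limitGap ha).differentiableAt
    (isOpen_rightHalf.mem_nhds (show 0 < (t : ℂ).re from ht))).hasDerivAt
  refine h1.real_of_complex.congr_deriv ?_
  have h2 : limitGap a t ≠ 0 := (ofReal_mem_regularSet ha ht).2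
  have h3 : deriv (limitGap a) t = -(limitSigma a t * gap a t) := by
    rw [← limitGap_ofReal ha ht, limitSigma]
    field_simp
  rw [h3, Complex.neg_re, Complex.re_mul_ofReal, sigmaLim]

lemma deriv_limitGap_ofReal (ha : 0 ≤ a) {t : ℝ} (ht : 0 < t) :
    deriv (limitGap a) t = (-(sigmaLim a t * gap a t) : ℝ) :=
  deriv_eq_ofReal_of_eventuallyEq ((differentiableOn_limitGap ha).differentiableAt
    (isOpen_rightHalf.mem_nhds (show 0 < (t : ℂ).re from ht))) (hasDerivAt_gap ha ht)
    (by filter_upwards [lt_mem_nhds ht] with y hy using limitGap_ofReal ha hy)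

lemma sigmaLim_nonneg (ha : 0 ≤ a) {t : ℝ} (ht : 0 < t) : 0 ≤ sigmaLim a t :=
  ge_of_tendsto' (tendsto_sigma ha ht tendsto_const_nhds) fun n =>
    div_nonneg (mul_nonneg (mul_nonneg (by positivity) (cauchyWeight_pos _ _ _).le)
      (diag_nonneg ha _)) (by positivity)

/-- Cauchy's estimate on the disc of radius `t / 2` turns the asymptotics of the limiting gap
probability into those of its derivative. -/
lemma abs_sigmaLim_mul_gap_sub_le (ha : 0 ≤ a) : ∃ C : ℝ, ∀ t : ℝ, 0 < t → t ≤ 1 / 2 →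
    |sigmaLim a t * gap a t - kappaLim a * t ^ (2 * a)| ≤ C * t ^ (2 * a + 1) := by
  obtain ⟨C, hC⟩ := norm_limitGap_sub_le ha
  have hC0 : 0 ≤ C := by
    have h := (norm_nonneg _).trans (hC 1 (by simp))
    simpa using h
  -- on the disc `|z| ≤ 3t/2`, and Cauchy's estimate divides by the radius `t/2`
  refine ⟨2 * C * (3 / 2) ^ (2 * a + 2), fun t ht ht2 => ?_⟩
  have hb : (2 * a + 1 : ℂ) ≠ 0 := by exact_mod_cast (by linarith : 2 * a + 1 ≠ 0)
  set e : ℂ → ℂ := fun T =>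
    limitGap a T - (1 - kappaLim a * T ^ ((2 * a + 1 : ℝ) : ℂ) / (2 * a + 1)) with he
  have hre : ∀ z ∈ Metric.closedBall (t : ℂ) (t / 2), 0 < z.re ∧ ‖z‖ ≤ 3 / 2 * t := fun z hz => by
    rw [mem_closedBall_iff_norm] at hz
    have h1 := (Complex.abs_re_le_norm (z - t)).trans hz
    have h2 := norm_le_norm_add_norm_sub' z t
    rw [Complex.norm_real, Real.norm_of_nonneg ht.le] at h2
    rw [Complex.sub_re, Complex.ofReal_re, abs_le] at h1
    exact ⟨by linarith, by linarith⟩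
  have hder : ∀ z : ℂ, 0 < z.re →
      HasDerivAt e (deriv (limitGap a) z + kappaLim a * z ^ ((2 * a : ℝ) : ℂ)) z := fun z hz => by
    have h1 := ((differentiableOn_limitGap ha).differentiableAt
      (isOpen_rightHalf.mem_nhds hz)).hasDerivAt
    have h2 := (hasDerivAt_id z).cpow_const (c := ((2 * a + 1 : ℝ) : ℂ)) (Or.inl hz)
    refine (h1.sub (((h2.const_mul (kappaLim a : ℂ)).div_const (2 * a + 1 : ℂ)).const_sub 1)).congr_deriv ?_
    rw [show ((2 * a + 1 : ℝ) : ℂ) - 1 = ((2 * a : ℝ) : ℂ) by push_cast; ring]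
    push_cast
    simp only [id]
    field_simp
    ring
  have hcl : DiffContOnCl ℂ e (Metric.ball (t : ℂ) (t / 2)) := by
    refine DifferentiableOn.diffContOnCl fun z hz => ?_
    rw [closure_ball _ (by linarith)] at hz
    exact (hder z (hre z hz).1).differentiableAt.differentiableWithinAt
  have hbound := Complex.norm_deriv_le_of_forall_mem_sphere_norm_le (f := e) (c := (t : ℂ))
    (R := t / 2) (C := C * (3 / 2 * t) ^ (2 * a + 2)) (by linarith) hcl fun z hz => by
      have h1 := hre z (Metric.sphere_subset_closedBall hz)
      refine (hC z (by linarith)).trans ?_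
      gcongr
      exact h1.2
  rw [(hder t ht).deriv, deriv_limitGap_ofReal ha ht, ← Complex.ofReal_cpow ht.le,
    ← Complex.ofReal_mul, ← Complex.ofReal_add, Complex.norm_real, Real.norm_eq_abs] at hbound
  rw [abs_sub_comm, sub_eq_neg_add]
  refine hbound.trans_eq ?_
  rw [Real.mul_rpow (by norm_num) ht.le, show 2 * a + 2 = 2 * a + 1 + 1 by ring,
    Real.rpow_add_one ht.ne' (2 * a + 1)]
  field_simp

/-- The boundary condition: `σ(t) ~ κ t^{2a}` at the origin. -/
lemma tendsto_sigmaLim_div (ha : 0 ≤ a) :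
    Tendsto (fun t => sigmaLim a t / (kappaLim a * t ^ (2 * a))) (𝓝[>] 0) (𝓝 1) := by
  obtain ⟨C, hC⟩ := abs_sigmaLim_mul_gap_sub_le ha
  have hκ := kappaLim_pos ha
  have h1 : Tendsto (fun t => sigmaLim a t * gap a t / (kappaLim a * t ^ (2 * a))) (𝓝[>] 0)
      (𝓝 1) := by
    have h0 : Tendsto (fun t : ℝ => C / kappaLim a * t) (𝓝[>] 0) (𝓝 0) :=
      ((continuous_const_mul _).tendsto' 0 0 (mul_zero _)).mono_left nhdsWithin_le_nhds
    rw [tendsto_iff_norm_sub_tendsto_zero]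
    refine squeeze_zero' (Eventually.of_forall fun _ => norm_nonneg _) ?_ h0
    filter_upwards [Ioc_mem_nhdsGT (by norm_num : (0 : ℝ) < 1 / 2)] with t ht
    have hp : 0 < kappaLim a * t ^ (2 * a) := mul_pos hκ (Real.rpow_pos_of_pos ht.1 _)
    rw [div_sub_one hp.ne', norm_div, Real.norm_eq_abs, Real.norm_of_nonneg hp.le, div_le_iff₀ hp]
    refine (hC t ht.1 ht.2).trans_eq ?_
    rw [Real.rpow_add_one ht.1.ne']
    field_simp
  have h2 := h1.div (tendsto_gap_zero ha) one_ne_zero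
  rw [div_one] at h2
  refine h2.congr' ?_
  filter_upwards [self_mem_nhdsWithin] with t ht
  have hg := (gap_pos ha ht).ne'
  simp only [Pi.div_apply]
  field_simp

/-! ### The gap probability as an exponential -/

lemma hasDerivAt_neg_log_gap (ha : 0 ≤ a) {t : ℝ} (ht : 0 < t) :
    HasDerivAt (fun u => -Real.log (gap a u)) (sigmaLim a t) t := by
  have hg := (gap_pos ha ht).ne'
  refine ((hasDerivAt_gap ha ht).log hg).fun_neg.congr_deriv ?_
  field_simp

/-- `-log` of the gap probability, with its limit `0` at the origin. -/
def negLogGap (a : ℝ) : ℝ → ℝ := Function.update (fun u => -Real.log (gap a u)) 0 0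

lemma continuousOn_negLogGap (ha : 0 ≤ a) (t : ℝ) : ContinuousOn (negLogGap a) (Icc 0 t) := by
  rw [negLogGap, continuousOn_update_iff]
  refine ⟨fun u hu => ?_, fun _ => ?_⟩
  · have hu0 : 0 < u := lt_of_le_of_ne hu.1.1 (Ne.symm hu.2)
    exact (hasDerivAt_neg_log_gap ha hu0).continuousAt.continuousWithinAt
  · have h := ((Real.continuousAt_log one_ne_zero).tendsto.comp (tendsto_gap_zero ha)).neg
    rw [Real.log_one, neg_zero] at h
    exact h.mono_left (nhdsWithin_mono _ fun u hu => lt_of_le_of_ne hu.1.1 (Ne.symm hu.2))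

lemma hasDerivAt_negLogGap (ha : 0 ≤ a) {t : ℝ} (ht : 0 < t) :
    HasDerivAt (negLogGap a) (sigmaLim a t) t := by
  refine (hasDerivAt_neg_log_gap ha ht).congr_of_eventuallyEq ?_
  filter_upwards [lt_mem_nhds ht] with u hu
  exact Function.update_of_ne hu.ne' _ _

/-- Integrability up to the origin, as the nonnegative derivative of a continuous function. -/
lemma intervalIntegrable_sigmaLim (ha : 0 ≤ a) {t : ℝ} (ht : 0 < t) :
    IntervalIntegrable (sigmaLim a) volume 0 t := by
  refine intervalIntegral.intervalIntegrable_deriv_of_nonneg (g := negLogGap a) ?_ ?_ ?_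
  · rw [uIcc_of_le ht.le]
    exact continuousOn_negLogGap ha t
  · rw [min_eq_left ht.le]
    exact fun u hu => hasDerivAt_negLogGap ha hu.1
  · rw [min_eq_left ht.le]
    exact fun u hu => sigmaLim_nonneg ha hu.1

lemma exp_neg_integral_sigmaLim (ha : 0 ≤ a) {t : ℝ} (ht : 0 < t) :
    Real.exp (-∫ y in (0 : ℝ)..t, sigmaLim a y) = gap a t := by
  rw [intervalIntegral.integral_eq_sub_of_hasDerivAt_of_le ht.le (continuousOn_negLogGap ha t)
    (fun u hu => hasDerivAt_negLogGap ha hu.1) (intervalIntegrable_sigmaLim ha ht), negLogGap,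
    Function.update_self, Function.update_of_ne ht.ne', sub_zero, neg_neg,
    Real.exp_log (gap_pos ha ht)]

/-! ### The thermodynamic limit -/

/-- In the variable `T = N / s` the end point `s = cot (t / N)` tends to `t`. -/
lemma tendsto_mul_tan_div (t : ℝ) :
    Tendsto (fun n : ℕ => ((n : ℝ) + 1) * Real.tan (t / (n + 1))) atTop (𝓝 t) := by
  have h1 : HasDerivAt (fun h : ℝ => Real.tan (t * h)) t 0 := by
    have h2 : HasDerivAt (fun h : ℝ => t * h) t 0 := by
      simpa using (hasDerivAt_id (0 : ℝ)).const_mul t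
    exact ((Real.hasDerivAt_tan (x := t * 0) (by simp)).comp 0 h2).congr_deriv (by simp)
  have h4 := h1.tendsto_slope.comp ((tendsto_nhdsWithin_iff.2
    ⟨tendsto_one_div_add_atTop_nhds_zero_nat (𝕜 := ℝ), Eventually.of_forall fun n => by
      have : (0 : ℝ) < 1 / ((n : ℝ) + 1) := by positivity
      exact this.ne'⟩ : Tendsto (fun n : ℕ => 1 / ((n : ℝ) + 1)) atTop (𝓝[≠] 0)))
  refine h4.congr fun n => ?_
  simp only [Function.comp_apply, slope_def_field, mul_zero, Real.tan_zero, sub_zero]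
  field_simp

lemma cot_eq_div (t : ℝ) (n : ℕ) :
    Real.cot (t / (n + 1)) = ((n : ℝ) + 1) / ((n + 1) * Real.tan (t / (n + 1))) := by
  have hn : (n : ℝ) + 1 ≠ 0 := by positivity
  rw [div_mul_cancel_left₀ hn, Real.tan_inv_eq_cot]

lemma angle_eq (ρ x : ℝ) (n : ℕ) :
    Real.pi * x / (((n + 1 : ℕ) : ℝ) / ρ) = Real.pi * ρ * x / (n + 1) := by
  rw [div_div_eq_mul_div]
  push_cast
  ring

end CauchyEnsemble

open CauchyEnsemble

theorem proposition7 (a : ℝ) (ha : 0 ≤ a) :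
    -- the finite `N` resolvent kernels exist and are unique
    (∀ (N : ℕ) (s : ℝ), ∃! R : ℝ → ℝ → ℝ, IsResolventKernel (cauchyKernel a N) (Ioi s) R) ∧
    ∃ σ τ : ℝ → ℝ,
      -- thermodynamic limit `N → ∞`, `L = N / ρ`, of `(1/N) σ_N(cot (π x / L))`
      (∀ ρ : ℝ, 0 < ρ → ∀ x : ℝ, 0 < x →
        Tendsto (fun N : ℕ =>
            1 / (N : ℝ) * cauchySigma a N (Real.cot (Real.pi * x / ((N : ℝ) / ρ))))
          atTop (𝓝 (σ (Real.pi * ρ * x)))) ∧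
      (∀ x : ℝ, τ x = x * σ x) ∧
      -- the differential equation
      ContDiffOn ℝ 2 τ (Ioi 0) ∧
      (∀ x : ℝ, 0 < x →
        x ^ 2 * (deriv (deriv τ) x) ^ 2
          - 4 * (x * deriv τ x - τ x) * (deriv τ x) ^ 2
          - 4 * a ^ 2 * (deriv τ x) ^ 2
          + 4 * (x * deriv τ x - τ x) ^ 2 = 0) ∧
      -- the boundary condition
      Asymptotics.IsEquivalent (𝓝[>] (0 : ℝ)) τ
        (fun x => (x / 2) ^ (2 * a + 1) /
          (Real.Gamma (a + 1 / 2) * Real.Gamma (a + 3 / 2))) ∧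
      -- the limiting probability of the gap `(0, x)`
      (∀ t : ℝ, 0 < t → IntervalIntegrable (fun y => τ y / y) volume 0 t) ∧
      (∀ ρ : ℝ, 0 < ρ → ∀ x : ℝ, 0 < x →
        Tendsto (fun N : ℕ => circularJacobiGap a ((N : ℝ) / ρ) N x)
          atTop (𝓝 (Real.exp (-∫ y in (0 : ℝ)..(Real.pi * ρ * x), τ y / y)))) := by
  have hcalc : ∀ t, 0 < t → HasDerivAt (fun x => x * sigmaLim a x)
      (sigmaLim a t + t * sigmaLim₁ a t) t := fun t ht => by
    simpa using (hasDerivAt_id t).fun_mul (hasDerivAt_sigmaLim ha ht)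
  have hcalc₂ : ∀ t, 0 < t → HasDerivAt (deriv fun x => x * sigmaLim a x)
      (2 * sigmaLim₁ a t + t * sigmaLim₂ a t) t := fun t ht => by
    have h1 := (hasDerivAt_sigmaLim ha ht).fun_add
      ((hasDerivAt_id t).fun_mul (hasDerivAt_sigmaLim₁ ha ht))
    refine (h1.congr_of_eventuallyEq ?_).congr_deriv (by simp; ring)
    filter_upwards [lt_mem_nhds ht] with u hu using (hcalc u hu).deriv
  refine ⟨fun N s => existsUnique_resolvent ha s, sigmaLim a, fun x => x * sigmaLim a x, ?_,
    fun _ => rfl, ?_, ?_, ?_, ?_, ?_⟩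
  · intro ρ hρ x hx
    rw [← tendsto_add_atTop_iff_nat 1]
    have ht : 0 < Real.pi * ρ * x := by positivity
    refine (tendsto_sigma ha ht (tendsto_mul_tan_div _)).congr fun n => ?_
    rw [cauchySigma_eq ha, angle_eq, cot_eq_div]
    push_cast
    ring
  · exact fun t ht => (contDiffAt_id.mul (contDiffAt_sigmaLim ha ht)).contDiffWithinAt
  · intro t ht
    have h := sigmaLim_ode ha ht
    have ht0 := ht.ne'
    rw [(hcalc₂ t ht).deriv, (hcalc t ht).deriv, ← h]
    field_simp
    ring
  · have hκ := kappaLim_pos ha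
    have heq : (fun x : ℝ => (x / 2) ^ (2 * a + 1)
        / (Real.Gamma (a + 1 / 2) * Real.Gamma (a + 3 / 2)))
        =ᶠ[𝓝[>] 0] fun x => kappaLim a * x ^ (2 * a + 1) := by
      filter_upwards [self_mem_nhdsWithin] with x hx
      rw [kappaLim, div_eq_mul_one_div x 2, Real.mul_rpow (le_of_lt hx) (by norm_num)]
      ring
    refine Asymptotics.IsEquivalent.congr_right ?_ heq.symm
    rw [Asymptotics.isEquivalent_iff_tendsto_one]
    · refine (tendsto_sigmaLim_div ha).congr' ?_
      filter_upwards [self_mem_nhdsWithin] with x hx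
      have hx' : 0 < x := hx
      have hp : x ^ (2 * a) ≠ 0 := (Real.rpow_pos_of_pos hx' _).ne'
      simp only [Pi.div_apply]
      rw [Real.rpow_add_one hx'.ne']
      field_simp
    · filter_upwards [self_mem_nhdsWithin] with x hx
      exact (mul_pos hκ (Real.rpow_pos_of_pos hx _)).ne'
  · intro t ht
    refine (intervalIntegrable_sigmaLim ha ht).congr fun y hy => ?_
    rw [uIoc_of_le ht.le] at hy
    exact (mul_div_cancel_left₀ _ hy.1.ne').symm
  · intro ρ hρ x hx
    have ht : 0 < Real.pi * ρ * x := by positivity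
    have hint : ∫ y in (0 : ℝ)..(Real.pi * ρ * x), y * sigmaLim a y / y
        = ∫ y in (0 : ℝ)..(Real.pi * ρ * x), sigmaLim a y := by
      refine intervalIntegral.integral_congr_ae (ae_of_all _ fun y hy => ?_)
      rw [uIoc_of_le ht.le] at hy
      exact mul_div_cancel_left₀ _ hy.1.ne'
    -- the gap fits on the circle, `x < L = N / ρ`, only for large `N`
    rw [hint, exp_neg_integral_sigmaLim ha ht, ← tendsto_add_atTop_iff_nat 1]
    refine (tendsto_gapDet ha ht (tendsto_mul_tan_div _)).congr' ?_
    filter_upwards [(tendsto_natCast_atTop_atTop (R := ℝ)).eventually_ge_atTop (ρ * x)] with n hn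
    have hL : x < ((n + 1 : ℕ) : ℝ) / ρ := by
      rw [lt_div_iff₀ hρ]
      push_cast
      linarith
    rw [circularJacobiGap_eq_gapDet ha (n + 1) hx hL, angle_eq, cot_eq_div]

end
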